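/- Let $G$ be a finite undirected connected graph on $n$ vertices with a root $r$. A schedule is an infinite sequence of matchings $M_0,M_1,\dots$ of $G$. The view $\phi_v^t$ that vertex $v$ has of the root at time $t$ is given by $\phi_v^0=0$ for all $v$, $\phi_r^t=t$ for all $t$, and, for $v\ne r$, $\phi_v^{t+1}=\max\{\phi_v^t,\phi_u^t\}$ if $v$ is matched to $u$ in $M_t$, and $\phi_v^{t+1}=\phi_v^t$ if $v$ is unmatched in $M_t$. The latency of $v$ at time $t$ is $l_v^t=t-\phi_v^t$. The Average Rooted Vector Clock problem (AvgRVC) asks for a schedule minimizing $\sup_{t\ge 0}\frac1n\sum_{v} l_v^t$; let $opt_{VC}$ be the infimum of this value over all schedules. When $G$ is a tree, the update sequence of a vertex $v$ consists of the times $t\ge 1$ with $l_v^t\le l_v^{t-1}$. A schedule is locally periodic if for every vertex $v$ the update sequence of $v$ is infinite and any two consecutive members of it differ by the same number $p^v$, the period of $v$. It is regular if, in addition, for every vertex $v\neq r$ with parent $u$ there is a number $o^v$, the offset of $v$, such that for every time $t$ in the update sequence of $v$ the largest time smaller than $t$ in the update sequence of $u$ is $t-o^v$. Theorem. There is a polynomial-time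 40-approximation algorithm for AvgRVC on trees. More precisely, there is an algorithm which, given a tree $G$ on $n$ vertices and a root $r$, computes in time polynomial in $n$ natural numbers $a_v$ and $p_v$ for all vertices $v$, such that every $p_v$ is a power of two and the following holds. The infinite schedule in which every vertex $v\ne r$ is matched to its parent exactly in the rounds $a_v+k\,p_v$, $k=0,1,2,\dots$, is a schedule (that is, in every round the chosen edges form a matching), it is regular with the periods $p_v$, and it satisfies $\sup_{t\ge 0}\frac1n\sum_v l_v^t\le 40\, opt_{VC}$. -/

import Mathlib

open scoped ENNReal

/-! ### The rooted vector clock -/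

section VectorClock

variable {V : Type*}

/-- An infinite schedule in the telephone model on the graph `G`: in every round `t` a matching
of `G` is picked, and matched vertices talk to each other between time `t` and time `t + 1`. -/
structure Schedule (G : SimpleGraph V) where
  /-- the calls made in round `t` -/
  round : ℕ → G.Subgraph
  /-- every vertex takes part in at most one call per round -/
  isMatching : ∀ t, (round t).IsMatching

variable [Fintype V] {G : SimpleGraph V}

open Classical in
/-- `S.view r t v` is the view that `v` has of the root `r` at time `t`. The supremum runs over
the vertices matched to `v` in round `t`, of which there is at most one; it is `0` if there is
none. -/
noncomputable def Schedule.view (S : Schedule G) (r : V) : ℕ → V → ℕ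
  | 0, _ => 0
  | t + 1, v =>
      if v = r then t + 1
      else max (S.view r t v)
        ((Finset.univ.filter fun u => (S.round t).Adj v u).sup fun u => S.view r t u)

/-- A view is never ahead of time, so the subtraction in `Schedule.latency` does not truncate. -/
theorem Schedule.view_le (S : Schedule G) (r : V) (t : ℕ) (v : V) : S.view r t v ≤ t := by
  induction t generalizing v with
  | zero => simp [Schedule.view]
  | succ t ih =>
    rw [Schedule.view]
    split_ifs with h
    · exact le_rfl
    · exact max_le ((ih v).trans (Nat.le_succ t))
        (Finset.sup_le fun u _ => (ih u).trans (Nat.le_succ t))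

/-- The information latency at `v` at time `t`. -/
noncomputable def Schedule.latency (S : Schedule G) (r : V) (t : ℕ) (v : V) : ℕ :=
  t - S.view r t v

/-- The largest average latency over all times, the objective of AvgRVC. -/
noncomputable def Schedule.maxAvgLatency (S : Schedule G) (r : V) : ℝ≥0∞ :=
  ⨆ t : ℕ, (∑ v : V, (S.latency r t v : ℝ≥0∞)) / (Fintype.card V : ℝ≥0∞)

/-- The optimal value of AvgRVC on the graph `G` with root `r`. -/
noncomputable def optAvgRVC (G : SimpleGraph V) (r : V) : ℝ≥0∞ :=
  ⨅ S : Schedule G, S.maxAvgLatency r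

/-! ### Locally periodic and regular schedules on trees -/

/-- In a tree `G` with root `r`, the vertex `u` is the parent of `v`. -/
def IsParent (G : SimpleGraph V) (r u v : V) : Prop :=
  G.Adj u v ∧ G.dist r v = G.dist r u + 1

/-- The time `t` is in the update sequence of `v`: there `v` hears fresh information. -/
def Schedule.IsUpdate (S : Schedule G) (r v : V) (t : ℕ) : Prop :=
  1 ≤ t ∧ S.latency r t v ≤ S.latency r (t - 1) v

/-- The schedule is locally periodic, with period `p v` at the vertex `v`: the update sequence
of `v` is an infinite arithmetic progression with difference `p v`. -/
def Schedule.IsLocallyPeriodic (S : Schedule G) (r : V) (p : V → ℕ) : Prop :=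
  ∀ v, 0 < p v ∧ ∃ t₀, ∀ t, S.IsUpdate r v t ↔ ∃ k, t = t₀ + k * p v

/-- The schedule is regular, with periods `p` and offsets `o`: it is locally periodic, and at
every update time `t` of a vertex `v` with parent `u` the last update of `u` before `t` was
exactly `o v` time units ago. -/
def Schedule.IsRegular (S : Schedule G) (r : V) (p o : V → ℕ) : Prop :=
  S.IsLocallyPeriodic r p ∧
    ∀ u v, IsParent G r u v → ∀ t, S.IsUpdate r v t →
      ∃ s, IsGreatest {s | s < t ∧ S.IsUpdate r u s} s ∧ t = s + o v

/-- The finite description `(a, p)` of an infinite schedule on a tree with root `r`: every vertex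
`v` other than the root talks to its parent exactly in the rounds
`a v, a v + p v, a v + 2 * p v, …`, and there are no other calls. -/
def Schedule.IsDescribedBy (S : Schedule G) (r : V) (a p : V → ℕ) : Prop :=
  ∀ t u v, IsParent G r u v → ((S.round t).Adj u v ↔ ∃ k, t = a v + k * p v)

end VectorClock

/-! ### Random access machines with logarithmic cost -/

namespace RAM

/-- The memory: registers, and arrays of unbounded length, all holding natural numbers. -/
structure State where
  /-- the content of register `x` -/
  reg : ℕ → ℕ
  /-- the content of cell `i` of array `a` -/
  arr : ℕ → ℕ → ℕ

/-- The arithmetic operations. -/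
inductive Op
  | add
  | sub
  | mul
  | div

/-- Truncated subtraction; division rounds down, and division by zero gives zero. -/
def Op.apply : Op → ℕ → ℕ → ℕ
  | .add, m, n => m + n
  | .sub, m, n => m - n
  | .mul, m, n => m * n
  | .div, m, n => m / n

/-- Expressions: constants, registers, array cells (indirect addressing) and arithmetic. -/
inductive Expr
  | const (c : ℕ)
  | reg (x : ℕ)
  | cell (a : ℕ) (i : Expr)
  | bin (op : Op) (e f : Expr)

/-- The value of an expression. -/
def Expr.eval (σ : State) : Expr → ℕ
  | .const c => c
  | .reg x => σ.reg x
  | .cell a i => σ.arr a (i.eval σ)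
  | .bin op e f => op.apply (e.eval σ) (f.eval σ)

/-- The logarithmic cost of evaluating an expression: one plus the number of binary digits of the
value, for every subexpression (so operands, addresses and results are all charged). -/
def Expr.cost (σ : State) : Expr → ℕ
  | .const c => 1 + Nat.size c
  | .reg x => 1 + Nat.size (σ.reg x)
  | .cell a i => 1 + Nat.size (σ.arr a (i.eval σ)) + i.cost σ
  | .bin op e f => 1 + Nat.size (op.apply (e.eval σ) (f.eval σ)) + e.cost σ + f.cost σ

/-- Programs. A test succeeds if the value of the expression is not zero. -/
inductive Prog
  | skip
  | assign (x : ℕ) (e : Expr)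
  | store (a : ℕ) (i e : Expr)
  | seq (c d : Prog)
  | ite (e : Expr) (c d : Prog)
  | loop (e : Expr) (c : Prog)

/-- `Exec c σ τ m`: the program `c`, started in the memory `σ`, halts with the memory `τ`, and the
run takes time `m`. -/
inductive Exec : Prog → State → State → ℕ → Prop
  | skip (σ : State) : Exec .skip σ σ 1
  | assign (σ : State) (x : ℕ) (e : Expr) :
      Exec (.assign x e) σ { σ with reg := Function.update σ.reg x (e.eval σ) } (1 + e.cost σ)
  | store (σ : State) (a : ℕ) (i e : Expr) :
      Exec (.store a i e) σ
        { σ with arr :=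
            Function.update σ.arr a (Function.update (σ.arr a) (i.eval σ) (e.eval σ)) }
        (1 + i.cost σ + e.cost σ)
  | seq {c d : Prog} {σ τ ρ : State} {k m : ℕ} :
      Exec c σ τ k → Exec d τ ρ m → Exec (.seq c d) σ ρ (k + m)
  | ite_true {e : Expr} {c d : Prog} {σ τ : State} {k : ℕ} :
      e.eval σ ≠ 0 → Exec c σ τ k → Exec (.ite e c d) σ τ (1 + e.cost σ + k)
  | ite_false {e : Expr} {c d : Prog} {σ τ : State} {k : ℕ} :
      e.eval σ = 0 → Exec d σ τ k → Exec (.ite e c d) σ τ (1 + e.cost σ + k)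
  | loop_done {e : Expr} {c : Prog} {σ : State} :
      e.eval σ = 0 → Exec (.loop e c) σ σ (1 + e.cost σ)
  | loop_step {e : Expr} {c : Prog} {σ τ ρ : State} {k m : ℕ} :
      e.eval σ ≠ 0 → Exec c σ τ k → Exec (.loop e c) τ ρ m →
      Exec (.loop e c) σ ρ (1 + e.cost σ + k + m)

open Classical in
/-- The initial memory for a graph on `n` vertices and a root: `n` is in register `0`, the root in
register `1`, the adjacency matrix in array `0` row by row, and zero everywhere else. -/
noncomputable def graphInput {n : ℕ} (G : SimpleGraph (Fin n)) (r : Fin n) : State where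
  reg x := if x = 0 then n else if x = 1 then (r : ℕ) else 0
  arr a i :=
    if a = 0 ∧ ∃ u v : Fin n, G.Adj u v ∧ i = (u : ℕ) * n + (v : ℕ) then 1 else 0

end RAM

/-!
A regular schedule is determined by the periods `p v` and by the offsets `o v`, the time that passes
between an update of the parent of `v` and the next update of `v`. In such a schedule the latency of
`v` is at most `p v` plus the sum of the offsets on the path from the root to `v`, so the total
latency is at most `∑ v, p v + ∑ v, size v * o v`, where `size v` is the number of vertices of the
subtree below `v` (`IsCallPlan.sum_latency_le`). Both sums are compared with the maximum `b` of the
total latency in an arbitrary schedule.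

* *Offsets.* In every schedule the information that leaves the root at time `k` is broadcast in the
  tree, and a vertex serves its children one after the other. The total delay is least if the
  children are served in decreasing order of their subtree sizes, hence
  `∑ v, size v * rank v ≤ b`, where `rank v` is the position of `v` among its siblings in this order
  (`Schedule.sum_subtreeSize_mul_rank_le`).
* *Periods.* Measure the update frequencies in units of `1 / n`: a vertex gets at most the frequency
  of its parent, and the children of a vertex get at most `n` in total. Rounding up to integers
  costs at most another `n` units, so a total of `2 * n` is allowed (`IsFeasible`).
  The update counts of an arbitrary schedule over a long time, rounded up, are feasible, and a
  vertex that is updated `U` times in `T` rounds has an average latency of at least about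
  `T / (2 * U)`. With `per i` the least power of two that is at least `8 * n / i`, the minimum of
  `∑ v, per (f v)` over all feasible frequencies `f` is therefore at most `32 * b`
  (`Schedule.le_of_forall_isFeasible`).

The algorithm finds optimal frequencies by dynamic programming, which is possible in polynomial time
as all frequencies are at most `2 * n` (`IsTable.root_le_sum` and `IsTable.sum_choices_le`). It then
places the calls: with the period `p = per f`, a vertex of frequency `f` would be content with a
fraction `1 / p ≤ f / (8 * n)` of the rounds. The children of a vertex, in decreasing order of
their subtree sizes, reserve consecutive intervals of lengths `f / (4 * n)` in the unit interval.
Each of these contains a dyadic interval of length `1 / p`, and reversing the bits turns disjoint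
dyadic intervals into disjoint residue classes modulo the periods. Since the frequency of a child is
at most the frequency of the parent, the offset of a child is at most `4 * rank`
(`IsPlacement.exists_isCallPlan`). Altogether the total latency is at most
`32 * b + 4 * b = 36 * b` (`IsPlacement.exists_schedule`).

The running time is controlled by a program logic (`RAM.Prog.wp`): a program that writes no number
above a bound `B` and iterates every loop at most `B` times runs in time polynomial in `B`, and here
`B` is `100 * n ^ 2`.
-/

/-! ### A program logic for random access machines with polynomial running times -/

namespace RAM

open Polynomial

/-- All registers and all array cells hold numbers that are at most `B`. -/
def State.Bounded (σ : State) (B : ℕ) : Prop :=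
  (∀ x, σ.reg x ≤ B) ∧ ∀ a i, σ.arr a i ≤ B

/-- A polynomial in `B` that bounds the value of an expression in every memory bounded by `B`. -/
noncomputable def Expr.valueBound : Expr → ℕ[X]
  | .const c => C c
  | .reg _ => X
  | .cell _ _ => X
  | .bin .add e f => e.valueBound + f.valueBound
  | .bin .sub e _ => e.valueBound
  | .bin .mul e f => e.valueBound * f.valueBound
  | .bin .div e _ => e.valueBound

/-- A polynomial in `B` that bounds the cost of an expression in every memory bounded by `B`. -/
noncomputable def Expr.costBound : Expr → ℕ[X]
  | .const c => 1 + C c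
  | .reg _ => 1 + X
  | .cell _ i => 1 + X + i.costBound
  | .bin op e f => 1 + (Expr.bin op e f).valueBound + e.costBound + f.costBound

/-- A polynomial in `B` that bounds the time of every run that keeps the memory bounded by `B`
and in which every loop is iterated at most `B` times. -/
noncomputable def Prog.timeBound : Prog → ℕ[X]
  | .skip => 1
  | .assign _ e => 1 + e.costBound
  | .store _ i e => 1 + i.costBound + e.costBound
  | .seq c d => c.timeBound + d.timeBound
  | .ite e c d => 1 + e.costBound + (c.timeBound + d.timeBound)
  | .loop e c => (X + 1) * (1 + e.costBound + c.timeBound)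

theorem size_le_self (m : ℕ) : Nat.size m ≤ m :=
  Nat.size_le.2 Nat.lt_two_pow_self

theorem Expr.eval_le_valueBound {σ : State} {B : ℕ} (h : σ.Bounded B) (e : Expr) :
    e.eval σ ≤ e.valueBound.eval B := by
  induction e with
  | const c => simp [Expr.eval, Expr.valueBound]
  | reg x => simpa [Expr.eval, Expr.valueBound] using h.1 x
  | cell a i _ => simpa [Expr.eval, Expr.valueBound] using h.2 a _
  | bin op e f ihe ihf =>
    cases op <;> simp only [Expr.eval, Expr.valueBound, Op.apply, eval_add, eval_mul]
    · exact Nat.add_le_add ihe ihf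
    · exact (Nat.sub_le _ _).trans ihe
    · exact Nat.mul_le_mul ihe ihf
    · exact (Nat.div_le_self _ _).trans ihe

theorem Expr.cost_le_costBound {σ : State} {B : ℕ} (h : σ.Bounded B) (e : Expr) :
    e.cost σ ≤ e.costBound.eval B := by
  induction e with
  | const c => simpa [Expr.cost, Expr.costBound] using size_le_self c
  | reg x => simpa [Expr.cost, Expr.costBound] using (size_le_self _).trans (h.1 x)
  | cell a i ih =>
    simp only [Expr.cost, Expr.costBound, eval_add, eval_one, eval_X]
    have := (size_le_self _).trans (h.2 a (i.eval σ))
    omega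
  | bin op e f ihe ihf =>
    simp only [Expr.cost, Expr.costBound, eval_add, eval_one]
    have := (size_le_self _).trans (Expr.eval_le_valueBound h (.bin op e f))
    simp only [Expr.eval] at this
    omega

/-- The memory after an assignment to a register. -/
def State.setReg (σ : State) (x v : ℕ) : State := { σ with reg := Function.update σ.reg x v }

/-- The memory after writing to an array cell. -/
def State.setArr (σ : State) (a i v : ℕ) : State :=
  { σ with arr := Function.update σ.arr a (Function.update (σ.arr a) i v) }

@[simp] theorem State.setReg_reg (σ : State) (x v y : ℕ) :
    (σ.setReg x v).reg y = if y = x then v else σ.reg y := by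
  simp [State.setReg, Function.update_apply]

@[simp] theorem State.setReg_arr (σ : State) (x v : ℕ) : (σ.setReg x v).arr = σ.arr := rfl

@[simp] theorem State.setArr_reg (σ : State) (a i v : ℕ) : (σ.setArr a i v).reg = σ.reg := rfl

@[simp] theorem State.setArr_arr (σ : State) (a i v b : ℕ) :
    (σ.setArr a i v).arr b = if b = a then Function.update (σ.arr a) i v else σ.arr b := by
  simp [State.setArr, Function.update_apply]

/-- The weakest precondition `c.wp B Q`: started there, the program `c` halts in a memory
satisfying `Q`, writes no number above `B`, and iterates every loop at most `B` times. -/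
def Prog.wp (B : ℕ) : Prog → (State → Prop) → State → Prop
  | .skip, Q, σ => Q σ
  | .assign x e, Q, σ => e.eval σ ≤ B ∧ Q (σ.setReg x (e.eval σ))
  | .store a i e, Q, σ => e.eval σ ≤ B ∧ Q (σ.setArr a (i.eval σ) (e.eval σ))
  | .seq c d, Q, σ => c.wp B (d.wp B Q) σ
  | .ite e c d, Q, σ => (e.eval σ ≠ 0 → c.wp B Q σ) ∧ (e.eval σ = 0 → d.wp B Q σ)
  | .loop e c, Q, σ => ∃ k ≤ B,
      Nat.rec (motive := fun _ => State → Prop) (fun σ => e.eval σ = 0 ∧ Q σ)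
        (fun _ W σ => e.eval σ ≠ 0 ∧ c.wp B W σ) k σ

/-- Soundness of weakest preconditions: they come with terminating runs whose time is polynomial
in the bound on the memory. -/
theorem Prog.exec_of_wp {B : ℕ} (c : Prog) {Q : State → Prop} {σ : State}
    (h : c.wp B Q σ) (hσ : σ.Bounded B) :
    ∃ τ m, Exec c σ τ m ∧ m ≤ c.timeBound.eval B ∧ τ.Bounded B ∧ Q τ := by
  induction c generalizing Q σ with
  | skip => exact ⟨σ, 1, .skip σ, by simp [Prog.timeBound], hσ, h⟩
  | assign x e =>
    refine ⟨_, _, .assign σ x e, ?_, ⟨fun y => ?_, hσ.2⟩, h.2⟩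
    · simpa [Prog.timeBound] using e.cost_le_costBound hσ
    · simp only [Function.update_apply]
      split_ifs
      exacts [h.1, hσ.1 y]
  | store a i e =>
    refine ⟨_, _, .store σ a i e, ?_, ⟨hσ.1, fun b j => ?_⟩, h.2⟩
    · have h1 := i.cost_le_costBound hσ
      have h2 := e.cost_le_costBound hσ
      simp only [Prog.timeBound, eval_add, eval_one]
      omega
    · simp only [Function.update_apply]
      split_ifs
      · simp only [Function.update_apply]
        split_ifs
        exacts [h.1, hσ.2 _ _]
      · exact hσ.2 _ _
  | seq c d ihc ihd =>
    obtain ⟨τ, m, hm, hmt, hτ, hQ⟩ := ihc h hσ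
    obtain ⟨ρ, k, hk, hkt, hρ, hQ'⟩ := ihd hQ hτ
    refine ⟨ρ, _, .seq hm hk, ?_, hρ, hQ'⟩
    simp only [Prog.timeBound, eval_add]
    omega
  | ite e c d ihc ihd =>
    have hc := e.cost_le_costBound hσ
    by_cases he : e.eval σ = 0
    · obtain ⟨τ, m, hm, hmt, hτ, hQ⟩ := ihd (h.2 he) hσ
      refine ⟨τ, _, .ite_false he hm, ?_, hτ, hQ⟩
      simp only [Prog.timeBound, eval_add, eval_one]
      omega
    · obtain ⟨τ, m, hm, hmt, hτ, hQ⟩ := ihc (h.1 he) hσ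
      refine ⟨τ, _, .ite_true he hm, ?_, hτ, hQ⟩
      simp only [Prog.timeBound, eval_add, eval_one]
      omega
  | loop e c ih =>
    obtain ⟨k, hkB, hk⟩ := h
    suffices ∃ τ m, Exec (.loop e c) σ τ m ∧
        m ≤ (k + 1) * (1 + e.costBound.eval B + c.timeBound.eval B) ∧ τ.Bounded B ∧ Q τ by
      obtain ⟨τ, m, hm, hmt, hτ, hQ⟩ := this
      refine ⟨τ, m, hm, hmt.trans ?_, hτ, hQ⟩
      simp only [Prog.timeBound, eval_mul, eval_add, eval_one, eval_X]
      gcongr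
    clear hkB
    induction k generalizing σ with
    | zero =>
      have hc := e.cost_le_costBound hσ
      exact ⟨σ, _, .loop_done hk.1, by omega, hσ, hk.2⟩
    | succ k ihk =>
      have hc := e.cost_le_costBound hσ
      obtain ⟨τ, m, hm, hmt, hτ, hQ⟩ := ih hk.2 hσ
      obtain ⟨ρ, l, hl, hlt, hρ, hQ'⟩ := ihk hτ hQ
      refine ⟨ρ, _, .loop_step hk.1 hm hl, ?_, hρ, hQ'⟩
      rw [add_mul (k + 1), one_mul]
      omega

theorem Prog.wp_mono {B : ℕ} (c : Prog) {Q Q' : State → Prop} (hQ : ∀ σ, Q σ → Q' σ) {σ : State}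
    (h : c.wp B Q σ) : c.wp B Q' σ := by
  induction c generalizing Q Q' σ with
  | skip => exact hQ _ h
  | assign x e => exact ⟨h.1, hQ _ h.2⟩
  | store a i e => exact ⟨h.1, hQ _ h.2⟩
  | seq c d ihc ihd => exact ihc (fun _ => ihd hQ) h
  | ite e c d ihc ihd => exact ⟨fun he => ihc hQ (h.1 he), fun he => ihd hQ (h.2 he)⟩
  | loop e c ih =>
    obtain ⟨k, hkB, hk⟩ := h
    refine ⟨k, hkB, ?_⟩
    clear hkB
    induction k generalizing σ with
    | zero => exact ⟨hk.1, hQ _ hk.2⟩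
    | succ k ihk => exact ⟨hk.1, ih (fun _ => ihk) hk.2⟩

instance : Add Expr := ⟨.bin .add⟩
instance : Sub Expr := ⟨.bin .sub⟩
instance : Mul Expr := ⟨.bin .mul⟩
instance : Div Expr := ⟨.bin .div⟩
/-- The remainder, computed by a division, a multiplication and a subtraction. -/
instance : Mod Expr := ⟨fun e f => e - e / f * f⟩
instance (c : ℕ) : OfNat Expr c := ⟨.const c⟩

section Eval

variable (σ : State) (e f : Expr)

@[simp] theorem Expr.eval_reg (x : ℕ) : (Expr.reg x).eval σ = σ.reg x := rfl
@[simp] theorem Expr.eval_cell (a : ℕ) : (Expr.cell a e).eval σ = σ.arr a (e.eval σ) := rfl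
@[simp] theorem Expr.eval_ofNat (c : ℕ) [c.AtLeastTwo] :
    (no_index (OfNat.ofNat c) : Expr).eval σ = OfNat.ofNat c := rfl
@[simp] theorem Expr.eval_zero : (0 : Expr).eval σ = 0 := rfl
@[simp] theorem Expr.eval_one : (1 : Expr).eval σ = 1 := rfl
@[simp] theorem Expr.eval_add : (e + f).eval σ = e.eval σ + f.eval σ := rfl
@[simp] theorem Expr.eval_sub : (e - f).eval σ = e.eval σ - f.eval σ := rfl
@[simp] theorem Expr.eval_mul : (e * f).eval σ = e.eval σ * f.eval σ := rfl
@[simp] theorem Expr.eval_div : (e / f).eval σ = e.eval σ / f.eval σ := rfl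
@[simp] theorem Expr.eval_mod : (e % f).eval σ = e.eval σ % f.eval σ := by
  change e.eval σ - e.eval σ / f.eval σ * f.eval σ = _
  rw [mul_comm]
  exact (Nat.mod_eq_sub _ _).symm

end Eval

/-- The expression is nonzero exactly if `e` and `f` have the same value. -/
def Expr.eq (e f : Expr) : Expr := 1 - ((e - f) + (f - e))

theorem Expr.eval_eq_ne_zero {σ : State} {e f : Expr} :
    (Expr.eq e f).eval σ ≠ 0 ↔ e.eval σ = f.eval σ := by
  simp [Expr.eq]
  omega

/-- The loop `for x = 0, …, e - 1 do c`. -/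
def Prog.forUp (x : ℕ) (e : Expr) (c : Prog) : Prog :=
  .seq (.assign x 0) (.loop (e - .reg x) (.seq c (.assign x (.reg x + 1))))

/-- The invariant rule for counting loops: `I i` has to hold after `i` iterations, and the body
may change neither the counter nor the value of the bound. -/
theorem Prog.wp_forUp {B : ℕ} {x : ℕ} {e : Expr} {c : Prog} {Q : State → Prop} {σ : State}
    (k : ℕ) (I : ℕ → State → Prop) (hk : k ≤ B)
    (hI : ∀ i τ, I i τ → e.eval τ = k ∧ τ.reg x = i)
    (h0 : I 0 (σ.setReg x 0))
    (hstep : ∀ i < k, ∀ τ, I i τ → c.wp B (fun ρ => ρ.reg x = i ∧ I (i + 1) (ρ.setReg x (i + 1))) τ)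
    (hQ : ∀ τ, I k τ → Q τ) : (Prog.forUp x e c).wp B Q σ := by
  refine ⟨Nat.zero_le _, k, hk, ?_⟩
  suffices ∀ j ≤ k, ∀ τ, I (k - j) τ →
      Nat.rec (motive := fun _ => State → Prop) (fun σ => (e - Expr.reg x).eval σ = 0 ∧ Q σ)
        (fun _ W σ => (e - Expr.reg x).eval σ ≠ 0 ∧
          Prog.wp B (.seq c (.assign x (.reg x + 1))) W σ) j τ by
    exact this k le_rfl _ (by simpa using h0)
  intro j
  induction j with
  | zero =>
    intro _ τ hτ
    refine ⟨?_, hQ _ hτ⟩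
    obtain ⟨h1, h2⟩ := hI _ _ hτ
    simp [h1, h2]
  | succ j ih =>
    intro hj τ hτ
    obtain ⟨h1, h2⟩ := hI _ _ hτ
    refine ⟨by simp [h1, h2]; omega, ?_⟩
    refine Prog.wp_mono c (fun ρ hρ => ?_) (hstep _ (by omega) τ hτ)
    have hjk : k - (j + 1) + 1 = k - j := by omega
    rw [hjk] at hρ
    refine ⟨?_, ?_⟩
    · simp [hρ.1]; omega
    · have : (Expr.reg x + 1).eval ρ = k - j := by simp [hρ.1]; omega
      rw [this]
      exact ih (by omega) _ hρ.2

end RAM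

/-! ### Rooted trees -/

section RootedTree

variable {V : Type*} [Fintype V] {G : SimpleGraph V} {r : V} {par : V → V}

/-- `G` is a tree with root `r`, and `par` maps every other vertex to its parent, and the root to
itself. -/
structure IsParentMap (G : SimpleGraph V) (r : V) (par : V → V) : Prop where
  root : par r = r
  adj_iff : ∀ u v, G.Adj u v ↔ v ≠ r ∧ par v = u ∨ u ≠ r ∧ par u = v
  dist_eq : ∀ v, v ≠ r → G.dist r v = G.dist r (par v) + 1
  dist_lt : ∀ v, G.dist r v < Fintype.card V

theorem SimpleGraph.IsTree.exists_isParentMap (hG : G.IsTree) (r : V) :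
    ∃ par, IsParentMap G r par := by
  classical
  have h1 (v : V) : ∃ p, v ≠ r → ∀ u, G.Adj u v → G.dist r v = G.dist r u + 1 → u = p := by
    obtain ⟨p, hp, -⟩ := hG.connected.exists_path_of_dist r v
    refine ⟨p.penultimate, fun _ u huv hd => ?_⟩
    obtain ⟨q, -, hq'⟩ := hG.connected.exists_path_of_dist r u
    have hc : (q.concat huv).IsPath := by
      apply SimpleGraph.Walk.isPath_of_length_eq_dist
      rw [SimpleGraph.Walk.length_concat, hq', hd]
    rw [(hG.existsUnique_path r v).unique hp hc, SimpleGraph.Walk.penultimate_concat]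
  have h2 (v : V) (hv : v ≠ r) : ∃ u, G.Adj u v ∧ G.dist r v = G.dist r u + 1 := by
    obtain ⟨p, hp, hl⟩ := hG.connected.exists_path_of_dist r v
    have hn : ¬ p.Nil := SimpleGraph.Walk.not_nil_of_ne hv.symm
    refine ⟨p.penultimate, p.adj_penultimate hn, ?_⟩
    rcases hG.dist_eq_dist_add_one_of_adj r (p.adj_penultimate hn) with h | h
    · exfalso
      have h3 := SimpleGraph.dist_le p.dropLast
      have h4 := p.length_dropLast_add_one hn
      omega
    · exact h
  choose q hq using h1
  choose! q' hq' using h2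
  have hqq (v : V) (hv : v ≠ r) : q' v = q v := hq v hv _ (hq' v hv).1 (hq' v hv).2
  have hr0 : G.dist r r = 0 := SimpleGraph.dist_self
  refine ⟨fun v => if v = r then r else q v, by simp, fun u v => ?_, fun v hv => ?_, fun v => ?_⟩
  · constructor
    · intro h
      rcases hG.dist_eq_dist_add_one_of_adj r h with hd | hd
      · have hu : u ≠ r := by rintro rfl; omega
        exact .inr ⟨hu, by simp [hu, hq u hu v h.symm hd]⟩
      · have hv : v ≠ r := by rintro rfl; omega
        exact .inl ⟨hv, by simp [hv, hq v hv u h hd]⟩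
    · rintro (⟨h, rfl⟩ | ⟨h, rfl⟩)
      · simpa [h, hqq v h] using (hq' v h).1
      · simpa [h, hqq u h] using (hq' u h).1.symm
  · simpa [hv, hqq v hv] using (hq' v hv).2
  · obtain ⟨p, hp, hl⟩ := hG.connected.exists_path_of_dist r v
    rw [← hl]
    exact hp.length_lt

namespace IsParentMap

variable (h : IsParentMap G r par)
include h

theorem isParent_iff {u v : V} : IsParent G r u v ↔ v ≠ r ∧ par v = u := by
  have hr0 : G.dist r r = 0 := SimpleGraph.dist_self
  constructor
  · rintro ⟨h1, h2⟩
    rcases (h.adj_iff u v).1 h1 with h3 | ⟨h3, rfl⟩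
    · exact h3
    · have := h.dist_eq u h3
      omega
  · rintro ⟨h1, rfl⟩
    exact ⟨(h.adj_iff _ _).2 (.inl ⟨h1, rfl⟩), h.dist_eq v h1⟩

theorem dist_iterate (d : ℕ) (v : V) : G.dist r (par^[d] v) = G.dist r v - d := by
  have hr0 : G.dist r r = 0 := SimpleGraph.dist_self
  induction d generalizing v with
  | zero => simp
  | succ d ih =>
    rw [Function.iterate_succ_apply, ih]
    by_cases hv : v = r
    · rw [hv, h.root, hr0]
      omega
    · have := h.dist_eq v hv
      omega

theorem dist_pos {v : V} (hv : v ≠ r) : 0 < G.dist r v := by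
  have := h.dist_eq v hv
  omega

theorem iterate_eq_root {d : ℕ} {v : V} (hd : G.dist r v ≤ d) : par^[d] v = r := by
  by_contra hne
  have h1 := h.dist_pos hne
  rw [h.dist_iterate] at h1
  omega

/-- Induction from the root downwards. -/
theorem induction_on {p : V → Prop} (v : V) (h0 : p r) (hs : ∀ v, v ≠ r → p (par v) → p v) :
    p v := by
  induction hd : G.dist r v using Nat.strong_induction_on generalizing v with
  | _ d ih =>
    by_cases hv : v = r
    · exact hv ▸ h0
    · have := h.dist_eq v hv
      exact hs v hv (ih _ (by omega) _ rfl)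

end IsParentMap

open Classical in
/-- The number of pairs `(v, d)` such that the `d`-th ancestor of `v` is `x`, where `d` is less
than the number of vertices. For `x` other than the root, this is the number of vertices of the
subtree below `x`; the root is counted several times, as it is its own parent. -/
noncomputable def subtreeSize (par : V → V) (x : V) : ℕ :=
  ∑ v, ∑ d ∈ Finset.range (Fintype.card V), if par^[d] v = x then 1 else 0

namespace IsParentMap

variable (h : IsParentMap G r par)
include h

/-- Summation of quantities that accumulate along the paths from the root. -/
theorem sum_eq_sum_subtreeSize_mul [DecidableEq V] {L o : V → ℕ} (h0 : L r = 0)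
    (hL : ∀ v, v ≠ r → L v = L (par v) + o v) :
    ∑ v, L v = ∑ x with x ≠ r, subtreeSize par x * o x := by
  classical
  have h1 (v : V) (m : ℕ) : L v = (∑ d ∈ Finset.range m,
      if par^[d] v ≠ r then o (par^[d] v) else 0) + L (par^[m] v) := by
    induction m with
    | zero => simp
    | succ m ih =>
      rw [Finset.sum_range_succ, ih, add_assoc, Function.iterate_succ_apply']
      congr 1
      by_cases hr : par^[m] v = r
      · simp [hr, h.root]
      · simp [hr, hL _ hr, add_comm]
  have h2 (v : V) : L v = ∑ x with x ≠ r, ∑ d ∈ Finset.range (Fintype.card V),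
      if par^[d] v = x then o x else 0 := by
    rw [h1 v (Fintype.card V), h.iterate_eq_root (h.dist_lt v).le, h0, add_zero, Finset.sum_comm]
    refine Finset.sum_congr rfl fun d _ => ?_
    rw [Finset.sum_ite_eq]
    simp
  rw [Finset.sum_congr rfl fun v _ => h2 v, Finset.sum_comm]
  refine Finset.sum_congr rfl fun x _ => ?_
  simp_rw [subtreeSize, Finset.sum_mul, ite_mul, one_mul, zero_mul]

theorem subtreeSize_lt_par {v : V} (hv : v ≠ r) :
    subtreeSize par v < subtreeSize par (par v) := by
  classical
  obtain ⟨m, hm⟩ : ∃ m, Fintype.card V = m + 1 :=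
    ⟨Fintype.card V - 1, by have := Fintype.card_pos_iff.2 ⟨r⟩; omega⟩
  have h1 : subtreeSize par v = ∑ x, ∑ d ∈ Finset.range m, if par^[d] x = v then 1 else 0 := by
    refine Finset.sum_congr rfl fun x _ => ?_
    have := h.dist_lt x
    rw [hm, Finset.sum_range_succ, h.iterate_eq_root (by omega : G.dist r x ≤ m), if_neg hv.symm,
      add_zero]
  have h2 : subtreeSize par (par v) =
      (∑ x, ∑ d ∈ Finset.range m, if par^[d + 1] x = par v then 1 else 0) + 1 := by
    rw [subtreeSize, hm]
    simp_rw [Finset.sum_range_succ']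
    rw [Finset.sum_add_distrib]
    congr 1
    rw [Finset.sum_eq_single (par v)] <;> simp +contextual
  rw [h1, h2, Nat.lt_succ_iff]
  refine Finset.sum_le_sum fun x _ => Finset.sum_le_sum fun d _ => ?_
  by_cases hx : par^[d] x = v
  · rw [Function.iterate_succ_apply', hx]
    simp
  · simp [hx]

theorem card_le_subtreeSize_root : Fintype.card V ≤ subtreeSize par r := by
  classical
  calc Fintype.card V = ∑ _v : V, 1 := by simp
    _ ≤ subtreeSize par r := by
      refine Finset.sum_le_sum fun v _ => ?_
      refine le_trans ?_ (Finset.single_le_sum (fun _ _ => Nat.zero_le _)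
        (Finset.mem_range.2 (h.dist_lt v)))
      simp [h.iterate_eq_root le_rfl]

theorem subtreeSize_lt_card {x : V} (hx : x ≠ r) : subtreeSize par x < Fintype.card V := by
  classical
  calc subtreeSize par x < ∑ _v : V, 1 := by
        refine Finset.sum_lt_sum (fun v _ => ?_) ⟨r, Finset.mem_univ _, ?_⟩
        · rw [Finset.sum_boole, Nat.cast_id, Finset.card_le_one]
          intro d hd e he
          simp only [Finset.mem_filter, Finset.mem_range] at hd he
          have h1 := h.dist_iterate d v
          have h2 := h.dist_iterate e v
          rw [hd.2] at h1
          rw [he.2] at h2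
          have := h.dist_pos hx
          omega
        · have h1 (d : ℕ) : par^[d] r = r := Function.iterate_fixed h.root d
          simp [h1, hx.symm]
    _ = Fintype.card V := by simp

end IsParentMap

end RootedTree

/-! ### Views on rooted trees -/

namespace Schedule

variable {V : Type*} {G : SimpleGraph V} {r : V} {par : V → V}

theorem adj_unique (S : Schedule G) {t : ℕ} {u v w : V} (h1 : (S.round t).Adj u v)
    (h2 : (S.round t).Adj u w) : v = w :=
  (S.isMatching t h1.fst_mem).unique h1 h2

variable [Fintype V]

theorem view_root (S : Schedule G) (t : ℕ) : S.view r t r = t := by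
  cases t <;> simp [Schedule.view]

theorem view_zero (S : Schedule G) (v : V) : S.view r 0 v = 0 := by
  simp [Schedule.view]

theorem view_succ_of_adj (S : Schedule G) {t : ℕ} {v w : V} (hv : v ≠ r)
    (h : (S.round t).Adj v w) : S.view r (t + 1) v = max (S.view r t v) (S.view r t w) := by
  classical
  rw [Schedule.view, if_neg hv]
  congr 1
  have : (Finset.univ.filter fun u => (S.round t).Adj v u) = {w} := by
    ext u
    simp only [Finset.mem_filter, Finset.mem_univ, true_and, Finset.mem_singleton]
    exact ⟨fun hu => S.adj_unique hu h, fun hu => hu ▸ h⟩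
  convert Finset.sup_singleton

theorem view_succ_of_not_adj (S : Schedule G) {t : ℕ} {v : V} (hv : v ≠ r)
    (h : ∀ w, ¬ (S.round t).Adj v w) : S.view r (t + 1) v = S.view r t v := by
  classical
  rw [Schedule.view, if_neg hv]
  simp [h]

theorem view_le_succ (S : Schedule G) (t : ℕ) (v : V) : S.view r t v ≤ S.view r (t + 1) v := by
  rw [Schedule.view]
  split_ifs with hv
  · exact (S.view_le r t v).trans (Nat.le_succ t)
  · exact le_max_left _ _

theorem view_mono (S : Schedule G) (v : V) : Monotone fun t => S.view r t v :=
  monotone_nat_of_le_succ fun t => S.view_le_succ t v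

/-- On a tree, no vertex is ahead of its parent. -/
theorem view_le_view_par (hp : IsParentMap G r par) (S : Schedule G) (t : ℕ) (v : V) :
    S.view r t v ≤ S.view r t (par v) := by
  induction t generalizing v with
  | zero => simp [view_zero]
  | succ t ih =>
    by_cases hv : v = r
    · rw [hv, hp.root]
    by_cases hw : ∃ w, (S.round t).Adj v w
    · obtain ⟨w, hw⟩ := hw
      rw [S.view_succ_of_adj hv hw]
      refine max_le ((ih v).trans (S.view_le_succ t _)) (le_trans ?_ (S.view_le_succ t _))
      rcases (hp.adj_iff v w).1 hw.adj_sub with ⟨-, h⟩ | ⟨-, h⟩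
      · exact (h ▸ ih w).trans (ih v)
      · rw [h]
    · push Not at hw
      rw [S.view_succ_of_not_adj hv hw]
      exact (ih v).trans (S.view_le_succ t _)

/-- On a tree, fresh information can come from the parent only. -/
theorem adj_par_of_view_lt (hp : IsParentMap G r par) (S : Schedule G) {t : ℕ} {v : V}
    (hv : v ≠ r) (h : S.view r t v < S.view r (t + 1) v) :
    (S.round t).Adj (par v) v ∧ S.view r (t + 1) v = S.view r t (par v) := by
  by_cases hw : ∃ w, (S.round t).Adj v w
  · obtain ⟨w, hw⟩ := hw
    have h1 := S.view_succ_of_adj hv hw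
    rcases (hp.adj_iff v w).1 hw.adj_sub with ⟨-, h2⟩ | ⟨-, h2⟩
    · have := S.view_le_view_par hp t w
      rw [h2] at this
      omega
    · subst h2
      exact ⟨hw.symm, by omega⟩
  · push Not at hw
    rw [S.view_succ_of_not_adj hv hw] at h
    exact absurd h (lt_irrefl _)

end Schedule

/-! ### The broadcast lower bound -/

section BroadcastBound

/-- If the delays `o` of siblings are positive and distinct, then the total delay, weighted by
`a`, is least if the siblings are served in decreasing order of their weights. Here `c x` names the
family of siblings that `x` belongs to, and `key` is an order in which `a` is monotone. -/
theorem sum_mul_rank_le_sum_mul {V W : Type*} [DecidableEq V] [DecidableEq W] (s : Finset V)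
    (a o key : V → ℕ) (c : V → W) (ho : ∀ x ∈ s, 1 ≤ o x)
    (hinj : ∀ x ∈ s, ∀ y ∈ s, c x = c y → o x = o y → x = y)
    (hkey : ∀ x ∈ s, ∀ y ∈ s, key x < key y → a x ≤ a y) :
    ∑ x ∈ s, a x * (1 + (s.filter fun y => c y = c x ∧ key x < key y).card) ≤
      ∑ x ∈ s, a x * o x := by
  have h1 : ∀ x ∈ s, 1 + (s.filter fun y => c y = c x ∧ o y < o x).card ≤ o x := by
    intro x hx
    have h2 : (s.filter fun y => c y = c x ∧ o y < o x).card ≤ (Finset.Ico 1 (o x)).card := by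
      refine Finset.card_le_card_of_injOn o (fun y hy => ?_) (fun y hy z hz hyz => ?_)
      · simp only [Finset.coe_filter, Set.mem_ofPred_eq] at hy
        simp only [Finset.coe_Ico, Set.mem_Ico]
        exact ⟨ho y hy.1, hy.2.2⟩
      · simp only [Finset.coe_filter, Set.mem_ofPred_eq] at hy hz
        exact hinj y hy.1 z hz.1 (hy.2.1.trans hz.2.1.symm) hyz
    rw [Nat.card_Ico] at h2
    have := ho x hx
    omega
  refine le_trans ?_ (Finset.sum_le_sum fun x hx => Nat.mul_le_mul_left (a x) (h1 x hx))
  simp_rw [mul_add, Finset.sum_add_distrib]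
  refine Nat.add_le_add_left ?_ _
  simp_rw [Finset.card_filter, Finset.mul_sum, mul_ite, mul_one, mul_zero]
  -- It suffices to compare the contributions of unordered pairs of siblings.
  have h3 (p : V → V → Prop) [∀ x y, Decidable (p x y)] :
      2 * ∑ x ∈ s, ∑ y ∈ s, (if p x y then a x else 0) =
        ∑ x ∈ s, ∑ y ∈ s, ((if p x y then a x else 0) + (if p y x then a y else 0)) := by
    simp_rw [Finset.sum_add_distrib]
    rw [two_mul]
    congr 1
    exact Finset.sum_comm
  refine Nat.le_of_mul_le_mul_left ?_ (two_pos : 0 < 2)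
  rw [h3, h3]
  refine Finset.sum_le_sum fun x hx => Finset.sum_le_sum fun y hy => ?_
  have h4 := hinj x hx y hy
  have h5 := hkey x hx y hy
  have h6 := hkey y hy x hx
  by_cases hc : c y = c x
  · by_cases hxy : x = y
    · simp [hxy]
    · have : o x ≠ o y := fun h => hxy (h4 hc.symm h)
      simp only [hc, true_and]
      split_ifs <;> omega
  · simp [hc, Ne.symm hc]

namespace Schedule

variable {V : Type*} [Fintype V] {G : SimpleGraph V} {r : V} {par : V → V}

theorem view_add_bound (S : Schedule G) {b : ℕ} (hb : ∀ t, ∑ v, S.latency r t v ≤ b) (t : ℕ)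
    (v : V) : t ≤ S.view r t v + b := by
  have h1 : S.latency r t v ≤ b := (Finset.single_le_sum (f := fun v => S.latency r t v)
    (fun _ _ => Nat.zero_le _) (Finset.mem_univ v)).trans (hb t)
  rw [Schedule.latency] at h1
  omega

open Classical in
/-- The first time by which `v` has information at least as recent as time `k` (and `0` if there
is no such time). -/
noncomputable def arrival (S : Schedule G) (r : V) (k : ℕ) (v : V) : ℕ :=
  if h : ∃ t, k ≤ S.view r t v then Nat.find h else 0

section Arrival

variable (S : Schedule G) {b : ℕ} (hb : ∀ t, ∑ v, S.latency r t v ≤ b)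
include hb

theorem arrival_le_iff {k t : ℕ} {v : V} : S.arrival r k v ≤ t ↔ k ≤ S.view r t v := by
  classical
  have h : ∃ t, k ≤ S.view r t v := ⟨k + b, by have := S.view_add_bound hb (k + b) v; omega⟩
  rw [arrival, dif_pos h]
  exact ⟨fun ht => (Nat.find_spec h).trans (S.view_mono v ht), fun ht => Nat.find_min' h ht⟩

theorem le_arrival (k : ℕ) (v : V) : k ≤ S.arrival r k v :=
  ((S.arrival_le_iff hb).1 le_rfl).trans (S.view_le r _ v)

theorem arrival_le (k : ℕ) (v : V) : S.arrival r k v ≤ k + b := by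
  rw [S.arrival_le_iff hb]
  have := S.view_add_bound hb (k + b) v
  omega

theorem arrival_root (k : ℕ) : S.arrival r k r = k := by
  refine le_antisymm ?_ (S.le_arrival hb k r)
  rw [S.arrival_le_iff hb, S.view_root]

theorem exists_adj_of_arrival (hp : IsParentMap G r par) {k : ℕ} (hk : 1 ≤ k) {v : V}
    (hv : v ≠ r) : ∃ t, S.arrival r k v = t + 1 ∧ (S.round t).Adj (par v) v ∧
      S.arrival r k (par v) ≤ t := by
  have h1 := S.le_arrival hb k v
  obtain ⟨t, ht⟩ : ∃ t, S.arrival r k v = t + 1 := ⟨S.arrival r k v - 1, by omega⟩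
  have h2 : k ≤ S.view r (t + 1) v := (S.arrival_le_iff hb).1 ht.le
  have h3 : ¬ k ≤ S.view r t v := fun h => by
    have := (S.arrival_le_iff hb).2 h
    omega
  obtain ⟨h4, h5⟩ := S.adj_par_of_view_lt hp hv (t := t) (by omega)
  exact ⟨t, ht, h4, (S.arrival_le_iff hb).2 (h5 ▸ h2)⟩

theorem sum_arrival_le (T : ℕ) (v : V) :
    ∑ k ∈ Finset.Icc 1 (T - b), (S.arrival r k v - k) ≤
      ∑ t ∈ Finset.range T, S.latency r t v := by
  classical
  calc ∑ k ∈ Finset.Icc 1 (T - b), (S.arrival r k v - k)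
      ≤ ∑ k ∈ Finset.Icc 1 (T - b), ∑ t ∈ Finset.range T,
          if k ≤ t ∧ t < S.arrival r k v then 1 else 0 := by
        refine Finset.sum_le_sum fun k hk => ?_
        rw [← Finset.card_filter, ← Nat.card_Ico]
        refine Finset.card_le_card fun t ht => ?_
        have := S.arrival_le hb k v
        simp only [Finset.mem_Icc, Finset.mem_Ico, Finset.mem_filter, Finset.mem_range] at *
        omega
    _ = ∑ t ∈ Finset.range T, ∑ k ∈ Finset.Icc 1 (T - b),
          if k ≤ t ∧ t < S.arrival r k v then 1 else 0 := Finset.sum_comm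
    _ ≤ _ := by
        refine Finset.sum_le_sum fun t _ => ?_
        rw [← Finset.card_filter, latency, ← Nat.card_Ioc (S.view r t v) t]
        refine Finset.card_le_card fun k hk => ?_
        simp only [Finset.mem_filter, Finset.mem_Ioc] at *
        refine ⟨?_, hk.2.1⟩
        by_contra h
        have := (S.arrival_le_iff hb).2 (not_lt.1 h)
        omega

/-- The broadcast lower bound: the information that leaves the root at any fixed time is
broadcast in the tree, and a vertex can pass it on to one child at a time only. So the delays of
the children are at least their ranks, if they are served in decreasing order of the sizes of
their subtrees. -/
theorem sum_subtreeSize_mul_rank_le [DecidableEq V] (hp : IsParentMap G r par) (key : V → ℕ)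
    (hkey : ∀ v w, key v < key w → subtreeSize par v ≤ subtreeSize par w) :
    ∑ v with v ≠ r, subtreeSize par v *
      (1 + ((Finset.univ.filter fun w => w ≠ r).filter
        fun w => par w = par v ∧ key v < key w).card) ≤ b := by
  set R := ∑ v with v ≠ r, subtreeSize par v *
      (1 + ((Finset.univ.filter fun w => w ≠ r).filter
        fun w => par w = par v ∧ key v < key w).card) with hR
  have h1 (k : ℕ) (hk : 1 ≤ k) : R ≤ ∑ v, (S.arrival r k v - k) := by
    have h2 (v : V) := S.le_arrival hb k v
    rw [hp.sum_eq_sum_subtreeSize_mul (L := fun v => S.arrival r k v - k)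
      (o := fun v => S.arrival r k v - S.arrival r k (par v)) (by simp [S.arrival_root hb])]
    · refine sum_mul_rank_le_sum_mul _ _ _ _ _ (fun v hv => ?_) (fun v hv w hw hvw ho => ?_)
        (fun v _ w _ => hkey v w)
      · obtain ⟨t, ht, -, ht'⟩ :=
          S.exists_adj_of_arrival hb hp hk (Finset.mem_filter.1 hv).2
        omega
      · obtain ⟨t, ht, hadj, ht'⟩ :=
          S.exists_adj_of_arrival hb hp hk (Finset.mem_filter.1 hv).2
        obtain ⟨t', hs, hadj', hs'⟩ :=
          S.exists_adj_of_arrival hb hp hk (Finset.mem_filter.1 hw).2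
        simp only [hvw] at ho hadj ht'
        have : t = t' := by omega
        subst this
        exact S.adj_unique hadj hadj'
    · intro v hv
      obtain ⟨t, ht, -, ht'⟩ := S.exists_adj_of_arrival hb hp hk hv
      have := h2 v
      have := h2 (par v)
      omega
  -- In the long run almost every message contributes `R` to the sum of all latencies.
  have h2 (T : ℕ) : (T - b) * R ≤ T * b := by
    calc (T - b) * R = ∑ _k ∈ Finset.Icc 1 (T - b), R := by simp
      _ ≤ ∑ k ∈ Finset.Icc 1 (T - b), ∑ v, (S.arrival r k v - k) :=
          Finset.sum_le_sum fun k hk => h1 k (Finset.mem_Icc.1 hk).1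
      _ = ∑ v, ∑ k ∈ Finset.Icc 1 (T - b), (S.arrival r k v - k) := Finset.sum_comm
      _ ≤ ∑ v, ∑ t ∈ Finset.range T, S.latency r t v :=
          Finset.sum_le_sum fun v _ => S.sum_arrival_le hb T v
      _ = ∑ t ∈ Finset.range T, ∑ v, S.latency r t v := Finset.sum_comm
      _ ≤ ∑ _t ∈ Finset.range T, b := Finset.sum_le_sum fun t _ => hb t
      _ = T * b := by simp
  by_contra! hlt
  have h3 := h2 (b + (b * b + 1))
  rw [Nat.add_sub_cancel_left] at h3
  have h4 := Nat.mul_le_mul_left (b * b + 1) (Nat.succ_le_of_lt hlt)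
  nlinarith

end Arrival

end Schedule

end BroadcastBound

/-! ### The frequency lower bound -/

section FrequencyBound

variable {V : Type*} [Fintype V] {G : SimpleGraph V} {r : V} {par : V → V}

/-- A feasible choice of the update frequencies, in units of an arbitrary common base rate: a
vertex is not updated more often than its parent, and the children of a vertex together get at most
`N` units. The root is given all the `N` units. -/
structure IsFeasible [DecidableEq V] (r : V) (par : V → V) (N : ℕ) (g : V → ℕ) : Prop where
  root : g r = N
  pos : ∀ v, v ≠ r → 1 ≤ g v
  le_par : ∀ v, v ≠ r → g v ≤ g (par v)
  sum_le : ∀ u, ∑ w with w ≠ r ∧ par w = u, g w ≤ N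

theorem IsFeasible.le [DecidableEq V] {r : V} {par : V → V} {N : ℕ} {g : V → ℕ}
    (h : IsFeasible r par N g) (v : V) : g v ≤ N := by
  by_cases hv : v = r
  · rw [hv, h.root]
  · exact (Finset.single_le_sum (fun _ _ => Nat.zero_le _) (Finset.mem_filter.2
      ⟨Finset.mem_univ v, hv, rfl⟩)).trans (h.sum_le (par v))

namespace Schedule

/-- The number of times up to `T` at which `v` gets fresh information. -/
noncomputable def updateCount (S : Schedule G) (r : V) (T : ℕ) (v : V) : ℕ :=
  ((Finset.range T).filter fun t => S.view r t v < S.view r (t + 1) v).card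

theorem updateCount_succ (S : Schedule G) (T : ℕ) (v : V) : S.updateCount r (T + 1) v =
    S.updateCount r T v + if S.view r T v < S.view r (T + 1) v then 1 else 0 := by
  rw [updateCount, updateCount, Finset.range_add_one, Finset.filter_insert]
  split_ifs
  · rw [Finset.card_insert_of_notMem (by simp)]
  · rfl

theorem updateCount_le (S : Schedule G) (T : ℕ) (v : V) : S.updateCount r T v ≤ T :=
  (Finset.card_filter_le _ _).trans (by simp)

theorem updateCount_le_par (S : Schedule G) (hp : IsParentMap G r par) (T : ℕ) {v : V}
    (hv : v ≠ r) : S.updateCount r T v ≤ S.updateCount r T (par v) := by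
  suffices S.updateCount r T v + (if S.view r T v < S.view r T (par v) then 1 else 0) ≤
      S.updateCount r T (par v) by omega
  induction T with
  | zero => simp [updateCount, view_zero]
  | succ T ih =>
    rw [updateCount_succ, updateCount_succ]
    have h1 := S.view_le_succ (r := r) T v
    have h2 := S.view_le_succ (r := r) T (par v)
    have h3 := S.view_le_view_par hp T v
    have h4 := S.adj_par_of_view_lt hp hv (t := T)
    by_cases h5 : S.view r T v < S.view r (T + 1) v
    · have h6 := (h4 h5).2
      split_ifs at ih ⊢ <;> omega
    · split_ifs at ih ⊢ <;> omega

theorem sum_updateCount_le [DecidableEq V] (S : Schedule G) (hp : IsParentMap G r par) (T : ℕ)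
    (u : V) : ∑ w with w ≠ r ∧ par w = u, S.updateCount r T w ≤ T := by
  simp only [updateCount]
  rw [← Finset.card_biUnion]
  · refine (Finset.card_le_card (t := Finset.range T) fun t ht => ?_).trans (by simp)
    simp only [Finset.mem_biUnion, Finset.mem_filter] at ht
    obtain ⟨_, _, h, _⟩ := ht
    exact h
  · intro v hv w hw hvw
    rw [Function.onFun, Finset.disjoint_left]
    intro t ht ht'
    simp only [Finset.coe_filter, Finset.mem_univ, true_and, Set.mem_ofPred_eq,
      Finset.mem_filter] at hv hw ht ht'
    refine hvw (S.adj_unique (S.adj_par_of_view_lt hp hv.1 ht.2).1 ?_)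
    rw [hv.2, ← hw.2]
    exact (S.adj_par_of_view_lt hp hw.1 ht'.2).1

/-- If `v` is updated `U` times up to time `T`, then its total latency is at least about
`h * T - U * h ^ 2 / 2`. This is the tangent in `g = h` of the convex function `g ^ 2 / 2` that
bounds the total latency over a gap of length `g` between updates. -/
theorem tangent_le_sum_latency (S : Schedule G) (hp : IsParentMap G r par) (T : ℕ) {v : V}
    (hv : v ≠ r) {h : ℝ} (hh : 0 ≤ h) :
    h * T ≤ ∑ t ∈ Finset.range T, (S.latency r t v : ℝ) + S.updateCount r T v * (h ^ 2 / 2)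
      + (h + 1 / 2) ^ 2 / 2 := by
  -- The potential accounts for the part of the current gap that is still to come.
  suffices h * T + (max (h + 1 / 2 - S.latency r T v) 0) ^ 2 / 2 ≤
      ∑ t ∈ Finset.range T, (S.latency r t v : ℝ) +
        S.updateCount r T v * (h ^ 2 / 2) + (h + 1 / 2) ^ 2 / 2 by
    have := sq_nonneg (max (h + 1 / 2 - S.latency r T v) 0)
    linarith
  induction T with
  | zero =>
    have h0 : 0 ≤ h + 1 / 2 := by linarith
    simp only [latency, zero_tsub, Nat.cast_zero, sub_zero, max_eq_left h0]
    simp [updateCount]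
  | succ T ih =>
    rw [Finset.sum_range_succ, updateCount_succ]
    set q := S.latency r T v with hq
    have hW : (1 : ℝ) / 2 * max (h + 1 / 2 - q) 0 ^ 2 ≥ h - q := by
      rcases le_total (h + 1 / 2 - q) 0 with h0 | h0
      · rw [max_eq_right h0]
        linarith
      · rw [max_eq_left h0]
        nlinarith [sq_nonneg (h + 1 / 2 - q - 1)]
    by_cases hu : S.view r T v < S.view r (T + 1) v
    · have h1 : 1 ≤ S.latency r (T + 1) v := by
        have h2 := (S.adj_par_of_view_lt hp hv hu).2
        have h3 := S.view_le r T (par v)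
        rw [latency]
        omega
      have h2 : max (h + 1 / 2 - (S.latency r (T + 1) v : ℝ)) 0 ^ 2 ≤ h ^ 2 := by
        have h3 : (1 : ℝ) ≤ S.latency r (T + 1) v := by exact_mod_cast h1
        rcases le_total (h + 1 / 2 - (S.latency r (T + 1) v : ℝ)) 0 with h0 | h0
        · rw [max_eq_right h0]
          nlinarith
        · rw [max_eq_left h0]
          nlinarith
      rw [if_pos hu]
      push_cast
      nlinarith
    · have h1 : S.latency r (T + 1) v = q + 1 := by
        have h2 := S.view_le_succ (r := r) T v
        have h3 := S.view_le r T v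
        rw [hq, latency, latency]
        omega
      rw [if_neg hu, h1]
      push_cast
      have h2 : max (h + 1 / 2 - ((q : ℝ) + 1)) 0 ^ 2 / 2 ≤
          max (h + 1 / 2 - q) 0 ^ 2 / 2 - (h - q) := by
        rcases le_total (h + 1 / 2 - ((q : ℝ) + 1)) 0 with h0 | h0
        · rw [max_eq_right h0]
          linarith
        · rw [max_eq_left h0, max_eq_left (by linarith)]
          nlinarith
      linarith

/-- The frequency lower bound: the numbers of updates of a schedule give a feasible choice of
frequencies, and the latency of a vertex is on average at least half of its period. -/
theorem le_of_forall_isFeasible [DecidableEq V] (S : Schedule G) (hp : IsParentMap G r par) {b : ℕ}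
    (hb : ∀ t, ∑ v, S.latency r t v ≤ b) {n : ℕ} (hn : Fintype.card V = n) {per : ℕ → ℕ}
    (hper : ∀ i, 1 ≤ i → i ≤ 2 * n → per i * i < 16 * n) {c : ℕ}
    (hc : ∀ g, IsFeasible r par (2 * n) g → c ≤ ∑ v with v ≠ r, per (g v)) : c ≤ 32 * b := by
  have hn1 : 1 ≤ n := hn ▸ Fintype.card_pos_iff.2 ⟨r⟩
  have hcard : ((Finset.univ : Finset V).filter fun v => v ≠ r).card = n - 1 := by
    rw [Finset.filter_ne', Finset.card_erase_of_mem (Finset.mem_univ r), Finset.card_univ, hn]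
  have key (T : ℕ) (hT : 1 ≤ T) : (T * c : ℝ) ≤ 32 * (T * b) + n * (16 * (n + 1) ^ 2) := by
    -- Rounding up costs one unit per vertex, which is why there are `2 * n` units and not only `n`.
    let g : V → ℕ := fun v => if v = r then 2 * n else n * S.updateCount r T v / T + 1
    have hg {v : V} (hv : v ≠ r) : g v = n * S.updateCount r T v / T + 1 := if_neg hv
    have hg1 {v : V} (hv : v ≠ r) : 1 ≤ g v := by
      rw [hg hv]
      exact Nat.le_add_left 1 _
    have hle {v : V} (hv : v ≠ r) : g v ≤ n + 1 := by
      rw [hg hv]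
      gcongr
      apply Nat.div_le_of_le_mul
      rw [mul_comm]
      exact Nat.mul_le_mul_right n (S.updateCount_le T v)
    have hgf : IsFeasible r par (2 * n) g := by
      refine ⟨if_pos rfl, fun v hv => hg1 hv, fun v hv => ?_, fun u => ?_⟩
      · by_cases hu : par v = r
        · have := hle hv
          have h2 : g (par v) = 2 * n := if_pos hu
          omega
        · rw [hg hv, hg hu]
          gcongr
          exact S.updateCount_le_par hp T hv
      · calc ∑ w with w ≠ r ∧ par w = u, g w
            = ∑ w with w ≠ r ∧ par w = u, (n * S.updateCount r T w / T + 1) :=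
              Finset.sum_congr rfl fun w hw => hg (Finset.mem_filter.1 hw).2.1
          _ = ∑ w with w ≠ r ∧ par w = u, n * S.updateCount r T w / T +
                ((Finset.univ : Finset V).filter fun w => w ≠ r ∧ par w = u).card := by
              rw [Finset.sum_add_distrib]
              simp
          _ ≤ n + (n - 1) := by
              refine Nat.add_le_add ?_ ?_
              · refine Nat.le_of_mul_le_mul_right (c := T) ?_ (by omega)
                rw [Finset.sum_mul]
                calc ∑ w with w ≠ r ∧ par w = u, n * S.updateCount r T w / T * T
                    ≤ ∑ w with w ≠ r ∧ par w = u, n * S.updateCount r T w :=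
                      Finset.sum_le_sum fun w _ => Nat.div_mul_le_self _ _
                  _ ≤ n * T := by
                      rw [← Finset.mul_sum]
                      exact Nat.mul_le_mul_left n (S.sum_updateCount_le hp T u)
              · rw [← hcard]
                exact Finset.card_le_card fun w hw => by
                  simp only [Finset.mem_filter] at hw ⊢
                  exact ⟨hw.1, hw.2.1⟩
          _ ≤ 2 * n := by omega
    have h1 (v : V) (hv : v ≠ r) : (T * per (g v) : ℝ) ≤
        32 * ∑ t ∈ Finset.range T, (S.latency r t v : ℝ) + 16 * (n + 1) ^ 2 := by
      have h2 := hper (g v) (hg1 hv) (by have := hle hv; omega)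
      have h3 : S.updateCount r T v * per (g v) ≤ 16 * T := by
        have h4 : n * S.updateCount r T v < T * g v := by
          rw [hg hv]
          exact Nat.lt_mul_div_succ _ (by omega)
        have h5 : n * (S.updateCount r T v * per (g v)) ≤ n * (16 * T) := by
          calc n * (S.updateCount r T v * per (g v))
              = n * S.updateCount r T v * per (g v) := by ring
            _ ≤ T * g v * per (g v) := Nat.mul_le_mul_right _ h4.le
            _ = T * (per (g v) * g v) := by ring
            _ ≤ T * (16 * n) := Nat.mul_le_mul_left _ h2.le
            _ = n * (16 * T) := by ring
        exact Nat.le_of_mul_le_mul_left h5 (by omega)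
      have h4 : per (g v) ≤ 16 * n :=
        (Nat.le_mul_of_pos_right _ (hg1 hv)).trans h2.le
      -- The mean gap between updates is at least `per (g v) / 16`, and the tangent at this point
      -- gives a bound that is linear in the period.
      have h5 := S.tangent_le_sum_latency hp T hv (h := per (g v) / 16) (by positivity)
      have h6 : (S.updateCount r T v * per (g v) : ℝ) ≤ 16 * T := by exact_mod_cast h3
      have h7 : (per (g v) : ℝ) ≤ 16 * n := by exact_mod_cast h4
      have h8 : (0 : ℝ) ≤ per (g v) := by positivity
      have h9 : (S.updateCount r T v : ℝ) * ((per (g v) / 16 : ℝ) ^ 2 / 2) ≤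
          T * per (g v) / 32 := by
        calc (S.updateCount r T v : ℝ) * ((per (g v) / 16 : ℝ) ^ 2 / 2)
            = (S.updateCount r T v * per (g v)) * (per (g v) / 512) := by ring
          _ ≤ 16 * T * (per (g v) / 512) := by gcongr
          _ = T * per (g v) / 32 := by ring
      have h10 : ((per (g v) / 16 : ℝ) + 1 / 2) ^ 2 / 2 ≤ (n + 1) ^ 2 / 2 := by
        gcongr
        · linarith
        · norm_num
      linarith
    have h2 : (T * c : ℝ) ≤ ∑ v with v ≠ r, (T * per (g v) : ℝ) := by
      rw [← Finset.mul_sum]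
      have := hc g hgf
      gcongr
      exact_mod_cast this
    have h3 : ∑ v with v ≠ r, ∑ t ∈ Finset.range T, (S.latency r t v : ℝ) ≤ T * b := by
      have : ∑ v with v ≠ r, ∑ t ∈ Finset.range T, S.latency r t v ≤ T * b := by
        calc ∑ v with v ≠ r, ∑ t ∈ Finset.range T, S.latency r t v
            ≤ ∑ v, ∑ t ∈ Finset.range T, S.latency r t v :=
              Finset.sum_le_sum_of_subset (Finset.filter_subset _ _)
          _ = ∑ t ∈ Finset.range T, ∑ v, S.latency r t v := Finset.sum_comm
          _ ≤ ∑ _t ∈ Finset.range T, b := Finset.sum_le_sum fun t _ => hb t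
          _ = T * b := by simp
      exact_mod_cast this
    calc (T * c : ℝ) ≤ ∑ v with v ≠ r, (T * per (g v) : ℝ) := h2
      _ ≤ ∑ v with v ≠ r, (32 * ∑ t ∈ Finset.range T, (S.latency r t v : ℝ) +
            16 * (n + 1) ^ 2) :=
          Finset.sum_le_sum fun v hv => h1 v (Finset.mem_filter.1 hv).2
      _ = 32 * ∑ v with v ≠ r, ∑ t ∈ Finset.range T, (S.latency r t v : ℝ) +
            (n - 1 : ℕ) * (16 * (n + 1) ^ 2) := by
          rw [Finset.sum_add_distrib, ← Finset.mul_sum, Finset.sum_const, hcard, nsmul_eq_mul]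
      _ ≤ _ := by
          gcongr
          exact Nat.sub_le n 1
  -- The error term does not depend on `T`.
  by_contra! hlt
  have h1 := key (n * (16 * (n + 1) ^ 2) + 1) (by omega)
  have h2 : (32 * b + 1 : ℝ) ≤ c := by exact_mod_cast hlt
  have h3 : (0 : ℝ) ≤ n * (16 * (n + 1) ^ 2) := by positivity
  push_cast at h1
  nlinarith

end Schedule

end FrequencyBound

/-! ### Schedules from periods and offsets -/

section CallPlan

variable {V : Type*} [Fintype V] {G : SimpleGraph V} {r : V} {par : V → V} {a p o : V → ℕ}

/-- First calls `a`, periods `p` and offsets `o` that fit together to a regular schedule: a call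
of `v` to its parent is `o v` rounds after a call of the parent to its own parent. The root counts
as being called in every round. -/
structure IsCallPlan (r : V) (par : V → V) (a p o : V → ℕ) : Prop where
  root_first : a r = 0
  root_period : p r = 1
  first_lt : ∀ v, a v < p v
  period_dvd : ∀ v, v ≠ r → p (par v) ∣ p v
  offset_pos : ∀ v, v ≠ r → 1 ≤ o v
  offset_le : ∀ v, v ≠ r → o v ≤ p (par v)
  offset_lt : ∀ v, v ≠ r → par v ≠ r → o v < p (par v)
  first_modEq : ∀ v, v ≠ r → a v ≡ a (par v) + o v [MOD p (par v)]
  disjoint : ∀ v w, v ≠ r → w ≠ r → par v = par w → v ≠ w →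
    ∀ t, ¬ (t ≡ a v [MOD p v] ∧ t ≡ a w [MOD p w])

namespace IsCallPlan

omit [Fintype V] in
theorem modEq_par (h : IsCallPlan r par a p o) {v : V} (hv : v ≠ r) {t : ℕ}
    (ht : t ≡ a v [MOD p v]) : t ≡ a (par v) + o v [MOD p (par v)] :=
  (ht.of_dvd (h.period_dvd v hv)).trans (h.first_modEq v hv)

omit [Fintype V] in
/-- A vertex is not called by its parent when it calls one of its children. -/
theorem not_modEq_par (h : IsCallPlan r par a p o) {v : V} (hv : v ≠ r) (hu : par v ≠ r) {t : ℕ}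
    (ht : t ≡ a v [MOD p v]) : ¬ t ≡ a (par v) [MOD p (par v)] := by
  intro ht'
  have h1 : a (par v) + 0 ≡ a (par v) + o v [MOD p (par v)] := ht'.symm.trans (h.modEq_par hv ht)
  have h2 := (Nat.ModEq.add_left_cancel' _ h1).symm
  rw [Nat.modEq_zero_iff_dvd] at h2
  have h3 := Nat.le_of_dvd (h.offset_pos v hv) h2
  exact absurd (h.offset_lt v hv hu) (not_lt.2 h3)

/-- The schedule in which every vertex `v` is called by its parent in the rounds that are `a v`
modulo `p v`. -/
def schedule (h : IsCallPlan r par a p o) (hp : IsParentMap G r par) : Schedule G where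
  round t :=
    { verts := {u | ∃ w, (w ≠ r ∧ par w = u ∧ t ≡ a w [MOD p w]) ∨
        (u ≠ r ∧ par u = w ∧ t ≡ a u [MOD p u])}
      Adj := fun u w => (w ≠ r ∧ par w = u ∧ t ≡ a w [MOD p w]) ∨
        (u ≠ r ∧ par u = w ∧ t ≡ a u [MOD p u])
      adj_sub := by
        rintro u w (⟨h1, h2, -⟩ | ⟨h1, h2, -⟩)
        · exact (hp.adj_iff u w).2 (.inl ⟨h1, h2⟩)
        · exact (hp.adj_iff u w).2 (.inr ⟨h1, h2⟩)
      edge_vert := fun {u w} hw => ⟨w, hw⟩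
      symm := ⟨fun u w => Or.symm⟩ }
  isMatching t := by
    rintro u ⟨w, hw⟩
    refine ⟨w, hw, fun w' hw' => ?_⟩
    rcases hw with ⟨h1, h2, h3⟩ | ⟨h1, h2, h3⟩ <;> rcases hw' with ⟨h1', h2', h3'⟩ | ⟨h1', h2', h3'⟩
    · by_contra hne
      exact h.disjoint w' w h1' h1 (h2'.trans h2.symm) hne t ⟨h3', h3⟩
    · subst h2
      exact absurd h3' (h.not_modEq_par h1 h1' h3)
    · subst h2'
      exact absurd h3 (h.not_modEq_par h1' h1 h3')
    · exact h2'.symm.trans h2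

section

variable (h : IsCallPlan r par a p o) (hp : IsParentMap G r par)

theorem schedule_adj {t : ℕ} {u w : V} : ((h.schedule hp).round t).Adj u w ↔
    (w ≠ r ∧ par w = u ∧ t ≡ a w [MOD p w]) ∨ (u ≠ r ∧ par u = w ∧ t ≡ a u [MOD p u]) := Iff.rfl

theorem schedule_adj_par {t : ℕ} {v : V} (hv : v ≠ r) :
    ((h.schedule hp).round t).Adj (par v) v ↔ t ≡ a v [MOD p v] := by
  rw [schedule_adj]
  refine ⟨?_, fun ht => .inl ⟨hv, rfl, ht⟩⟩
  rintro (⟨-, -, h1⟩ | ⟨h1, h2, -⟩)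
  · exact h1
  · have h3 := hp.dist_eq v hv
    have h4 := hp.dist_eq _ h1
    rw [h2] at h4
    omega

theorem schedule_isDescribedBy : (h.schedule hp).IsDescribedBy r a p := by
  intro t u v huv
  obtain ⟨hv, rfl⟩ := hp.isParent_iff.1 huv
  rw [h.schedule_adj_par hp hv]
  constructor
  · intro ht
    refine ⟨t / p v, ?_⟩
    have h4 : t % p v = a v := by rw [ht, Nat.mod_eq_of_lt (h.first_lt v)]
    rw [← h4, mul_comm, Nat.mod_add_div]
  · rintro ⟨k, rfl⟩
    rw [Nat.ModEq, Nat.add_mul_mod_self_right]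

open Classical in
/-- The sum of the offsets on the path from the root to `v`, the latency of `v` right after an
update. -/
noncomputable def delay (r : V) (par : V → V) (o : V → ℕ) (v : V) : ℕ :=
  ∑ d ∈ Finset.range (Fintype.card V), if par^[d] v = r then 0 else o (par^[d] v)

omit h in
include hp in
theorem delay_root : delay r par o r = 0 := by
  have h1 (d : ℕ) : par^[d] r = r := Function.iterate_fixed hp.root d
  simp [delay, h1]

omit h in
include hp in
theorem delay_eq {v : V} (hv : v ≠ r) : delay r par o v = delay r par o (par v) + o v := by
  have h1 := hp.dist_lt v
  obtain ⟨m, hm⟩ : ∃ m, Fintype.card V = m + 1 := ⟨Fintype.card V - 1, by omega⟩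
  have h2 : par^[m] (par v) = r := by
    rw [← Function.iterate_succ_apply]
    exact hp.iterate_eq_root (by omega)
  rw [delay, delay, hm, Finset.sum_range_succ', Finset.sum_range_succ, if_pos h2, add_zero,
    Function.iterate_zero_apply, if_neg hv]
  rfl

end

/-- The last time up to `t` at which `v` is updated, in the schedule extended to negative times. -/
def lastCall (a p : V → ℕ) (t : ℕ) (v : V) : ℤ := t - (t - 1 - a v : ℤ) % p v

omit [Fintype V] in
/-- `lastCall` is characterized by its residue and its distance from `t`. -/
theorem lastCall_eq_of {t : ℕ} {v : V} {s : ℤ} (h1 : s ≤ t) (h2 : t < s + p v)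
    (h3 : (p v : ℤ) ∣ s - 1 - a v) : lastCall a p t v = s := by
  have h4 : (t - 1 - a v : ℤ) % p v = t - s := by
    obtain ⟨k, hk⟩ := h3
    have h5 : (t - 1 - a v : ℤ) = (t - s) + p v * k := by rw [← hk]; ring
    rw [h5, Int.add_mul_emod_self_left]
    exact Int.emod_eq_of_lt (by omega) (by omega)
  rw [lastCall, h4]
  ring

omit [Fintype V] in
theorem dvd_lastCall (t : ℕ) (v : V) : (p v : ℤ) ∣ lastCall a p t v - 1 - a v := by
  have h1 := Int.dvd_self_sub_of_emod_eq (a := (t - 1 - a v : ℤ)) (b := p v) rfl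
  rw [lastCall]
  convert h1 using 1
  ring

section

variable (h : IsCallPlan r par a p o)
include h

omit [Fintype V] in
theorem period_pos (v : V) : 0 < p v := (Nat.zero_le _).trans_lt (h.first_lt v)

omit [Fintype V] in
theorem lastCall_le (t : ℕ) (v : V) : lastCall a p t v ≤ t := by
  have := Int.emod_nonneg (t - 1 - a v : ℤ) (by have := h.period_pos v; omega : (p v : ℤ) ≠ 0)
  rw [lastCall]
  omega

omit [Fintype V] in
theorem lt_lastCall_add (t : ℕ) (v : V) : t < lastCall a p t v + p v := by
  have := Int.emod_lt_of_pos (t - 1 - a v : ℤ) (by have := h.period_pos v; omega : (0 : ℤ) < p v)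
  rw [lastCall]
  omega

omit [Fintype V] in
theorem lastCall_succ_of_modEq {t : ℕ} {v : V} (ht : t ≡ a v [MOD p v]) :
    lastCall a p (t + 1) v = t + 1 := by
  refine lastCall_eq_of (by push_cast; omega) (by have := h.period_pos v; push_cast; omega) ?_
  have h1 := Nat.modEq_iff_dvd.1 ht.symm
  convert h1 using 1
  ring

omit [Fintype V] in
theorem lastCall_succ_of_not_modEq {t : ℕ} {v : V} (ht : ¬ t ≡ a v [MOD p v]) :
    lastCall a p (t + 1) v = lastCall a p t v := by
  have h1 := h.lastCall_le t v
  have h2 := h.lt_lastCall_add t v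
  have h3 := dvd_lastCall (a := a) (p := p) t v
  refine lastCall_eq_of (by push_cast; omega) ?_ h3
  by_contra h4
  refine ht (Nat.modEq_iff_dvd.2 ?_)
  have h5 : lastCall a p t v = t + 1 - p v := by push_cast at h4; omega
  rw [h5] at h3
  obtain ⟨k, hk⟩ := h3
  exact ⟨-k - 1, by linear_combination -hk⟩

omit [Fintype V] in
theorem lastCall_root (t : ℕ) : lastCall a p t r = t := by
  simp [lastCall, h.root_period]

variable (hp : IsParentMap G r par)

/-- The views in the schedule of a call plan: the information that `v` gets at an update is as old
as `delay r par o v`. -/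
theorem view_schedule (t : ℕ) (v : V) :
    (h.schedule hp).view r t v = (lastCall a p t v - delay r par o v).toNat := by
  induction t generalizing v with
  | zero =>
    have := h.lastCall_le 0 v
    rw [Schedule.view_zero]
    omega
  | succ t ih =>
    by_cases hv : v = r
    · rw [hv, Schedule.view_root, h.lastCall_root, delay_root hp]
      omega
    by_cases ht : t ≡ a v [MOD p v]
    · rw [Schedule.view_succ_of_adj _ hv (((h.schedule_adj_par hp hv).2 ht).symm), ih, ih,
        h.lastCall_succ_of_modEq ht, delay_eq hp hv]
      have h1 := h.lastCall_le t v
      have h2 : lastCall a p t (par v) = t + 1 - o v := by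
        have h3 := h.offset_pos v hv
        have h4 := h.offset_le v hv
        refine lastCall_eq_of (by omega) (by omega) ?_
        have h5 := Nat.modEq_iff_dvd.1 (h.modEq_par hv ht).symm
        convert h5 using 1
        push_cast
        ring
      rw [h2]
      omega
    · rw [h.lastCall_succ_of_not_modEq ht, ← ih]
      have h1 := (h.schedule hp).view_le_succ (r := r) t v
      by_contra hne
      exact ht ((h.schedule_adj_par hp hv).1
        ((h.schedule hp).adj_par_of_view_lt hp hv (lt_of_le_of_ne h1 (Ne.symm hne))).1)

theorem isUpdate_iff {v : V} {t : ℕ} : (h.schedule hp).IsUpdate r v t ↔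
    delay r par o v < t ∧ t ≡ a v + 1 [MOD p v] := by
  cases t with
  | zero => simp [Schedule.IsUpdate]
  | succ t =>
    have h1 := (h.schedule hp).view_le r t v
    have h2 := (h.schedule hp).view_le r (t + 1) v
    have h3 : (h.schedule hp).IsUpdate r v (t + 1) ↔
        (h.schedule hp).view r t v < (h.schedule hp).view r (t + 1) v := by
      rw [Schedule.IsUpdate, Schedule.latency, Schedule.latency, Nat.add_sub_cancel]
      omega
    have h4 : t + 1 ≡ a v + 1 [MOD p v] ↔ t ≡ a v [MOD p v] :=
      ⟨Nat.ModEq.add_right_cancel' 1, Nat.ModEq.add_right 1⟩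
    rw [h3, h4, h.view_schedule hp, h.view_schedule hp]
    by_cases ht : t ≡ a v [MOD p v]
    · rw [h.lastCall_succ_of_modEq ht]
      have := h.lastCall_le t v
      simp only [ht, and_true]
      omega
    · rw [h.lastCall_succ_of_not_modEq ht]
      simp [ht]

theorem isRegular : ∃ o', (h.schedule hp).IsRegular r p o' := by
  refine ⟨o, fun v => ⟨h.period_pos v, ?_⟩, fun u v huv t ht => ?_⟩
  · have h0 := h.period_pos v
    have hex : ∃ t, delay r par o v < t ∧ t ≡ a v + 1 [MOD p v] := by
      refine ⟨a v + 1 + delay r par o v * p v, ?_, ?_⟩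
      · have := Nat.le_mul_of_pos_right (delay r par o v) h0
        omega
      · rw [Nat.ModEq, Nat.add_mul_mod_self_right]
    classical
    obtain ⟨h1, h2⟩ := Nat.find_spec hex
    refine ⟨Nat.find hex, fun t => ?_⟩
    rw [h.isUpdate_iff hp]
    constructor
    · intro ht
      have h3 := Nat.find_min' hex ht
      obtain ⟨k, hk⟩ := (Nat.modEq_iff_dvd' h3).1 (h2.trans ht.2.symm)
      exact ⟨k, by rw [mul_comm, ← hk]; omega⟩
    · rintro ⟨k, hk⟩
      refine ⟨by omega, ?_⟩
      rw [hk, Nat.ModEq, Nat.add_mul_mod_self_right]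
      exact h2
  · obtain ⟨hv, rfl⟩ := hp.isParent_iff.1 huv
    obtain ⟨h1, h2⟩ := (h.isUpdate_iff hp).1 ht
    rw [delay_eq hp hv] at h1
    have h3 := h.offset_pos v hv
    have h4 := h.offset_le v hv
    have h5 : t - o v ≡ a (par v) + 1 [MOD p (par v)] := by
      refine Nat.ModEq.add_right_cancel' (o v) ?_
      rw [Nat.sub_add_cancel (by omega)]
      refine (h2.of_dvd (h.period_dvd v hv)).trans ?_
      rw [add_right_comm]
      exact (h.first_modEq v hv).add_right 1
    refine ⟨t - o v, ⟨⟨by omega, ?_⟩, fun s hs => ?_⟩, by omega⟩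
    · rw [h.isUpdate_iff hp]
      exact ⟨by omega, h5⟩
    · have h6 := (h.isUpdate_iff hp).1 hs.2
      by_contra! h7
      have h8 := (Nat.modEq_iff_dvd' h7.le).1 (h5.trans h6.2.symm)
      have h9 := Nat.le_of_dvd (by omega) h8
      have := hs.1
      omega

theorem sum_latency_le [DecidableEq V] (t : ℕ) : ∑ v, (h.schedule hp).latency r t v ≤
    ∑ v with v ≠ r, p v + ∑ v with v ≠ r, subtreeSize par v * o v := by
  rw [← hp.sum_eq_sum_subtreeSize_mul (delay_root (o := o) hp) fun v hv => delay_eq hp hv,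
    Finset.sum_filter, ← Finset.sum_add_distrib]
  refine Finset.sum_le_sum fun v _ => ?_
  rw [Schedule.latency]
  by_cases hv : v = r
  · rw [hv, Schedule.view_root]
    omega
  · rw [if_pos hv, h.view_schedule hp]
    have h1 := h.lt_lastCall_add t v
    omega

end

end IsCallPlan

end CallPlan

/-! ### Placing the calls -/

section Placement

/-- The round given to the `J`-th dyadic interval of level `d`: there are `P` rounds in a period of
the parent, the first bits of `J` select one of them, and the last `d` bits of `J`, in reversed
order, select a residue class of periods of the parent. -/
def revRound (P : ℕ) : ℕ → ℕ → ℕ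
  | 0, J => J
  | d + 1, J => revRound P d (J / 2) + J % 2 * (P * 2 ^ d)

theorem revRound_lt {P d J : ℕ} (hJ : J < P * 2 ^ d) : revRound P d J < P * 2 ^ d := by
  induction d generalizing J with
  | zero => exact hJ
  | succ d ih =>
    rw [pow_succ, ← mul_assoc] at hJ ⊢
    have h1 := ih (J := J / 2) (by omega)
    rw [revRound]
    rcases Nat.mod_two_eq_zero_or_one J with h | h <;> rw [h] <;> omega

/-- Reversing the bits turns inclusion of dyadic intervals into inclusion of residue classes. -/
theorem revRound_mod {P d e J : ℕ} (hJ : J < P * 2 ^ (d + e)) :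
    revRound P (d + e) J % (P * 2 ^ d) = revRound P d (J / 2 ^ e) := by
  induction e generalizing J with
  | zero =>
    rw [pow_zero, Nat.div_one]
    exact Nat.mod_eq_of_lt (revRound_lt hJ)
  | succ e ih =>
    rw [← add_assoc, revRound]
    have h1 : J % 2 * (P * 2 ^ (d + e)) = P * 2 ^ d * (J % 2 * 2 ^ e) := by ring
    rw [h1, Nat.add_mul_mod_self_left, ih, Nat.div_div_eq_div_mul, pow_succ']
    rw [← add_assoc, pow_succ, ← mul_assoc] at hJ
    omega

theorem revRound_injective {P d J J' : ℕ} (hJ : J < P * 2 ^ d) (hJ' : J' < P * 2 ^ d)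
    (h : revRound P d J = revRound P d J') : J = J' := by
  induction d generalizing J J' with
  | zero => exact h
  | succ d ih =>
    rw [pow_succ, ← mul_assoc] at hJ hJ'
    have h1 := revRound_lt (P := P) (d := d) (J := J / 2) (by omega)
    have h2 := revRound_lt (P := P) (d := d) (J := J' / 2) (by omega)
    rw [revRound, revRound] at h
    have h3 : J % 2 = J' % 2 := by
      rcases Nat.mod_two_eq_zero_or_one J with h3 | h3 <;>
        rcases Nat.mod_two_eq_zero_or_one J' with h4 | h4 <;> rw [h3, h4] at h <;> omega
    have h4 := ih (J := J / 2) (J' := J' / 2) (by omega) (by omega) (by rw [h3] at h; omega)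
    omega

/-- The table `per` translates frequencies into periods: the period of the frequency `i` is the
least power of two that is at least `8 * n / i`. -/
structure IsPeriodTable (n : ℕ) (per : ℕ → ℕ) : Prop where
  pow_two : ∀ i, 1 ≤ i → i ≤ 2 * n → ∃ k, per i = 2 ^ k
  le_mul : ∀ i, 1 ≤ i → i ≤ 2 * n → 8 * n ≤ per i * i
  mul_lt : ∀ i, 1 ≤ i → i ≤ 2 * n → per i * i < 16 * n

theorem IsPeriodTable.exists_eq_mul_pow {n : ℕ} {per : ℕ → ℕ} (h : IsPeriodTable n per) {i j : ℕ}
    (hi : 1 ≤ i) (hij : i ≤ j) (hj : j ≤ 2 * n) : ∃ d, per i = per j * 2 ^ d := by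
  obtain ⟨k, hk⟩ := h.pow_two i hi (hij.trans hj)
  obtain ⟨l, hl⟩ := h.pow_two j (hi.trans hij) hj
  have h1 := h.le_mul i hi (hij.trans hj)
  have h2 := h.mul_lt j (hi.trans hij) hj
  rw [hk] at h1
  rw [hl] at h2
  have h3 : 2 ^ l * j < 2 ^ (k + 1) * j := by
    calc 2 ^ l * j < 16 * n := h2
      _ ≤ 2 * (2 ^ k * i) := by omega
      _ = 2 ^ (k + 1) * i := by ring
      _ ≤ 2 ^ (k + 1) * j := Nat.mul_le_mul_left _ hij
  have h4 : l < k + 1 := (Nat.pow_lt_pow_iff_right (by norm_num)).1 (Nat.lt_of_mul_lt_mul_right h3)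
  exact ⟨k - l, by rw [hk, hl, ← pow_add]; congr 1; omega⟩

/-- The first dyadic interval of length `1 / p` that begins at `x / (4 * n)` or later. -/
def intervalIndex (n x p : ℕ) : ℕ := (x * p + (4 * n - 1)) / (4 * n)

theorem le_intervalIndex_mul {n : ℕ} (hn : 1 ≤ n) (x p : ℕ) :
    x * p ≤ intervalIndex n x p * (4 * n) := by
  have h1 := Nat.div_add_mod' (x * p + (4 * n - 1)) (4 * n)
  have h2 := Nat.mod_lt (x * p + (4 * n - 1)) (by omega : 0 < 4 * n)
  rw [intervalIndex]
  omega

theorem intervalIndex_mul_lt {n : ℕ} (hn : 1 ≤ n) (x p : ℕ) :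
    intervalIndex n x p * (4 * n) < x * p + 4 * n := by
  have h1 := Nat.div_mul_le_self (x * p + (4 * n - 1)) (4 * n)
  rw [intervalIndex]
  omega

variable {V : Type*} [Fintype V] [DecidableEq V] {r : V} {par : V → V} {n : ℕ} {per : ℕ → ℕ}
  {key f a p : V → ℕ}

/-- The total frequency of the siblings of `v` that come after `v` in the order given by `key`.
These are the siblings with larger subtrees, which are served before `v`. -/
def usedBy (r : V) (par : V → V) (key f : V → ℕ) (v : V) : ℕ :=
  ∑ w with w ≠ r ∧ par w = par v ∧ key v < key w, f w

/-- The calls of the children of every vertex are placed one after the other. In the time line of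
the parent, scaled to the unit interval, a child of frequency `f` uses up an interval of length
`f / (4 * n)`, which contains a dyadic interval whose length is the reciprocal of its period. The
root acts as if it had the frequency `2 * n`. -/
structure IsPlacement (r : V) (par : V → V) (n : ℕ) (per : ℕ → ℕ) (key f a p : V → ℕ) : Prop where
  root_freq : f r = 2 * n
  root_first : a r = 0
  root_period : p r = 1
  freq_pos : ∀ v, v ≠ r → 1 ≤ f v
  freq_le : ∀ v, v ≠ r → f v ≤ f (par v)
  used_add_le : ∀ v, v ≠ r → usedBy r par key f v + f v ≤ 2 * n
  period : ∀ v, v ≠ r → p v = per (f v)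
  first : ∀ v, v ≠ r → ∀ d, per (f v) = per (f (par v)) * 2 ^ d →
    a v = (a (par v) + 1 + revRound (per (f (par v))) d
      (intervalIndex n (usedBy r par key f v) (per (f v)))) % per (f v)

theorem usedBy_add_le {v w : V} (hw : w ≠ r) (hp : par v = par w) (hk : key v < key w) :
    usedBy r par key f w + f w ≤ usedBy r par key f v := by
  rw [usedBy, usedBy, add_comm, ← Finset.sum_insert (a := w) (f := f) (by simp)]
  refine Finset.sum_le_sum_of_subset fun x hx => ?_
  simp only [Finset.mem_insert, Finset.mem_filter, Finset.mem_univ, true_and] at hx ⊢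
  rcases hx with rfl | ⟨h1, h2, h3⟩
  · exact ⟨hw, hp.symm, hk⟩
  · exact ⟨h1, h2.trans hp.symm, hk.trans h3⟩

/-- The dyadic intervals of two siblings are not nested. -/
theorem intervalIndex_ne_div {n x y f g p e : ℕ} (hn : 1 ≤ n) (hf : 8 * n ≤ p * f)
    (hg : 8 * n ≤ p * 2 ^ e * g) (h : x + f ≤ y ∨ y + g ≤ x) :
    intervalIndex n x p ≠ intervalIndex n y (p * 2 ^ e) / 2 ^ e := by
  intro heq
  have h1 := le_intervalIndex_mul hn x p
  have h2 := intervalIndex_mul_lt hn x p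
  have h3 := le_intervalIndex_mul hn y (p * 2 ^ e)
  have h4 := intervalIndex_mul_lt hn y (p * 2 ^ e)
  have h5 := Nat.div_mul_le_self (intervalIndex n y (p * 2 ^ e)) (2 ^ e)
  have h6 := Nat.lt_div_mul_add (a := intervalIndex n y (p * 2 ^ e)) (Nat.two_pow_pos e)
  rw [← heq] at h5 h6
  set I := intervalIndex n x p
  set J := intervalIndex n y (p * 2 ^ e)
  rcases h with h | h
  · have h7 : (I + 1) * (4 * n) ≤ y * p := by
      have := Nat.mul_le_mul_right p h
      rw [add_mul, mul_comm f p] at this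
      rw [add_mul]
      omega
    have h8 := Nat.mul_le_mul_right (2 ^ e) h7
    have h9 : J * (4 * n) < (I * 2 ^ e + 2 ^ e) * (4 * n) :=
      Nat.mul_lt_mul_of_pos_right h6 (by omega)
    have h10 : (I * 2 ^ e + 2 ^ e) * (4 * n) = (I + 1) * (4 * n) * 2 ^ e := by ring
    rw [mul_assoc y] at h8
    omega
  · have h7 : (J + 1) * (4 * n) ≤ x * p * 2 ^ e := by
      have := Nat.mul_le_mul_right (p * 2 ^ e) h
      rw [add_mul, mul_comm g] at this
      rw [add_mul, mul_assoc x]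
      omega
    have h8 := Nat.mul_le_mul_right (2 ^ e) h1
    have h9 := Nat.mul_le_mul_right (4 * n) h5
    have h10 : I * (4 * n) * 2 ^ e = I * 2 ^ e * (4 * n) := by ring
    rw [add_mul] at h7
    omega

namespace IsPlacement

variable {G : SimpleGraph V} (h : IsPlacement r par n per key f a p) (hp : IsParentMap G r par)
  (hper : IsPeriodTable n per)
include h hp

theorem freq_bounds (v : V) : f v ≤ 2 * n := by
  induction v using hp.induction_on with
  | h0 => exact h.root_freq.le
  | hs v hv ih => exact (h.freq_le v hv).trans ih

omit hp in
theorem one_le_freq (hn : 1 ≤ n) (v : V) : 1 ≤ f v := by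
  by_cases hv : v = r
  · rw [hv, h.root_freq]
    omega
  · exact h.freq_pos v hv

include hper

theorem exists_period_eq (hn : 1 ≤ n) {v : V} (hv : v ≠ r) :
    ∃ d, per (f v) = per (f (par v)) * 2 ^ d :=
  hper.exists_eq_mul_pow (h.one_le_freq hn v) (h.freq_le v hv) (h.freq_bounds hp _)

theorem two_mul_intervalIndex_lt (hn : 1 ≤ n) {v : V} (hv : v ≠ r) :
    2 * intervalIndex n (usedBy r par key f v) (per (f v)) < per (f v) := by
  have h1 := intervalIndex_mul_lt hn (usedBy r par key f v) (per (f v))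
  have h2 := Nat.mul_le_mul_right (per (f v)) (h.used_add_le v hv)
  have h3 := hper.le_mul _ (h.freq_pos v hv) (h.freq_bounds hp v)
  rw [add_mul, mul_comm (f v)] at h2
  have h4 : 2 * intervalIndex n (usedBy r par key f v) (per (f v)) * (2 * n) <
      per (f v) * (2 * n) := by
    have : 2 * intervalIndex n (usedBy r par key f v) (per (f v)) * (2 * n) =
      intervalIndex n (usedBy r par key f v) (per (f v)) * (4 * n) := by ring
    rw [this, mul_comm (per (f v))]
    omega
  exact Nat.lt_of_mul_lt_mul_right h4

/-- Siblings are never called at the same time. -/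
theorem not_modEq_of_dvd (hn : 1 ≤ n) (hkey : Function.Injective key) {v w : V} (hv : v ≠ r)
    (hw : w ≠ r) (hvw : par v = par w) (hne : v ≠ w) {d e : ℕ}
    (hd : per (f v) = per (f (par v)) * 2 ^ d)
    (he : per (f w) = per (f (par v)) * 2 ^ (d + e)) (t : ℕ) :
    ¬ (t ≡ a v [MOD per (f v)] ∧ t ≡ a w [MOD per (f w)]) := by
  rintro ⟨h1, h2⟩
  have he' : per (f w) = per (f v) * 2 ^ e := by rw [he, hd, pow_add, mul_assoc]
  have h3 : a v ≡ a w [MOD per (f v)] := h1.symm.trans (h2.of_dvd ⟨2 ^ e, he'⟩)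
  rw [h.first v hv d hd, h.first w hw (d + e) (hvw ▸ he), ← hvw] at h3
  have h4 := ((Nat.mod_modEq _ _).symm.trans h3).trans
    ((Nat.mod_modEq _ (per (f w))).of_dvd ⟨2 ^ e, he'⟩)
  have h5 := Nat.ModEq.add_left_cancel' _ h4
  have h6 := h.two_mul_intervalIndex_lt hp hper hn hv
  set I := intervalIndex n (usedBy r par key f v) (per (f v))
  have h7 := h.two_mul_intervalIndex_lt hp hper hn hw
  have h8 : intervalIndex n (usedBy r par key f w) (per (f w)) <
      per (f (par v)) * 2 ^ (d + e) := by omega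
  have h9 : intervalIndex n (usedBy r par key f w) (per (f w)) / 2 ^ e <
      per (f (par v)) * 2 ^ d := by
    rw [Nat.div_lt_iff_lt_mul (Nat.two_pow_pos e), mul_assoc, ← pow_add]
    exact h8
  rw [Nat.ModEq, hd, revRound_mod h8, Nat.mod_eq_of_lt (revRound_lt (by omega))] at h5
  have h10 := revRound_injective (by omega) h9 h5
  rw [he'] at h10
  refine intervalIndex_ne_div hn (hper.le_mul _ (h.freq_pos v hv) (h.freq_bounds hp v))
    (he' ▸ hper.le_mul _ (h.freq_pos w hw) (h.freq_bounds hp w)) ?_ h10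
  rcases lt_or_gt_of_ne (fun hk => hne (hkey hk) : key v ≠ key w) with hk | hk
  · exact .inr (usedBy_add_le hw hvw hk)
  · exact .inl (usedBy_add_le hv hvw.symm hk)

/-- A placement is a call plan, and the offset of a vertex is at most four times its rank among
its siblings. -/
theorem exists_isCallPlan (hn : 1 ≤ n) (hkey : Function.Injective key) :
    ∃ o, IsCallPlan r par a p o ∧ ∀ v, v ≠ r → o v ≤ 4 *
      (1 + ((Finset.univ.filter fun w => w ≠ r).filter
        fun w => par w = par v ∧ key v < key w).card) := by
  have hd (v : V) (hv : v ≠ r) := h.exists_period_eq hp hper hn hv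
  choose! d hd using hd
  have hpos (v : V) : 0 < per (f v) := by
    have h1 := hper.le_mul _ (h.one_le_freq hn v) (h.freq_bounds hp v)
    exact Nat.pos_of_mul_pos_right (lt_of_lt_of_le (by omega) h1)
  set s : V → ℕ := fun v => intervalIndex n (usedBy r par key f v) (per (f v)) / 2 ^ d v with hs
  have hslt (v : V) (hv : v ≠ r) : s v + 1 < per (f (par v)) := by
    have h1 := h.two_mul_intervalIndex_lt hp hper hn hv
    have h2 : 2 * s v < per (f (par v)) := by
      have h3 : s v * 2 ^ d v ≤ _ := Nat.div_mul_le_self _ _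
      set I := intervalIndex n (usedBy r par key f v) (per (f v))
      rw [hd v hv] at h1
      refine Nat.lt_of_mul_lt_mul_right (a := 2 ^ d v) ?_
      rw [mul_assoc]
      omega
    have h3 : 4 ≤ per (f (par v)) := by
      have h4 := hper.le_mul _ (h.one_le_freq hn (par v)) (h.freq_bounds hp _)
      have h5 := Nat.mul_le_mul_left (per (f (par v))) (h.freq_bounds hp (par v))
      refine Nat.le_of_mul_le_mul_right (c := 2 * n) ?_ (by omega)
      omega
    omega
  have hsle (v : V) (hv : v ≠ r) : s v ≤ 4 * ((Finset.univ.filter fun w => w ≠ r).filter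
      fun w => par w = par v ∧ key v < key w).card := by
    set m := ((Finset.univ.filter fun w => w ≠ r).filter
      fun w => par w = par v ∧ key v < key w).card with hm
    have h1 : usedBy r par key f v ≤ m * f (par v) := by
      rw [usedBy, hm, Finset.filter_filter, ← smul_eq_mul]
      refine Finset.sum_le_card_nsmul _ _ _ fun w hw => ?_
      simp only [Finset.mem_filter, Finset.mem_univ, true_and] at hw
      rw [← hw.2.1]
      exact h.freq_le w hw.1
    have h2 := intervalIndex_mul_lt hn (usedBy r par key f v) (per (f v))
    have h3 := Nat.div_mul_le_self (intervalIndex n (usedBy r par key f v) (per (f v))) (2 ^ d v)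
    have h4 := hper.mul_lt _ (h.one_le_freq hn (par v)) (h.freq_bounds hp _)
    have h5 : s v * (2 ^ d v * (4 * n)) < (4 * m + 1) * (2 ^ d v * (4 * n)) := by
      calc s v * (2 ^ d v * (4 * n))
          = s v * 2 ^ d v * (4 * n) := by ring
        _ ≤ intervalIndex n (usedBy r par key f v) (per (f v)) * (4 * n) :=
            Nat.mul_le_mul_right _ h3
        _ < usedBy r par key f v * per (f v) + 4 * n := h2
        _ ≤ m * f (par v) * (per (f (par v)) * 2 ^ d v) + 2 ^ d v * (4 * n) := by
            rw [hd v hv]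
            exact Nat.add_le_add (Nat.mul_le_mul_right _ h1)
              (Nat.le_mul_of_pos_left _ (Nat.two_pow_pos _))
        _ = m * 2 ^ d v * (per (f (par v)) * f (par v)) + 2 ^ d v * (4 * n) := by ring
        _ ≤ m * 2 ^ d v * (16 * n) + 2 ^ d v * (4 * n) :=
            Nat.add_le_add_right (Nat.mul_le_mul_left _ h4.le) _
        _ = (4 * m + 1) * (2 ^ d v * (4 * n)) := by ring
    have := Nat.lt_of_mul_lt_mul_right h5
    omega
  have hmod (v : V) (hv : v ≠ r) : a v ≡ a (par v) + (s v + 1) [MOD per (f (par v))] := by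
    have h1 := h.first v hv _ (hd v hv)
    have h2 := h.two_mul_intervalIndex_lt hp hper hn hv
    rw [h1]
    refine ((Nat.mod_modEq _ _).of_dvd ⟨2 ^ d v, hd v hv⟩).trans ?_
    rw [add_assoc, add_comm (s v)]
    refine Nat.ModEq.add_left _ (Nat.ModEq.add_left _ ?_)
    have h3 := revRound_mod (P := per (f (par v))) (d := 0) (e := d v)
      (J := intervalIndex n (usedBy r par key f v) (per (f v)))
      (by rw [zero_add, ← hd v hv]; omega)
    rw [zero_add, pow_zero, mul_one, revRound] at h3
    rw [Nat.ModEq, h3]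
    exact (Nat.mod_eq_of_lt ((Nat.lt_succ_self _).trans (hslt v hv))).symm
  have hpu {v : V} (hu : par v ≠ r) : p (par v) = per (f (par v)) := h.period _ hu
  refine ⟨fun v => if par v = r then 1 else s v + 1, ⟨h.root_first, h.root_period, fun v => ?_,
    fun v hv => ?_, fun v hv => ?_, fun v hv => ?_, fun v hv hu => ?_, fun v hv => ?_,
    fun v w hv hw hvw hne t => ?_⟩, fun v hv => ?_⟩
  · by_cases hv : v = r
    · rw [hv, h.root_first, h.root_period]
      exact one_pos
    · rw [h.first v hv _ (hd v hv), h.period v hv]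
      exact Nat.mod_lt _ (hpos v)
  · by_cases hu : par v = r
    · rw [hu, h.root_period]
      exact one_dvd _
    · rw [hpu hu, h.period v hv, hd v hv]
      exact dvd_mul_right _ _
  · split_ifs <;> omega
  · split_ifs with hu
    · rw [hu, h.root_period]
    · rw [hpu hu]
      exact (hslt v hv).le
  · rw [if_neg hu, hpu hu]
    exact hslt v hv
  · split_ifs with hu
    · rw [hu, h.root_period]
      exact Nat.modEq_one
    · rw [hpu hu]
      exact hmod v hv
  · rw [h.period v hv, h.period w hw]
    rcases le_total (d v) (d w) with hle | hle
    · obtain ⟨e, he⟩ := Nat.exists_eq_add_of_le hle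
      exact h.not_modEq_of_dvd hp hper hn hkey hv hw hvw hne (hd v hv)
        (by rw [← he, hvw]; exact hd w hw) t
    · obtain ⟨e, he⟩ := Nat.exists_eq_add_of_le hle
      rw [and_comm]
      exact h.not_modEq_of_dvd hp hper hn hkey hw hv hvw.symm hne.symm (hd w hw)
        (by rw [← he, ← hvw]; exact hd v hv) t
  · have := hsle v hv
    dsimp only
    split_ifs <;> omega

end IsPlacement

end Placement

/-! ### Dynamic programming for the frequencies -/

section DynamicProgram

variable {n : ℕ} [NeZero n] {r : Fin n} {par : Fin n → Fin n} {key : Fin n → ℕ}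

/-- The vertices are processed in increasing order of their keys: in step `k` the vertex `k % n` is
processed, if its key is `k`. So a vertex comes after its children, and the children of a vertex are
sorted by the sizes of their subtrees. The root is not processed. -/
structure IsProcessingOrder (r : Fin n) (par : Fin n → Fin n) (key : Fin n → ℕ) : Prop where
  ofNat_key : ∀ v, Fin.ofNat n (key v) = v
  lt_iff : ∀ v, key v < n * n ↔ v ≠ r
  lt_par : ∀ v, v ≠ r → key v < key (par v)

/-- `lastChild key par k u` is `0` if no child of `u` is processed before step `k`, and `v + 1` if
`v` is the child that is processed last before step `k`. -/
def lastChild (key : Fin n → ℕ) (par : Fin n → Fin n) : ℕ → Fin n → ℕ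
  | 0, _ => 0
  | k + 1, u => if key (Fin.ofNat n k) = k ∧ par (Fin.ofNat n k) = u then k % n + 1
      else lastChild key par k u

/-- The row of the vertex `v` in a table for the dynamic program: every entry is the minimum over
all frequencies `i` of `v`, and `ch` holds the frequencies that attain the minimum. An entry that is
at least `big` stands for a problem without a feasible solution. -/
structure IsTableRow (key : Fin n → ℕ) (par : Fin n → Fin n) (per : ℕ → ℕ)
    (H ch : ℕ → ℕ → ℕ → ℕ) (big : ℕ) (v : Fin n) : Prop where
  le : ∀ j c i, j ≤ 2 * n → c ≤ 2 * n → 1 ≤ i → i ≤ j → i ≤ c →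
    H (v + 1) j c ≤ per i + H (lastChild key par (key v) v) i (2 * n) +
      H (lastChild key par (key v) (par v)) j (c - i)
  choice : ∀ j c, j ≤ 2 * n → c ≤ 2 * n → H (v + 1) j c < big →
    1 ≤ ch (v + 1) j c ∧ ch (v + 1) j c ≤ j ∧ ch (v + 1) j c ≤ c ∧
      per (ch (v + 1) j c) + H (lastChild key par (key v) v) (ch (v + 1) j c) (2 * n) +
        H (lastChild key par (key v) (par v)) j (c - ch (v + 1) j c) ≤ H (v + 1) j c

/-- `H` is a table for the dynamic program, up to step `k`. The entry `H (v + 1) j c` is the least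
total period of the subtrees below `v` and below the siblings of `v` that are processed before `v`,
if their parent has frequency `j` and they have a total frequency of at most `c`. -/
structure IsTable (key : Fin n → ℕ) (par : Fin n → Fin n) (per : ℕ → ℕ)
    (H ch : ℕ → ℕ → ℕ → ℕ) (big k : ℕ) : Prop where
  zero : ∀ j c, j ≤ 2 * n → c ≤ 2 * n → H 0 j c = 0
  row : ∀ v, key v < k → IsTableRow key par per H ch big v

namespace IsProcessingOrder

variable (hK : IsProcessingOrder r par key)
include hK

theorem key_injective : Function.Injective key := fun v w h => by
  rw [← hK.ofNat_key v, h, hK.ofNat_key]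

omit hK in
theorem lastChild_succ_of_ne {k : ℕ} (hk : ∀ v, key v ≠ k) (u : Fin n) :
    lastChild key par (k + 1) u = lastChild key par k u := by
  rw [lastChild, if_neg fun h => hk _ h.1]

theorem lastChild_key_succ (v u : Fin n) : lastChild key par (key v + 1) u =
    if par v = u then (v : ℕ) + 1 else lastChild key par (key v) u := by
  have h1 : key v % n = v := congrArg Fin.val (hK.ofNat_key v)
  rw [lastChild, hK.ofNat_key, h1]
  simp

theorem key_ne_of_ofNat {k : ℕ} (hk : key (Fin.ofNat n k) ≠ k) (v : Fin n) : key v ≠ k := by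
  rintro rfl
  rw [hK.ofNat_key] at hk
  exact hk rfl

omit hK in
theorem lastChild_eq_zero_or (k : ℕ) (u : Fin n) :
    lastChild key par k u = 0 ∨ ∃ v : Fin n, lastChild key par k u = v + 1 ∧ key v < k := by
  induction k with
  | zero => exact .inl rfl
  | succ k ih =>
    rw [lastChild]
    split_ifs with h
    · exact .inr ⟨Fin.ofNat n k, rfl, by omega⟩
    · rcases ih with ih | ⟨v, hv, hv'⟩
      · exact .inl ih
      · exact .inr ⟨v, hv, by omega⟩

omit hK in
theorem lastChild_ne {k : ℕ} {v : Fin n} (hk : k ≤ key v) (u : Fin n) :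
    lastChild key par k u ≠ v + 1 := by
  intro h
  rcases lastChild_eq_zero_or (key := key) (par := par) k u with h' | ⟨w, h', hw⟩
  · omega
  · obtain rfl : v = w := Fin.ext (by omega)
    omega

/-- The sets of vertices that are not yet processed shrink by one vertex. -/
theorem filter_key_le (v : Fin n) : (Finset.univ.filter fun x => key v ≤ key x) =
    insert v (Finset.univ.filter fun x => key v + 1 ≤ key x) := by
  ext x
  simp only [Finset.mem_filter, Finset.mem_univ, true_and, Finset.mem_insert, Nat.succ_le_iff]
  constructor
  · intro h
    rcases h.eq_or_lt with h | h
    · exact .inl (hK.key_injective h.symm)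
    · exact .inr h
  · rintro (rfl | h)
    exacts [le_rfl, h.le]

end IsProcessingOrder

variable {per : ℕ → ℕ} {H ch : ℕ → ℕ → ℕ → ℕ} {big : ℕ}

omit [NeZero n] in
theorem filter_le_of_forall_ne {k : ℕ} (hk : ∀ v, key v ≠ k) :
    (Finset.univ.filter fun x => k + 1 ≤ key x) = Finset.univ.filter fun x => k ≤ key x := by
  ext x
  have := hk x
  simp only [Finset.mem_filter, Finset.mem_univ, true_and]
  omega

namespace IsTable

variable (hH : IsTable key par per H ch big (n * n)) (hK : IsProcessingOrder r par key)
include hH hK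

/-- The table bounds the cost of every feasible choice of frequencies from below. -/
theorem table_le_sum {g : Fin n → ℕ} (hg : IsFeasible r par (2 * n) g) (k : ℕ) (hk : k ≤ n * n)
    (c : Fin n → ℕ)
    (hc : ∀ u, ∑ w with w ≠ r ∧ par w = u ∧ key w < k, g w ≤ c u) (hc2 : ∀ u, c u ≤ 2 * n) :
    ∑ x with k ≤ key x, H (lastChild key par k x) (g x) (c x) ≤ ∑ x with key x < k, per (g x) := by
  have hg2 := hg.le
  induction k generalizing c with
  | zero => simp [lastChild, hH.zero _ _ (hg2 _) (hc2 _)]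
  | succ k ih =>
    by_cases hex : ∃ v, key v = k
    · obtain ⟨v, rfl⟩ := hex
      have hv : v ≠ r := (hK.lt_iff v).1 (by omega)
      have hvu := hK.lt_par v hv
      have huv : par v ≠ v := fun h => by rw [h] at hvu; omega
      have h1 : (Finset.univ.filter fun x => key x < key v + 1) =
          insert v (Finset.univ.filter fun x => key x < key v) := by
        ext x
        simp only [Finset.mem_filter, Finset.mem_univ, true_and, Finset.mem_insert, Nat.lt_succ_iff]
        rw [le_iff_eq_or_lt, hK.key_injective.eq_iff]
      have h2 : ∑ w with w ≠ r ∧ par w = par v ∧ key w < key v, g w + g v ≤ c (par v) := by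
        refine le_trans ?_ (hc (par v))
        rw [add_comm, ← Finset.sum_insert (a := v) (f := g) (by simp)]
        refine Finset.sum_le_sum_of_subset fun x hx => ?_
        simp only [Finset.mem_insert, Finset.mem_filter, Finset.mem_univ, true_and] at hx ⊢
        rcases hx with rfl | ⟨h1, h2, h3⟩
        · exact ⟨hv, rfl, by omega⟩
        · exact ⟨h1, h2, by omega⟩
      -- Reserve the frequency of `v`, and give all the `2 * n` units to the children of `v`.
      have h3 := ih (by omega) (fun x => if x = v then 2 * n else if x = par v then
          c (par v) - g v else c x) (fun u => ?_) (fun u => ?_)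
      · rw [h1, Finset.sum_insert (by simp)]
        rw [hK.filter_key_le v, Finset.sum_insert (by simp)] at h3
        have hu : par v ∈ Finset.univ.filter fun x => key v + 1 ≤ key x := by
          simp only [Finset.mem_filter, Finset.mem_univ, true_and]
          omega
        rw [← Finset.add_sum_erase _ _ hu] at h3 ⊢
        have h4 : ∀ x ∈ (Finset.univ.filter fun x => key v + 1 ≤ key x).erase (par v),
            H (lastChild key par (key v + 1) x) (g x) (c x) =
            H (lastChild key par (key v) x) (g x) (if x = v then 2 * n else if x = par v then
              c (par v) - g v else c x) := by
          intro x hx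
          simp only [Finset.mem_erase, Finset.mem_filter, Finset.mem_univ, true_and] at hx
          have hxv : x ≠ v := by rintro rfl; omega
          rw [hK.lastChild_key_succ, if_neg (Ne.symm hx.1), if_neg hxv, if_neg hx.1]
        rw [Finset.sum_congr rfl h4, hK.lastChild_key_succ, if_pos rfl]
        have h5 := (hH.row v (by omega)).le (g (par v)) (c (par v)) (g v) (hg2 _) (hc2 _)
          (hg.pos v hv) (hg.le_par v hv) (by omega)
        simp only [if_neg huv, if_true] at h3
        omega
      · split_ifs with hu hu'
        · rw [hu]
          refine le_trans (Finset.sum_le_sum_of_subset fun x hx => ?_) (hg.sum_le v)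
          simp only [Finset.mem_filter, Finset.mem_univ, true_and] at hx ⊢
          exact ⟨hx.1, hx.2.1⟩
        · rw [hu']
          omega
        · refine le_trans (Finset.sum_le_sum_of_subset fun x hx => ?_) (hc u)
          simp only [Finset.mem_filter, Finset.mem_univ, true_and] at hx ⊢
          exact ⟨hx.1, hx.2.1, by omega⟩
      · have := hc2 u
        have := hc2 (par v)
        split_ifs <;> omega
    · push Not at hex
      have h1 (x : Fin n) : key x < k + 1 ↔ key x < k := by
        have := hex x
        omega
      simp only [h1] at hc ⊢
      rw [filter_le_of_forall_ne hex]
      simp only [IsProcessingOrder.lastChild_succ_of_ne hex]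
      exact ih (by omega) c hc hc2

/-- The entry for the whole tree is at most the cost of every feasible choice of frequencies. -/
theorem root_le_sum {g : Fin n → ℕ} (hg : IsFeasible r par (2 * n) g) :
    H (lastChild key par (n * n) r) (2 * n) (2 * n) ≤ ∑ v with v ≠ r, per (g v) := by
  have h1 := hH.table_le_sum hK hg (n * n) le_rfl (fun _ => 2 * n) (fun u => ?_)
    (fun _ => le_rfl)
  · simp only [hK.lt_iff] at h1
    refine le_trans ?_ h1
    refine le_of_eq_of_le ?_ (Finset.single_le_sum (fun _ _ => Nat.zero_le _)
      (Finset.mem_filter.2 ⟨Finset.mem_univ r, not_lt.1 fun h => (hK.lt_iff r).1 h rfl⟩))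
    rw [hg.root]
  · refine le_trans (Finset.sum_le_sum_of_subset fun x hx => ?_) (hg.sum_le u)
    simp only [Finset.mem_filter, Finset.mem_univ, true_and] at hx ⊢
    exact ⟨hx.1, hx.2.1⟩

/-- Reading off the choices from the table in the reversed order gives feasible frequencies whose
cost is the entry for the whole tree. -/
theorem choices_feasible {f : Fin n → ℕ} (hfr : f r = 2 * n)
    (hbig : H (lastChild key par (n * n) r) (2 * n) (2 * n) < big) (k : ℕ) (hk : k ≤ n * n)
    (hf : ∀ v, v ≠ r → k ≤ key v →
      f v = ch (v + 1) (f (par v)) (2 * n - usedBy r par key f v)) :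
    (∀ v, v ≠ r → k ≤ key v →
      1 ≤ f v ∧ f v ≤ f (par v) ∧ usedBy r par key f v + f v ≤ 2 * n) ∧
    (∀ v, k ≤ key v → f v ≤ 2 * n) ∧
    ∑ x with k ≤ key x, (H (lastChild key par k x) (f x)
        (2 * n - ∑ w with w ≠ r ∧ par w = x ∧ k ≤ key w, f w) +
      if x = r then 0 else per (f x)) ≤ H (lastChild key par (n * n) r) (2 * n) (2 * n) := by
  induction hm : n * n - k generalizing k with
  | zero =>
    obtain rfl : k = n * n := by omega
    have h1 (v : Fin n) : n * n ≤ key v ↔ v = r := by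
      rw [← not_lt, hK.lt_iff, not_not]
    refine ⟨fun v hv hv' => absurd ((h1 v).1 hv') hv, fun v hv => ?_, ?_⟩
    · rw [(h1 v).1 hv, hfr]
    · simp only [h1]
      have h2 (x : Fin n) : (Finset.univ.filter fun w => w ≠ r ∧ par w = x ∧ w = r) = ∅ := by
        ext w
        simp only [Finset.mem_filter, Finset.mem_univ, true_and, Finset.notMem_empty, iff_false]
        tauto
      simp [Finset.filter_eq', hfr, h2]
  | succ m ih =>
    obtain ⟨ih1, ih2, ih3⟩ := ih (k + 1) (by omega) (fun v hv h => hf v hv (by omega)) (by omega)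
    by_cases hex : ∃ v, key v = k
    · obtain ⟨v, rfl⟩ := hex
      have hv : v ≠ r := (hK.lt_iff v).1 (by omega)
      have hvu := hK.lt_par v hv
      have huv : par v ≠ v := fun h => by rw [h] at hvu; omega
      have hu : par v ∈ Finset.univ.filter fun x => key v + 1 ≤ key x := by
        simp only [Finset.mem_filter, Finset.mem_univ, true_and]
        omega
      have hused : ∑ w with w ≠ r ∧ par w = par v ∧ key v + 1 ≤ key w, f w =
          usedBy r par key f v := rfl
      rw [← Finset.add_sum_erase _ _ hu, hK.lastChild_key_succ, if_pos rfl, hused] at ih3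
      have h1 := (hH.row v (by omega)).choice (f (par v)) (2 * n - usedBy r par key f v)
        (ih2 _ (by omega)) (Nat.sub_le _ _) (by omega)
      rw [← hf v hv le_rfl] at h1
      obtain ⟨h2, h3, h4, h5⟩ := h1
      have hle (x : Fin n) : key v ≤ key x ↔ x = v ∨ key v + 1 ≤ key x := by
        rw [Nat.succ_le_iff, le_iff_eq_or_lt, hK.key_injective.eq_iff, eq_comm]
      refine ⟨fun x hx hx' => ?_, fun x hx => ?_, ?_⟩
      · rcases (hle x).1 hx' with rfl | h
        · exact ⟨h2, h3, by omega⟩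
        · exact ih1 x hx h
      · rcases (hle x).1 hx with rfl | h
        · exact h3.trans (ih2 _ (by omega))
        · exact ih2 x h
      · rw [hK.filter_key_le v, Finset.sum_insert (by simp), ← Finset.add_sum_erase _ _ hu,
          if_neg hv]
        have h6 : ∑ w with w ≠ r ∧ par w = v ∧ key v ≤ key w, f w = 0 := by
          rw [Finset.sum_eq_zero_iff]
          intro w hw
          simp only [Finset.mem_filter, Finset.mem_univ, true_and] at hw
          have := hK.lt_par w hw.1
          rw [hw.2.1] at this
          omega
        have h7 : ∑ w with w ≠ r ∧ par w = par v ∧ key v ≤ key w, f w =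
            usedBy r par key f v + f v := by
          rw [← hused, add_comm, ← Finset.sum_insert (a := v) (f := f) (by simp)]
          congr 1
          ext w
          simp only [Finset.mem_insert, Finset.mem_filter, Finset.mem_univ, true_and]
          rw [hle]
          constructor
          · rintro ⟨h1, h2, h3 | h3⟩
            · exact .inl h3
            · exact .inr ⟨h1, h2, h3⟩
          · rintro (rfl | ⟨h1, h2, h3⟩)
            · exact ⟨hv, rfl, .inl rfl⟩
            · exact ⟨h1, h2, .inr h3⟩
        rw [h6, h7, Nat.sub_zero]
        have h8 : ∀ x ∈ (Finset.univ.filter fun x => key v + 1 ≤ key x).erase (par v),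
            (H (lastChild key par (key v) x) (f x)
              (2 * n - ∑ w with w ≠ r ∧ par w = x ∧ key v ≤ key w, f w) +
              if x = r then 0 else per (f x)) =
            (H (lastChild key par (key v + 1) x) (f x)
              (2 * n - ∑ w with w ≠ r ∧ par w = x ∧ key v + 1 ≤ key w, f w) +
              if x = r then 0 else per (f x)) := by
          intro x hx
          simp only [Finset.mem_erase, Finset.mem_filter, Finset.mem_univ, true_and] at hx
          rw [hK.lastChild_key_succ, if_neg (Ne.symm hx.1)]
          congr 4
          ext w
          simp only [Finset.mem_filter, Finset.mem_univ, true_and]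
          rw [hle]
          constructor
          · rintro ⟨hw1, hw2, hw3 | hw3⟩
            · rw [hw3] at hw2
              exact absurd hw2.symm hx.1
            · exact ⟨hw1, hw2, hw3⟩
          · rintro ⟨hw1, hw2, hw3⟩
            exact ⟨hw1, hw2, .inr hw3⟩
        rw [Finset.sum_congr rfl h8]
        rw [Nat.sub_sub] at h5
        omega
    · push Not at hex
      have h1 (x : Fin n) : k + 1 ≤ key x ↔ k ≤ key x := by
        have := hex x
        omega
      simp only [h1, IsProcessingOrder.lastChild_succ_of_ne hex] at ih1 ih2 ih3
      exact ⟨ih1, ih2, ih3⟩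

theorem sum_choices_le {f : Fin n → ℕ} (hfr : f r = 2 * n)
    (hf : ∀ v, v ≠ r → f v = ch (v + 1) (f (par v)) (2 * n - usedBy r par key f v))
    (hbig : H (lastChild key par (n * n) r) (2 * n) (2 * n) < big) :
    ∑ v with v ≠ r, per (f v) ≤ H (lastChild key par (n * n) r) (2 * n) (2 * n) := by
  refine le_trans ?_ (hH.choices_feasible hK hfr hbig 0 (Nat.zero_le _) fun v hv _ => hf v hv).2.2
  rw [Finset.sum_filter, Finset.sum_filter]
  refine Finset.sum_le_sum fun v _ => ?_
  by_cases hv : v = r <;> simp [hv]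

omit hH hK in
theorem _root_.isFeasible_one (r : Fin n) (par : Fin n → Fin n) :
    IsFeasible r par (2 * n) fun v => if v = r then 2 * n else 1 := by
  have hn : 0 < n := Nat.pos_of_ne_zero (NeZero.ne n)
  refine ⟨if_pos rfl, fun v hv => by rw [if_neg hv], fun v hv => ?_, fun u => ?_⟩
  · rw [if_neg hv]
    split_ifs <;> omega
  · calc ∑ w with w ≠ r ∧ par w = u, (if w = r then 2 * n else 1)
        = ∑ w with w ≠ r ∧ par w = u, 1 :=
          Finset.sum_congr rfl fun w hw => if_neg (Finset.mem_filter.1 hw).2.1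
      _ ≤ ∑ _w : Fin n, 1 := Finset.sum_le_sum_of_subset (Finset.filter_subset _ _)
      _ ≤ 2 * n := by simp; omega

theorem root_lt_big (hper : IsPeriodTable n per) (hbig : 16 * n * n ≤ big) :
    H (lastChild key par (n * n) r) (2 * n) (2 * n) < big := by
  have hn : 0 < n := Nat.pos_of_ne_zero (NeZero.ne n)
  have h1 := hH.root_le_sum hK (isFeasible_one r par)
  refine (h1.trans_lt ?_).trans_le hbig
  have h2 := hper.mul_lt 1 le_rfl (by omega)
  calc ∑ v with v ≠ r, per (if v = r then 2 * n else 1)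
      = ∑ v with v ≠ r, per 1 :=
        Finset.sum_congr rfl fun w hw => by rw [if_neg (Finset.mem_filter.1 hw).2]
    _ ≤ ∑ _v : Fin n, per 1 := Finset.sum_le_sum_of_subset (Finset.filter_subset _ _)
    _ = n * per 1 := by simp
    _ < n * (16 * n) := Nat.mul_lt_mul_of_pos_left (by omega) hn
    _ = 16 * n * n := by ring

end IsTable

end DynamicProgram

/-! ### The program: parents, subtree sizes and periods -/

namespace RAM

/-- Computes the parents: array `3` holds `0` at the vertices that are not yet reached from the
root, and `u + 1` at the other ones, where `u` is the parent (and the root is its own parent). -/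
def findParents : Prog :=
  .seq (.store 3 (.reg 1) (.reg 1 + 1)) <|
  .forUp 2 (.reg 0) <|
  .forUp 3 (.reg 0 * .reg 0) <|
  .ite (.cell 0 (.reg 3) * .cell 3 (.reg 3 / .reg 0) * (1 - .cell 3 (.reg 3 % .reg 0)))
    (.store 3 (.reg 3 % .reg 0) (.reg 3 / .reg 0 + 1))
    .skip

/-- Computes the subtree sizes in array `4`, by walking up from every vertex. -/
def findSizes : Prog :=
  .forUp 2 (.reg 0) <|
  .seq (.assign 5 (.reg 2)) <|
  .forUp 3 (.reg 0) <|
  .seq (.store 4 (.reg 5) (.cell 4 (.reg 5) + 1)) <|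
  .assign 5 (.cell 3 (.reg 5) - 1)

/-- Computes the table of periods in array `5`, by repeated doubling. -/
def findPeriods : Prog :=
  .forUp 2 (2 * .reg 0) <|
  .seq (.assign 6 1) <|
  .seq (.forUp 3 (8 * .reg 0) <|
    .ite (8 * .reg 0 - .reg 6 * (.reg 2 + 1)) (.assign 6 (2 * .reg 6)) .skip) <|
  .store 5 (.reg 2 + 1) (.reg 6)

variable {n B : ℕ} {G : SimpleGraph (Fin n)} {r : Fin n} {par : Fin n → Fin n}

/-- The registers that hold the input are intact, and `τ` agrees with `σ` on all arrays outside
`s`. -/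
structure Frame (n : ℕ) (r : Fin n) (s : Set ℕ) (σ τ : State) : Prop where
  reg_zero : τ.reg 0 = n
  reg_one : τ.reg 1 = r
  arr : ∀ a, a ∉ s → τ.arr a = σ.arr a

theorem Frame.setReg {s : Set ℕ} {σ τ : State} (h : Frame n r s σ τ) (x v : ℕ) (hx : 2 ≤ x) :
    Frame n r s σ (τ.setReg x v) := by
  refine ⟨?_, ?_, h.arr⟩
  · simp [h.reg_zero]
    omega
  · simp [h.reg_one]
    omega

theorem Frame.setArr {s : Set ℕ} {σ τ : State} (h : Frame n r s σ τ) {a : ℕ} (i v : ℕ)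
    (ha : a ∈ s) : Frame n r s σ (τ.setArr a i v) := by
  refine ⟨h.reg_zero, h.reg_one, fun b hb => ?_⟩
  have hba : b ≠ a := fun hba => hb (hba ▸ ha)
  simp [hba, h.arr b hb]

theorem Frame.refl {s : Set ℕ} {σ : State} (h0 : σ.reg 0 = n) (h1 : σ.reg 1 = r) :
    Frame n r s σ σ := ⟨h0, h1, fun _ _ => rfl⟩

/-- The state of the search for parents: `A` holds parents only, and the set of vertices that are
reached contains the parents of its members. -/
structure ParentSearch (r : Fin n) (par : Fin n → Fin n) (A : ℕ → ℕ) : Prop where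
  eq : ∀ v : Fin n, A v ≠ 0 → A v = par v + 1
  par_ne : ∀ v : Fin n, A v ≠ 0 → A (par v) ≠ 0
  root_ne : A r ≠ 0

theorem ParentSearch.update (hp : IsParentMap G r par) {A : ℕ → ℕ} (h : ParentSearch r par A)
    {u v : Fin n} (huv : G.Adj u v) (hu : A u ≠ 0) (hv : A v = 0) :
    ParentSearch r par (Function.update A v (u + 1)) := by
  have hvr : v ≠ r := fun hvr => h.root_ne (hvr ▸ hv)
  have hpar : par v = u := by
    rcases (hp.adj_iff u v).1 huv with h1 | h1
    · exact h1.2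
    · exact absurd hv (h1.2 ▸ h.par_ne u hu)
  have hne {x : Fin n} : Function.update A v (u + 1) x ≠ 0 ↔ x = v ∨ A x ≠ 0 := by
    rw [Function.update_apply]
    split_ifs with hx
    · simp [Fin.ext hx]
    · have : x ≠ v := fun h => hx (congrArg _ h)
      simp [this]
  refine ⟨fun x hx => ?_, fun x hx => ?_, hne.2 (.inr h.root_ne)⟩
  · rw [Function.update_apply]
    split_ifs with hxv
    · rw [Fin.ext hxv, hpar]
    · exact h.eq x ((hne.1 hx).resolve_left fun h => hxv (congrArg _ h))
  · rw [hne]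
    rcases hne.1 hx with rfl | hx
    · exact .inr (hpar ▸ hu)
    · exact .inr (h.par_ne x hx)

theorem findParents_wp (hp : IsParentMap G r par) (hB : 100 * (n * n) ≤ B) {σ : State}
    (h0 : σ.reg 0 = n) (h1 : σ.reg 1 = r)
    (hadj : ∀ u v : Fin n, σ.arr 0 (u * n + v) ≠ 0 ↔ G.Adj u v)
    (h3 : σ.arr 3 = fun _ => 0) {Q : State → Prop}
    (hQ : ∀ τ, Frame n r {3} σ τ → (∀ v : Fin n, τ.arr 3 v = par v + 1) → Q τ) :
    findParents.wp B Q σ := by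
  have hr := r.2
  have hnn : n ≤ n * n := Nat.le_mul_self n
  refine ⟨?_, ?_⟩
  · simp [h1]
    omega
  refine Prog.wp_forUp n (fun i τ => Frame n r {3} σ τ ∧ τ.reg 2 = i ∧
    ParentSearch r par (τ.arr 3) ∧ ∀ v : Fin n, G.dist r v ≤ i → τ.arr 3 v ≠ 0)
    (by omega) ?_ ?_ ?_ ?_
  · rintro i τ ⟨hF, hi, -⟩
    exact ⟨hF.reg_zero, hi⟩
  · have h4 : (Function.update (fun _ => 0) (r : ℕ) ((r : ℕ) + 1) : ℕ → ℕ) r ≠ 0 := by simp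
    have h5 (v : Fin n) : (Function.update (fun _ => 0) (r : ℕ) ((r : ℕ) + 1) : ℕ → ℕ) v ≠ 0 →
        v = r := by
      intro hv
      rw [Function.update_apply] at hv
      split_ifs at hv with hv'
      · exact Fin.ext hv'
      · exact absurd rfl hv
    refine ⟨((Frame.refl h0 h1).setArr _ _ (Set.mem_singleton 3)).setReg _ _ le_rfl,
      by simp, ?_, fun v hv => ?_⟩
    · simp only [State.setReg_arr, State.setArr_arr, if_true, h3, Expr.eval_reg, h1, Expr.eval_add,
        Expr.eval_one]
      refine ⟨fun v hv => ?_, fun v hv => ?_, h4⟩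
      · rw [h5 v hv, hp.root]
        simp
      · rw [h5 v hv, hp.root]
        exact h4
    · have hvr : v = r := by
        by_contra hne
        have := hp.dist_pos hne
        omega
      simp [h3, h1, hvr]
  · rintro i hi τ ⟨hF, h2, hS, hd⟩
    refine Prog.wp_forUp (n * n) (fun q ρ => Frame n r {3} σ ρ ∧ ρ.reg 2 = i ∧ ρ.reg 3 = q ∧
      ParentSearch r par (ρ.arr 3) ∧ (∀ v : Fin n, G.dist r v ≤ i → ρ.arr 3 v ≠ 0) ∧
      ∀ u v : Fin n, u * n + v < q → G.Adj u v → G.dist r u ≤ i → ρ.arr 3 v ≠ 0)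
      (by omega) ?_ ?_ ?_ ?_
    · rintro q ρ ⟨hF, -, hq, -⟩
      exact ⟨by simp [hF.reg_zero], hq⟩
    · exact ⟨hF.setReg _ _ (by norm_num), by simpa using h2, by simp, hS, hd, by simp⟩
    · rintro q hq ρ ⟨hF, h2, h3, hS, hd, hq'⟩
      have hn : 0 < n := r.pos
      set u : Fin n := ⟨q / n, Nat.div_lt_of_lt_mul hq⟩ with hu
      set v : Fin n := ⟨q % n, Nat.mod_lt _ hn⟩ with hv
      have hquv : q = u * n + v := by
        rw [hu, hv, mul_comm]
        exact (Nat.div_add_mod q n).symm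
      have hudiv : q / n = u := rfl
      have hvmod : q % n = v := rfl
      have h00 : ρ.arr 0 = σ.arr 0 := hF.arr 0 (by simp)
      have hx {x y : Fin n} : (x : ℕ) * n + y < q + 1 ↔ (x : ℕ) * n + y < q ∨ x = u ∧ y = v := by
        have hinj : (x : ℕ) * n + y = q ↔ x = u ∧ y = v := by
          constructor
          · intro h
            constructor
            · apply Fin.ext
              rw [← hudiv, ← h, mul_comm, Nat.mul_add_div hn, Nat.div_eq_of_lt y.2, add_zero]
            · apply Fin.ext
              rw [← hvmod, ← h, mul_comm, Nat.mul_add_mod, Nat.mod_eq_of_lt y.2]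
          · rintro ⟨rfl, rfl⟩
            exact hquv.symm
        omega
      simp only [Prog.wp, Expr.eval_mul, Expr.eval_cell, Expr.eval_reg, Expr.eval_div,
        Expr.eval_sub, Expr.eval_one, Expr.eval_mod, Expr.eval_add, hF.reg_zero, h3, h00,
        hudiv, hvmod]
      constructor
      · intro hc
        have hc1 : G.Adj u v := by
          rw [← hadj, ← hquv]
          exact fun h => hc (by simp [h])
        have hc2 : ρ.arr 3 u ≠ 0 := fun h => hc (by simp [h])
        have hc3 : ρ.arr 3 v = 0 := by
          by_contra h
          refine hc (mul_eq_zero_of_right _ ?_)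
          omega
        refine ⟨by have := u.2; omega, by simp [h3], ?_⟩
        have hmono (x : Fin n) (hx : ρ.arr 3 x ≠ 0) :
            Function.update (ρ.arr 3) v (u + 1) x ≠ 0 := by
          rw [Function.update_apply]
          split_ifs
          · simp
          · exact hx
        refine ⟨(hF.setArr _ _ (Set.mem_singleton 3)).setReg _ _ (by norm_num), by simpa using h2,
          by simp, ?_, fun x hx => ?_, fun x y hxy ha hd' => ?_⟩
        · simpa using hS.update hp hc1 hc2 hc3
        · simpa using hmono x (hd x hx)
        · rcases hx.1 hxy with h | ⟨rfl, rfl⟩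
          · simpa using hmono y (hq' x y h ha hd')
          · simp
      · intro hc
        refine ⟨trivial, hF.setReg _ _ (by norm_num), by simpa using h2, by simp, hS, hd,
          fun x y hxy ha hd' => ?_⟩
        rcases hx.1 hxy with h | ⟨h, h'⟩
        · exact hq' x y h ha hd'
        · rw [h] at ha hd'
          rw [h'] at ha ⊢
          intro h0
          have h0' : ρ.arr 3 v = 0 := h0
          rw [h0', hquv, Nat.sub_zero, mul_one] at hc
          rcases mul_eq_zero.1 hc with h | h
          · exact (hadj u v).2 ha h
          · exact hd u hd' h
    · rintro ρ ⟨hF, h2, -, hS, hd, hq⟩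
      refine ⟨h2, hF.setReg _ _ le_rfl, by simp, hS, fun v hv => ?_⟩
      by_cases hvr : v = r
      · rw [hvr]
        exact hS.root_ne
      · have h5 := hp.dist_eq v hvr
        refine hq (par v) v ?_ ((hp.adj_iff _ _).2 (.inl ⟨hvr, rfl⟩)) (by omega)
        have h6 := (par v).2
        have h7 := v.2
        calc (par v : ℕ) * n + v < (par v : ℕ) * n + n := by omega
          _ = ((par v : ℕ) + 1) * n := by ring
          _ ≤ n * n := Nat.mul_le_mul_right n h6
  · rintro τ ⟨hF, -, hS, hd⟩
    refine hQ τ hF fun v => hS.eq v (hd v ?_)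
    simpa using (hp.dist_lt v).le

open Classical in
theorem sum_filter_lt_succ {M : Type*} [AddCommMonoid M] (f : Fin n → M) {i : ℕ} (hi : i < n) :
    ∑ v ∈ Finset.univ.filter (fun v : Fin n => (v : ℕ) < i + 1), f v =
      ∑ v ∈ Finset.univ.filter (fun v : Fin n => (v : ℕ) < i), f v + f ⟨i, hi⟩ := by
  have h : (Finset.univ.filter fun v : Fin n => (v : ℕ) < i + 1) =
      insert ⟨i, hi⟩ (Finset.univ.filter fun v : Fin n => (v : ℕ) < i) := by
    ext v
    simp only [Finset.mem_filter, Finset.mem_univ, true_and, Finset.mem_insert, Fin.ext_iff]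
    omega
  rw [h, Finset.sum_insert (by simp), add_comm]

open Classical in
theorem findSizes_wp (hB : 100 * (n * n) ≤ B) {σ : State}
    (h0 : σ.reg 0 = n) (h1 : σ.reg 1 = r) (h3 : ∀ v : Fin n, σ.arr 3 v = par v + 1)
    (h4 : σ.arr 4 = fun _ => 0) {Q : State → Prop}
    (hQ : ∀ τ, Frame n r {4} σ τ → (∀ v : Fin n, τ.arr 4 v = subtreeSize par v) → Q τ) :
    findSizes.wp B Q σ := by
  have hnn : n ≤ n * n := Nat.le_mul_self n
  set cnt : ℕ → Fin n → ℕ := fun i x => ∑ v ∈ Finset.univ.filter (fun v : Fin n => (v : ℕ) < i),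
    ∑ d ∈ Finset.range n, if par^[d] v = x then 1 else 0 with hcnt
  refine Prog.wp_forUp n (fun i τ => Frame n r {4} σ τ ∧ τ.reg 2 = i ∧
    (∀ x : Fin n, τ.arr 4 x = cnt i x) ∧ ∀ x : Fin n, τ.arr 4 x ≤ i * n) (by omega) ?_ ?_ ?_ ?_
  · rintro i τ ⟨hF, hi, -⟩
    exact ⟨hF.reg_zero, hi⟩
  · exact ⟨(Frame.refl h0 h1).setReg _ _ le_rfl, by simp, by simp [h4, hcnt], by simp [h4]⟩
  · rintro i hi τ ⟨hF, h2, hc, hle⟩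
    set v : Fin n := ⟨i, hi⟩ with hv
    refine ⟨?_, ?_⟩
    · rw [Expr.eval_reg, h2]
      omega
    refine Prog.wp_forUp n (fun d ρ => Frame n r {4} σ ρ ∧ ρ.reg 2 = i ∧ ρ.reg 3 = d ∧
      ρ.reg 5 = par^[d] v ∧ (∀ x : Fin n, ρ.arr 4 x = cnt i x +
        ∑ d ∈ Finset.range d, if par^[d] v = x then 1 else 0) ∧
      ∀ x : Fin n, ρ.arr 4 x ≤ i * n + d) (by omega) ?_ ?_ ?_ ?_
    · rintro q ρ ⟨hF, -, hq, -⟩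
      exact ⟨hF.reg_zero, hq⟩
    · exact ⟨(hF.setReg _ _ (by norm_num)).setReg _ _ (by norm_num), by simpa using h2, by simp,
        by simp [h2, hv], by simpa using hc, by simpa using hle⟩
    · rintro d hd ρ ⟨hF, h2, hd', h5, hc, hle⟩
      have h33 : ρ.arr 3 = σ.arr 3 := hF.arr 3 (by simp)
      have h5' : par^[d + 1] v = par (par^[d] v) := Function.iterate_succ_apply' _ _ _
      have hin : i * n + n ≤ n * n := by
        rw [← Nat.succ_mul]
        exact Nat.mul_le_mul_right n hi
      have h6 := hle (par^[d] v)
      have h7 := (par (par^[d] v)).2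
      simp only [Prog.wp, Expr.eval_reg, Expr.eval_cell, Expr.eval_add, Expr.eval_one,
        Expr.eval_sub, h5, State.setArr_reg]
      simp only [State.setArr_arr, State.setReg_reg, State.setReg_arr, h33, h3,
        Nat.reduceEqDiff, if_true, if_false]
      refine ⟨by omega, by omega, by simpa using hd',
        ((hF.setArr _ _ (Set.mem_singleton 4)).setReg _ _ (by norm_num)).setReg _ _ (by norm_num),
        h2, trivial, by rw [h5']; simp, fun x => ?_, fun x => ?_⟩
      · rw [Finset.sum_range_succ, Function.update_apply, ← add_assoc, ← hc x]
        by_cases hx : par^[d] v = x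
        · rw [if_pos hx, if_pos (by rw [hx]), hx]
        · rw [if_neg hx, if_neg fun h => hx (Fin.ext h.symm), add_zero]
      · have := hle x
        rw [Function.update_apply]
        split_ifs <;> omega
    · rintro ρ ⟨hF, h2, -, -, hc, hle⟩
      refine ⟨h2, hF.setReg _ _ le_rfl, by simp, fun x => ?_, fun x => ?_⟩
      · rw [hcnt]
        dsimp only
        rw [sum_filter_lt_succ _ hi]
        exact hc x
      · have := hle x
        rw [Nat.succ_mul]
        exact this
  · rintro τ ⟨hF, -, hc, -⟩
    refine hQ τ hF fun v => ?_
    rw [hc, hcnt, subtreeSize]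
    simp only [Fin.is_lt, Finset.filter_true, Fintype.card_fin]
    congr!

theorem findPeriods_wp (hB : 100 * (n * n) ≤ B) {σ : State}
    (h0 : σ.reg 0 = n) (h1 : σ.reg 1 = r) {Q : State → Prop}
    (hQ : ∀ τ, Frame n r {5} σ τ → IsPeriodTable n (τ.arr 5) → Q τ) :
    findPeriods.wp B Q σ := by
  have hnn : n ≤ n * n := Nat.le_mul_self n
  have hn : 0 < n := r.pos
  let ok : ℕ → ℕ → Prop := fun j p => (∃ k, p = 2 ^ k) ∧ 8 * n ≤ p * j ∧ p * j < 16 * n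
  refine Prog.wp_forUp (2 * n) (fun i τ => Frame n r {5} σ τ ∧ τ.reg 2 = i ∧
    ∀ j, 1 ≤ j → j ≤ i → ok j (τ.arr 5 j)) (by omega) ?_ ?_ ?_ ?_
  · rintro i τ ⟨hF, hi, -⟩
    exact ⟨by simp [hF.reg_zero], hi⟩
  · exact ⟨(Frame.refl h0 h1).setReg _ _ le_rfl, by simp, fun j hj hj' => by omega⟩
  · rintro i hi τ ⟨hF, h2, hj⟩
    refine ⟨?_, ?_⟩
    · rw [Expr.eval_one]
      omega
    refine Prog.wp_forUp (8 * n) (fun d ρ => Frame n r {5} σ ρ ∧ ρ.reg 2 = i ∧ ρ.reg 3 = d ∧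
      (∀ j, 1 ≤ j → j ≤ i → ok j (ρ.arr 5 j)) ∧ (∃ k, ρ.reg 6 = 2 ^ k) ∧
      ρ.reg 6 * (i + 1) < 16 * n ∧ (8 * n ≤ ρ.reg 6 * (i + 1) ∨ ρ.reg 6 = 2 ^ d))
      (by omega) ?_ ?_ ?_ ?_
    · rintro q ρ ⟨hF, -, hq, -⟩
      exact ⟨by simp [hF.reg_zero], hq⟩
    · refine ⟨(hF.setReg _ _ (by norm_num)).setReg _ _ (by norm_num), by simpa using h2,
        by simp, hj, ⟨0, by simp⟩, ?_, .inr (by simp)⟩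
      simp
      omega
    · rintro d hd ρ ⟨hF, h2, h3, hj, ⟨k, hk⟩, hlt, hor⟩
      simp only [Prog.wp, Expr.eval_reg, Expr.eval_sub, Expr.eval_mul, Expr.eval_add,
        Expr.eval_one, Expr.eval_ofNat, h2, hF.reg_zero]
      constructor
      · intro hc
        have h4 : ρ.reg 6 ≤ ρ.reg 6 * (i + 1) := Nat.le_mul_of_pos_right _ (Nat.succ_pos i)
        refine ⟨by omega, by simpa using h3, (hF.setReg _ _ (by norm_num)).setReg _ _ (by norm_num),
          by simpa using h2, by simp, hj, ⟨k + 1, by simp [hk, pow_succ']⟩, ?_, ?_⟩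
        · simp only [State.setReg_reg, Nat.reduceEqDiff, if_true, if_false, mul_assoc]
          omega
        · refine .inr ?_
          simp only [State.setReg_reg, Nat.reduceEqDiff, if_true, if_false]
          rw [hor.resolve_left (by omega), pow_succ']
      · intro hc
        exact ⟨h3, hF.setReg _ _ (by norm_num), by simpa using h2, by simp, hj, ⟨k, hk⟩, hlt,
          .inl (Nat.sub_eq_zero_iff_le.1 hc)⟩
    · rintro ρ ⟨hF, h2, -, hj, hk, hlt, hor⟩
      have h4 : 8 * n ≤ ρ.reg 6 * (i + 1) := by
        rcases hor with h | h
        · exact h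
        · have h5 : 8 * n < 2 ^ (8 * n) := Nat.lt_two_pow_self
          rw [h]
          exact h5.le.trans (Nat.le_mul_of_pos_right _ (Nat.succ_pos i))
      have h5 : ρ.reg 6 ≤ ρ.reg 6 * (i + 1) := Nat.le_mul_of_pos_right _ (Nat.succ_pos i)
      refine ⟨?_, h2, (hF.setArr _ _ (Set.mem_singleton 5)).setReg _ _ le_rfl, by simp,
        fun j hj1 hj2 => ?_⟩
      · rw [Expr.eval_reg]
        omega
      · simp only [State.setReg_arr, State.setArr_arr, if_true, Expr.eval_add, Expr.eval_reg,
          Expr.eval_one, h2]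
        rw [Function.update_apply]
        split_ifs with hji
        · rw [hji]
          exact ⟨hk, h4, hlt⟩
        · exact hj j hj1 (by omega)
  · rintro τ ⟨hF, -, hj⟩
    exact hQ τ hF ⟨fun i hi hi' => (hj i hi hi').1, fun i hi hi' => (hj i hi hi').2.1,
      fun i hi hi' => (hj i hi hi').2.2⟩

end RAM

/-! ### The program: the table of the dynamic program -/

namespace RAM

/-- The dimension `2 * n + 1` of the table. -/
def dim : Expr := 2 * .reg 0 + 1

/-- Computes one entry of the table: the minimum over all the frequencies `i + 1` of the vertex
in register `5`, whose parent is in register `6`. The index of the entry in its row is in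
register `3`. The test compares `i` with the frequency of the parent and with the units that are
left, by truncated subtractions. The minimum is left in register `7`, and the frequency that attains
it in register `8`. -/
def minimize : Prog :=
  .seq (.assign 7 (16 * (.reg 0 * .reg 0))) <|
  .seq (.assign 8 0) <|
  .forUp 4 (2 * .reg 0) <|
  .ite ((.reg 3 / dim - .reg 4) * (.reg 3 % dim - .reg 4))
    (.seq (.assign 9 (.cell 5 (.reg 4 + 1) +
        .cell 6 (.cell 8 (.reg 5) * (dim * dim) + ((.reg 4 + 1) * dim + 2 * .reg 0)) +
        .cell 6 (.cell 8 (.reg 6) * (dim * dim) + .reg 3 - (.reg 4 + 1)))) <|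
      .ite (.reg 7 - .reg 9) (.seq (.assign 7 (.reg 9)) (.assign 8 (.reg 4 + 1))) .skip)
    .skip

/-- Computes a row of the table: the minima go to array `6`, the frequencies that attain them to
array `7`. -/
def fillRow : Prog :=
  .forUp 3 (dim * dim) <|
  .seq minimize <|
  .seq (.store 6 ((.reg 5 + 1) * (dim * dim) + .reg 3) (.reg 7)) <|
  .store 7 ((.reg 5 + 1) * (dim * dim) + .reg 3) (.reg 8)

/-- Computes the table. The vertices are processed in increasing order of their keys, and array `8`
holds the child that was processed last, for every vertex. -/
def fillTable : Prog :=
  .forUp 2 (.reg 0 * .reg 0) <|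
  .seq (.assign 5 (.reg 2 % .reg 0)) <|
  .ite (Expr.eq (.cell 4 (.reg 5)) (.reg 2 / .reg 0))
    (.seq (.assign 6 (.cell 3 (.reg 5) - 1)) <|
      .seq fillRow <|
      .store 8 (.reg 6) (.reg 5 + 1))
    .skip

variable {n B : ℕ} {r : Fin n} {par : Fin n → Fin n}

/-- The three-dimensional table stored in an array: row `b` occupies `(2 * n + 1) ^ 2` cells. -/
def tableOf (n : ℕ) (A : ℕ → ℕ) (b j c : ℕ) : ℕ :=
  A (b * ((2 * n + 1) * (2 * n + 1)) + (j * (2 * n + 1) + c))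

theorem eval_dim {σ : State} (h0 : σ.reg 0 = n) : dim.eval σ = 2 * n + 1 := by
  simp [dim, h0]

/-- The cost of the frequency `i` for the entry with index `q`, if the rows `a` and `b` hold the
results for the children and for the earlier siblings. -/
def candidate (n : ℕ) (per A : ℕ → ℕ) (a b q i : ℕ) : ℕ :=
  per i + A (a * ((2 * n + 1) * (2 * n + 1)) + (i * (2 * n + 1) + 2 * n)) +
    A (b * ((2 * n + 1) * (2 * n + 1)) + q - i)

/-- The value `x` is the minimum of the costs of all feasible frequencies, attained at `y`, or at
least `16 * n ^ 2` if there are none. -/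
structure IsMinimum (n : ℕ) (per A : ℕ → ℕ) (a b q x y : ℕ) : Prop where
  le_big : x ≤ 16 * (n * n)
  choice_le : y ≤ 2 * n
  le : ∀ i, 1 ≤ i → i ≤ q / (2 * n + 1) → i ≤ q % (2 * n + 1) → x ≤ candidate n per A a b q i
  choice : x < 16 * (n * n) → 1 ≤ y ∧ y ≤ q / (2 * n + 1) ∧ y ≤ q % (2 * n + 1) ∧
    candidate n per A a b q y ≤ x

theorem minimize_wp (hB : 100 * (n * n) ≤ B) {σ : State} (h0 : σ.reg 0 = n)
    (h5 : ∀ i, 1 ≤ i → i ≤ 2 * n → σ.arr 5 i ≤ 16 * n) (h6 : ∀ i, σ.arr 6 i ≤ 16 * (n * n))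
    {Q : State → Prop}
    (hQ : ∀ τ, τ.arr = σ.arr → (∀ x, x ≠ 4 → x ≠ 7 → x ≠ 8 → x ≠ 9 → τ.reg x = σ.reg x) →
      IsMinimum n (σ.arr 5) (σ.arr 6) (σ.arr 8 (σ.reg 5)) (σ.arr 8 (σ.reg 6)) (σ.reg 3)
        (τ.reg 7) (τ.reg 8) → Q τ) :
    minimize.wp B Q σ := by
  have hnn : n ≤ n * n := Nat.le_mul_self n
  set cand := candidate n (σ.arr 5) (σ.arr 6) (σ.arr 8 (σ.reg 5)) (σ.arr 8 (σ.reg 6)) (σ.reg 3)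
    with hcand
  refine ⟨?_, Nat.zero_le _, ?_⟩
  · simp [h0]
    omega
  refine Prog.wp_forUp (2 * n) (fun i τ => τ.arr = σ.arr ∧
    (∀ x, x ≠ 4 → x ≠ 7 → x ≠ 8 → x ≠ 9 → τ.reg x = σ.reg x) ∧ τ.reg 4 = i ∧
    τ.reg 7 ≤ 16 * (n * n) ∧ τ.reg 8 ≤ 2 * n ∧
    (∀ i', 1 ≤ i' → i' ≤ i → i' ≤ σ.reg 3 / (2 * n + 1) → i' ≤ σ.reg 3 % (2 * n + 1) →
      τ.reg 7 ≤ cand i') ∧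
    (τ.reg 7 < 16 * (n * n) → 1 ≤ τ.reg 8 ∧ τ.reg 8 ≤ σ.reg 3 / (2 * n + 1) ∧
      τ.reg 8 ≤ σ.reg 3 % (2 * n + 1) ∧ cand (τ.reg 8) ≤ τ.reg 7)) (by omega) ?_ ?_ ?_ ?_
  · rintro i τ ⟨-, hr, hi, -⟩
    have h00 : τ.reg 0 = n := by rw [hr] <;> norm_num [h0]
    exact ⟨by simp [h00], hi⟩
  · refine ⟨rfl, fun x h1 h2 h3 _ => by simp [h1, h2, h3], by simp, by simp [h0], by simp,
      fun i' h1 h2 => by omega, fun h => ?_⟩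
    simp [h0] at h
  · rintro i hi τ ⟨ha, hr, h4, h7, h8, hle, hch⟩
    have h00 : τ.reg 0 = n := by rw [hr] <;> norm_num [h0]
    have h03 : τ.reg 3 = σ.reg 3 := hr 3 (by norm_num) (by norm_num) (by norm_num) (by norm_num)
    have h05 : τ.reg 5 = σ.reg 5 := hr 5 (by norm_num) (by norm_num) (by norm_num) (by norm_num)
    have h06 : τ.reg 6 = σ.reg 6 := hr 6 (by norm_num) (by norm_num) (by norm_num) (by norm_num)
    have hd := eval_dim h00
    have hcb : cand (i + 1) ≤ 100 * (n * n) := by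
      have h1 := h5 (i + 1) (by omega) (by omega)
      rw [hcand, candidate]
      have h2 := h6 (σ.arr 8 (σ.reg 5) * ((2 * n + 1) * (2 * n + 1)) +
        ((i + 1) * (2 * n + 1) + 2 * n))
      have h3 := h6 (σ.arr 8 (σ.reg 6) * ((2 * n + 1) * (2 * n + 1)) + σ.reg 3 - (i + 1))
      omega
    have hlast : ∀ x, (x ≤ cand (i + 1) ∨ ¬ (i + 1 ≤ σ.reg 3 / (2 * n + 1) ∧
        i + 1 ≤ σ.reg 3 % (2 * n + 1))) → x ≤ τ.reg 7 → ∀ i', 1 ≤ i' → i' ≤ i + 1 →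
        i' ≤ σ.reg 3 / (2 * n + 1) → i' ≤ σ.reg 3 % (2 * n + 1) → x ≤ cand i' := by
      intro x hx hx7 i' h1 h2 h3 h4
      rcases Nat.lt_or_ge i i' with h | h
      · obtain rfl : i' = i + 1 := by omega
        exact hx.resolve_right fun h => h ⟨h3, h4⟩
      · exact hx7.trans (hle i' h1 h h3 h4)
    have hc : σ.arr 5 (i + 1) +
        σ.arr 6 (σ.arr 8 (σ.reg 5) * ((2 * n + 1) * (2 * n + 1)) +
          ((i + 1) * (2 * n + 1) + 2 * n)) +
        σ.arr 6 (σ.arr 8 (σ.reg 6) * ((2 * n + 1) * (2 * n + 1)) + σ.reg 3 - (i + 1)) =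
        cand (i + 1) := rfl
    simp only [Prog.wp, Expr.eval_mul, Expr.eval_sub, Expr.eval_div, Expr.eval_mod, Expr.eval_reg,
      Expr.eval_add, Expr.eval_cell, Expr.eval_one, Expr.eval_ofNat, hd, h00, h03, h05, h06, h4, ha,
      hc, State.setReg_reg, State.setReg_arr, Nat.reduceEqDiff, if_true, if_false]
    refine ⟨fun hcond => ⟨by omega, fun hlt => ⟨by omega, by omega, ?_⟩, fun hge => ?_⟩,
      fun hcond => ?_⟩
    · obtain ⟨hc1, hc2⟩ := mul_ne_zero_iff.1 hcond
      refine ⟨trivial, trivial, fun x h1 h2 h3 h4 => ?_, trivial, by omega, by omega,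
        hlast _ (.inl le_rfl) (by omega), fun _ => ⟨by omega, by omega, by omega, le_rfl⟩⟩
      rw [if_neg h1, if_neg h3, if_neg h2, if_neg h4]
      exact hr x h1 h2 h3 h4
    · refine ⟨trivial, trivial, fun x h1 h2 h3 h4 => ?_, trivial, h7, h8,
        hlast _ (.inl (by omega)) le_rfl, hch⟩
      rw [if_neg h1, if_neg h4]
      exact hr x h1 h2 h3 h4
    · refine ⟨trivial, trivial, fun x h1 h2 h3 h4 => ?_, trivial, h7, h8,
        hlast _ (.inr fun h => ?_) le_rfl, hch⟩
      · rw [if_neg h1]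
        exact hr x h1 h2 h3 h4
      · rcases mul_eq_zero.1 hcond with h' | h' <;> omega
  · rintro τ ⟨ha, hr, -, h7, h8, hle, hch⟩
    refine hQ τ ha hr ⟨h7, h8, fun i h1 h2 h3 => hle i h1 ?_ h2 h3, hch⟩
    have := Nat.mod_lt (σ.reg 3) (by omega : 0 < 2 * n + 1)
    omega

theorem add_div_of_lt {W q : ℕ} (hq : q < W) (b : ℕ) : (b * W + q) / W = b := by
  rw [mul_comm, Nat.mul_add_div (by omega), Nat.div_eq_of_lt hq, add_zero]

theorem index_lt {n j c : ℕ} (hj : j ≤ 2 * n) (hc : c ≤ 2 * n) :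
    j * (2 * n + 1) + c < (2 * n + 1) * (2 * n + 1) := by
  have := Nat.mul_le_mul_right (2 * n + 1) hj
  rw [add_mul (2 * n) 1, one_mul]
  omega

theorem candidate_eq {per A : ℕ → ℕ} {a b j c i : ℕ} (hc : i ≤ c) :
    candidate n per A a b (j * (2 * n + 1) + c) i =
      per i + tableOf n A a i (2 * n) + tableOf n A b j (c - i) := by
  rw [candidate, tableOf, tableOf]
  congr 2
  omega

/-- Changes in other rows do not matter. -/
theorem IsMinimum.congr {per A A' : ℕ → ℕ} {a b q x y d : ℕ} (h : IsMinimum n per A a b q x y)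
    (hq : q < (2 * n + 1) * (2 * n + 1)) (ha : a ≠ d) (hb : b ≠ d)
    (hA : ∀ i, i / ((2 * n + 1) * (2 * n + 1)) ≠ d → A' i = A i) :
    IsMinimum n per A' a b q x y := by
  have hc (i : ℕ) (h2 : i ≤ q / (2 * n + 1)) (h3 : i ≤ q % (2 * n + 1)) :
      candidate n per A' a b q i = candidate n per A a b q i := by
    have h4 : q / (2 * n + 1) < 2 * n + 1 := Nat.div_lt_of_lt_mul hq
    have h5 := Nat.mod_le q (2 * n + 1)
    rw [candidate, candidate, hA, hA]
    · rw [Nat.add_sub_assoc (h3.trans h5), add_div_of_lt (by omega)]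
      exact hb
    · rw [add_div_of_lt (index_lt (by omega) le_rfl)]
      exact ha
  refine ⟨h.le_big, h.choice_le, fun i h1 h2 h3 => ?_, fun hx => ?_⟩
  · rw [hc i h2 h3]
    exact h.le i h1 h2 h3
  · obtain ⟨h1, h2, h3, h4⟩ := h.choice hx
    exact ⟨h1, h2, h3, by rwa [hc y h2 h3]⟩

theorem fillRow_wp (hB : 100 * (n * n) ≤ B) (hn : 1 ≤ n) {σ : State} (h0 : σ.reg 0 = n)
    (h5 : ∀ i, 1 ≤ i → i ≤ 2 * n → σ.arr 5 i ≤ 16 * n) (h6 : ∀ i, σ.arr 6 i ≤ 16 * (n * n))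
    (ha : σ.arr 8 (σ.reg 5) ≠ σ.reg 5 + 1) (hb : σ.arr 8 (σ.reg 6) ≠ σ.reg 5 + 1)
    {Q : State → Prop}
    (hQ : ∀ τ, (∀ x, x ≠ 3 → x ≠ 4 → x ≠ 7 → x ≠ 8 → x ≠ 9 → τ.reg x = σ.reg x) →
      (∀ x, x ≠ 6 → x ≠ 7 → τ.arr x = σ.arr x) →
      (∀ i, i / ((2 * n + 1) * (2 * n + 1)) ≠ σ.reg 5 + 1 →
        τ.arr 6 i = σ.arr 6 i ∧ τ.arr 7 i = σ.arr 7 i) →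
      (∀ i, τ.arr 6 i ≤ 16 * (n * n)) →
      (∀ q < (2 * n + 1) * (2 * n + 1), IsMinimum n (σ.arr 5) (σ.arr 6) (σ.arr 8 (σ.reg 5))
        (σ.arr 8 (σ.reg 6)) q (τ.arr 6 ((σ.reg 5 + 1) * ((2 * n + 1) * (2 * n + 1)) + q))
        (τ.arr 7 ((σ.reg 5 + 1) * ((2 * n + 1) * (2 * n + 1)) + q))) → Q τ) :
    fillRow.wp B Q σ := by
  have hnn : n ≤ n * n := Nat.le_mul_self n
  set W := (2 * n + 1) * (2 * n + 1) with hW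
  have hWB : W ≤ B := by
    have : W = 4 * (n * n) + 4 * n + 1 := by rw [hW]; ring
    omega
  refine Prog.wp_forUp W (fun q τ =>
      (∀ x, x ≠ 3 → x ≠ 4 → x ≠ 7 → x ≠ 8 → x ≠ 9 → τ.reg x = σ.reg x) ∧ τ.reg 3 = q ∧
      (∀ x, x ≠ 6 → x ≠ 7 → τ.arr x = σ.arr x) ∧
      (∀ i, i / W ≠ σ.reg 5 + 1 → τ.arr 6 i = σ.arr 6 i ∧ τ.arr 7 i = σ.arr 7 i) ∧
      (∀ i, τ.arr 6 i ≤ 16 * (n * n)) ∧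
      (∀ q' < q, IsMinimum n (σ.arr 5) (σ.arr 6) (σ.arr 8 (σ.reg 5))
        (σ.arr 8 (σ.reg 6)) q' (τ.arr 6 ((σ.reg 5 + 1) * W + q'))
        (τ.arr 7 ((σ.reg 5 + 1) * W + q')))) hWB ?_ ?_ ?_ ?_
  · rintro q τ ⟨hr, h3, -⟩
    have h00 : τ.reg 0 = n :=
      (hr 0 (by norm_num) (by norm_num) (by norm_num) (by norm_num) (by norm_num)).trans h0
    exact ⟨by rw [Expr.eval_mul, eval_dim h00], h3⟩
  · exact ⟨fun x h1 _ _ _ _ => by simp [h1], by simp, fun _ _ _ => rfl, fun _ _ => ⟨rfl, rfl⟩, h6,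
      fun q hq => absurd hq (Nat.not_lt_zero q)⟩
  · rintro q hq τ ⟨hr, h3, hA, hout, hbd, hmin⟩
    have hreg (x : ℕ) (h1 : x ≠ 3) (h2 : x ≠ 4) (h3 : x ≠ 7) (h4 : x ≠ 8) (h5 : x ≠ 9) :=
      hr x h1 h2 h3 h4 h5
    have h00 : τ.reg 0 = n := by rw [hr] <;> norm_num [h0]
    have h05 : τ.reg 5 = σ.reg 5 := by rw [hr] <;> norm_num
    have h06 : τ.reg 6 = σ.reg 6 := by rw [hr] <;> norm_num
    have hA5 : τ.arr 5 = σ.arr 5 := by rw [hA] <;> norm_num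
    have hA8 : τ.arr 8 = σ.arr 8 := by rw [hA] <;> norm_num
    refine minimize_wp hB h00 (hA5 ▸ h5) hbd fun ρ hρA hρr hρ => ?_
    rw [hA5, hA8, h05, h06, h3] at hρ
    have hρ' := hρ.congr hq ha hb fun i hi => ((hout i hi).1).symm
    have hρ0 : ρ.reg 0 = n := by rw [hρr] <;> norm_num [h00]
    have hρ3 : ρ.reg 3 = q := by rw [hρr] <;> norm_num [h3]
    have hρ5 : ρ.reg 5 = σ.reg 5 := by rw [hρr] <;> norm_num [h05]
    have h1 := hρ.le_big
    have h2 := hρ.choice_le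
    have hd := eval_dim hρ0
    have hd' : dim.eval (ρ.setArr 6 ((σ.reg 5 + 1) * W + q) (ρ.reg 7)) = 2 * n + 1 := eval_dim hρ0
    simp only [Prog.wp, Expr.eval_add, Expr.eval_mul, Expr.eval_reg, Expr.eval_one, hd, hρ5, hρ3,
      ← hW, State.setArr_reg, hd']
    refine ⟨by omega, by omega, trivial, fun x h1 h2 h3 h4 h5 => ?_, by simp,
      fun x h1 h2 => ?_, fun i hi => ?_, fun i => ?_, fun q' hq' => ?_⟩
    · simp only [State.setReg_reg, State.setArr_reg, if_neg h1]
      rw [hρr x h2 h3 h4 h5, hr x h1 h2 h3 h4 h5]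
    · simp only [State.setReg_arr, State.setArr_arr, if_neg h1, if_neg h2, hρA]
      exact hA x h1 h2
    · have hne : i ≠ (σ.reg 5 + 1) * W + q := by
        rintro rfl
        exact hi (add_div_of_lt hq _)
      simp only [State.setReg_arr, State.setArr_arr, Nat.reduceEqDiff, if_true, if_false, hρA,
        Function.update_of_ne hne]
      exact hout i hi
    · simp only [State.setReg_arr, State.setArr_arr, Nat.reduceEqDiff, if_true, if_false, hρA,
        Function.update_apply]
      split_ifs
      exacts [h1, hbd i]
    · simp only [State.setReg_arr, State.setArr_arr, Nat.reduceEqDiff, if_true, if_false, hρA,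
        Function.update_apply]
      rcases Nat.lt_or_ge q' q with h | h
      · rw [if_neg (by omega), if_neg (by omega)]
        exact hmin q' h
      · obtain rfl : q' = q := by omega
        rw [if_pos rfl, if_pos rfl]
        exact hρ'
  · rintro τ ⟨hr, -, hA, hout, hbd, hmin⟩
    exact hQ τ hr hA hout hbd hmin

/-- The keys of the vertices: they are sorted by the sizes of their subtrees. -/
noncomputable def sizeKey (par : Fin n → Fin n) (v : Fin n) : ℕ := subtreeSize par v * n + v

theorem sizeKey_div (v : Fin n) : sizeKey par v / n = subtreeSize par v := by
  rw [sizeKey, mul_comm, Nat.mul_add_div v.pos, Nat.div_eq_of_lt v.2, add_zero]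

theorem isProcessingOrder [NeZero n] {G : SimpleGraph (Fin n)} (hp : IsParentMap G r par) :
    IsProcessingOrder r par (sizeKey par) := by
  refine ⟨fun v => ?_, fun v => ?_, fun v hv => ?_⟩
  · apply Fin.ext
    rw [Fin.ofNat, sizeKey, mul_comm]
    dsimp only
    rw [Nat.mul_add_mod, Nat.mod_eq_of_lt v.2]
  · rw [← Nat.div_lt_iff_lt_mul r.pos, sizeKey_div]
    constructor
    · rintro h rfl
      have := hp.card_le_subtreeSize_root
      rw [Fintype.card_fin] at this
      omega
    · intro hv
      simpa using hp.subtreeSize_lt_card hv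
  · have h1 := hp.subtreeSize_lt_par hv
    have h2 := Nat.mul_le_mul_right n h1
    have h3 := v.2
    rw [Nat.succ_mul] at h2
    rw [sizeKey, sizeKey]
    omega

theorem subtreeSize_le_of_sizeKey_lt (v w : Fin n) (h : sizeKey par v < sizeKey par w) :
    subtreeSize par v ≤ subtreeSize par w := by
  rw [← sizeKey_div, ← sizeKey_div]
  exact Nat.div_le_div_right h.le

theorem subtreeSize_eq_div_iff [NeZero n] (k : ℕ) :
    subtreeSize par (Fin.ofNat n k) = k / n ↔ sizeKey par (Fin.ofNat n k) = k := by
  have h1 : ((Fin.ofNat n k : Fin n) : ℕ) = k % n := rfl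
  have h2 := Nat.div_add_mod' k n
  constructor
  · intro h
    rw [sizeKey, h, h1, h2]
  · intro h
    rw [← sizeKey_div, h]

/-- Changes in the row of a vertex that is processed later do not matter. -/
theorem _root_.IsTableRow.congr [NeZero n] {key : Fin n → ℕ} {per A A' C C' : ℕ → ℕ} {big : ℕ}
    {w v : Fin n} (h : IsTableRow key par per (tableOf n A) (tableOf n C) big w)
    (hwv : key w < key v)
    (hA : ∀ i, i / ((2 * n + 1) * (2 * n + 1)) ≠ v + 1 → A' i = A i)
    (hC : ∀ i, i / ((2 * n + 1) * (2 * n + 1)) ≠ v + 1 → C' i = C i) :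
    IsTableRow key par per (tableOf n A') (tableOf n C') big w := by
  have hA' (b j c : ℕ) (hb : b ≠ v + 1) (hj : j ≤ 2 * n) (hc : c ≤ 2 * n) :
      tableOf n A' b j c = tableOf n A b j c :=
    hA _ (by rwa [add_div_of_lt (index_lt hj hc)])
  have hC' (b j c : ℕ) (hb : b ≠ v + 1) (hj : j ≤ 2 * n) (hc : c ≤ 2 * n) :
      tableOf n C' b j c = tableOf n C b j c :=
    hC _ (by rwa [add_div_of_lt (index_lt hj hc)])
  have hw : (w : ℕ) + 1 ≠ v + 1 := fun h => by
    obtain rfl : w = v := Fin.ext (by omega)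
    omega
  have hl (u : Fin n) : lastChild key par (key w) u ≠ v + 1 :=
    IsProcessingOrder.lastChild_ne hwv.le u
  constructor
  · intro j c i hj hc h1 h2 h3
    rw [hA' _ _ _ hw hj hc, hA' _ _ _ (hl _) (by omega) le_rfl, hA' _ _ _ (hl _) hj (by omega)]
    exact h.le j c i hj hc h1 h2 h3
  · intro j c hj hc hbig
    rw [hA' _ _ _ hw hj hc] at hbig
    obtain ⟨h1, h2, h3, h4⟩ := h.choice j c hj hc hbig
    rw [hC' _ _ _ hw hj hc, hA' _ _ _ hw hj hc, hA' _ _ _ (hl _) (by omega) le_rfl,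
      hA' _ _ _ (hl _) hj (by omega)]
    exact ⟨h1, h2, h3, h4⟩

theorem fillTable_wp [NeZero n] {G : SimpleGraph (Fin n)} (hp : IsParentMap G r par)
    (hB : 100 * (n * n) ≤ B) {σ : State} (h0 : σ.reg 0 = n) (h1 : σ.reg 1 = r)
    (h3 : ∀ v : Fin n, σ.arr 3 v = par v + 1) (h4 : ∀ v : Fin n, σ.arr 4 v = subtreeSize par v)
    (hper : IsPeriodTable n (σ.arr 5)) (h6 : σ.arr 6 = fun _ => 0) (h8 : σ.arr 8 = fun _ => 0)
    {Q : State → Prop}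
    (hQ : ∀ τ, Frame n r {6, 7, 8} σ τ → IsTable (sizeKey par) par (σ.arr 5)
      (tableOf n (τ.arr 6)) (tableOf n (τ.arr 7)) (16 * (n * n)) (n * n) → Q τ) :
    fillTable.wp B Q σ := by
  have hnn : n ≤ n * n := Nat.le_mul_self n
  have hn : 1 ≤ n := r.pos
  have hK := isProcessingOrder hp
  have h5 (i : ℕ) (hi : 1 ≤ i) (hi' : i ≤ 2 * n) : σ.arr 5 i ≤ 16 * n :=
    (Nat.le_mul_of_pos_right _ hi).trans (hper.mul_lt i hi hi').le
  refine Prog.wp_forUp (n * n) (fun k τ => Frame n r {6, 7, 8} σ τ ∧ τ.reg 2 = k ∧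
      (∀ u : Fin n, τ.arr 8 u = lastChild (sizeKey par) par k u) ∧
      (∀ i, τ.arr 6 i ≤ 16 * (n * n)) ∧
      IsTable (sizeKey par) par (σ.arr 5) (tableOf n (τ.arr 6)) (tableOf n (τ.arr 7))
        (16 * (n * n)) k) (by omega) ?_ ?_ ?_ ?_
  · rintro k τ ⟨hF, hk, -⟩
    exact ⟨by simp [hF.reg_zero], hk⟩
  · exact ⟨(Frame.refl h0 h1).setReg _ _ le_rfl, by simp, fun u => by simp [h8, lastChild],
      fun i => by simp [h6], fun j c _ _ => by simp [tableOf, h6],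
      fun v hv => absurd hv (Nat.not_lt_zero _)⟩
  · rintro k hk τ ⟨hF, h2, hl, hbd, hT⟩
    set v : Fin n := Fin.ofNat n k with hv
    have hkv : k % n = v := rfl
    have hA (x : ℕ) (hx : x ∉ ({6, 7, 8} : Set ℕ)) := hF.arr x hx
    have hvn := v.2
    refine ⟨by simp only [Expr.eval_mod, Expr.eval_reg, h2, hF.reg_zero, hkv]; omega, ?_⟩
    simp only [Expr.eval_mod, Expr.eval_reg, h2, hF.reg_zero, hkv]
    refine ⟨fun hc => ?_, fun hc => ?_⟩
    · rw [Expr.eval_eq_ne_zero] at hc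
      simp only [Expr.eval_cell, Expr.eval_reg, Expr.eval_div, State.setReg_reg, State.setReg_arr,
        Nat.reduceEqDiff, if_true, if_false, h2, hF.reg_zero, hA 4 (by simp), h4,
        OfNat.zero_ne_ofNat] at hc
      rw [hv, subtreeSize_eq_div_iff, ← hv] at hc
      have hpar : (Expr.cell 3 (.reg 5) - 1 : Expr).eval (τ.setReg 5 v) = par v := by
        simp [hA 3 (by simp), h3]
      refine ⟨by rw [hpar]; have := (par v).2; omega, ?_⟩
      rw [hpar]
      set τ' := (τ.setReg 5 v).setReg 6 (par v) with hτ'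
      have hF' : Frame n r {6, 7, 8} σ τ' :=
        (hF.setReg _ _ (by norm_num)).setReg _ _ (by norm_num)
      have h5' : τ'.reg 5 = v := by simp [hτ']
      have h6' : τ'.reg 6 = par v := by simp [hτ']
      have hτA : τ'.arr = τ.arr := rfl
      have hA5 : τ'.arr 5 = σ.arr 5 := hA 5 (by simp)
      have hlv (u : Fin n) : τ'.arr 8 u ≠ v + 1 := by
        rw [hτA, hl, ← hc]
        exact IsProcessingOrder.lastChild_ne le_rfl u
      refine fillRow_wp hB hn hF'.reg_zero (hA5 ▸ h5) hbd (by rw [h5']; exact hlv v)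
        (by rw [h5', h6']; exact hlv _) fun ρ hρr hρA hρo hρb hρm => ?_
      rw [h5'] at hρo hρm
      rw [h6', hA5, hτA, hl, hl] at hρm
      have hρ5 : ρ.reg 5 = v := by rw [hρr] <;> norm_num [h5']
      have hρ6 : ρ.reg 6 = par v := by rw [hρr] <;> norm_num [h6']
      refine ⟨by simp only [Expr.eval_add, Expr.eval_reg, Expr.eval_one, hρ5]; have := v.2; omega,
        ?_, ⟨?_, ?_, fun x hx => ?_⟩, by simp, fun u => ?_, fun i => ?_, ?_, fun w hw => ?_⟩
      · rw [State.setArr_reg, hρr _ (by norm_num) (by norm_num) (by norm_num) (by norm_num)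
          (by norm_num)]
        simpa [hτ'] using h2
      · simp only [State.setReg_reg, State.setArr_reg, OfNat.zero_ne_ofNat, if_false]
        rw [hρr _ (by norm_num) (by norm_num) (by norm_num) (by norm_num) (by norm_num)]
        exact hF'.reg_zero
      · simp only [State.setReg_reg, State.setArr_reg, OfNat.one_ne_ofNat, if_false]
        rw [hρr _ (by norm_num) (by norm_num) (by norm_num) (by norm_num) (by norm_num)]
        exact hF'.reg_one
      · simp only [Set.mem_insert_iff, Set.mem_singleton_iff, not_or] at hx
        simp only [State.setReg_arr, State.setArr_arr, if_neg hx.2.2]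
        rw [hρA x hx.1 hx.2.1]
        exact hA x (by simp [hx])
      · simp only [State.setReg_arr, State.setArr_arr, if_true, Expr.eval_reg, Expr.eval_add,
          Expr.eval_one, hρ5, hρ6, Function.update_apply]
        rw [← hc, hK.lastChild_key_succ, hρA 8 (by norm_num) (by norm_num), hτA, hl, ← hc]
        simp only [← Fin.ext_iff, eq_comm]
      · simpa using hρb i
      · intro j c hj hc'
        have h7 := (hρo (0 * ((2 * n + 1) * (2 * n + 1)) + (j * (2 * n + 1) + c))
          (by rw [add_div_of_lt (index_lt hj hc')]; omega)).1
        have h8 := hT.zero j c hj hc'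
        rw [tableOf] at h8 ⊢
        simp only [State.setReg_arr, State.setArr_arr, Nat.reduceEqDiff, if_false]
        rw [h7]
        exact h8
      · simp only [State.setReg_arr, State.setArr_arr, Nat.reduceEqDiff, if_false]
        rcases Nat.lt_succ_iff_lt_or_eq.1 hw with hw | hw
        · exact (hT.row w hw).congr (v := v) (by omega) (fun i hi => (hρo i hi).1)
            fun i hi => (hρo i hi).2
        · have hwv : w = v := hK.key_injective (hw.trans hc.symm)
          rw [hwv]
          have hout (b j c : ℕ) (hb : b ≠ v + 1) (hj : j ≤ 2 * n) (hc : c ≤ 2 * n) :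
              tableOf n (ρ.arr 6) b j c = tableOf n (τ.arr 6) b j c :=
            (hρo _ (by rwa [add_div_of_lt (index_lt hj hc)])).1
          have hlv' (u : Fin n) : lastChild (sizeKey par) par (sizeKey par v) u ≠ v + 1 :=
            IsProcessingOrder.lastChild_ne le_rfl u
          rw [← hc] at hρm
          have hdiv (j c : ℕ) (hc : c ≤ 2 * n) : (j * (2 * n + 1) + c) / (2 * n + 1) = j :=
            add_div_of_lt (by omega) j
          have hmod (j c : ℕ) (hc : c ≤ 2 * n) : (j * (2 * n + 1) + c) % (2 * n + 1) = c := by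
            rw [mul_comm, Nat.mul_add_mod, Nat.mod_eq_of_lt (by omega)]
          constructor
          · intro j c i hj hc' h7 h8 h9
            have h10 := (hρm _ (index_lt hj hc')).le i h7 (by rwa [hdiv j c hc'])
              (by rwa [hmod j c hc'])
            rw [candidate_eq h9] at h10
            rw [hout _ _ _ (hlv' _) (by omega) le_rfl, hout _ _ _ (hlv' _) hj (by omega)]
            exact h10
          · intro j c hj hc' hbig
            obtain ⟨h7, h8, h9, h10⟩ := (hρm _ (index_lt hj hc')).choice hbig
            rw [hdiv j c hc'] at h8
            rw [hmod j c hc'] at h9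
            rw [candidate_eq h9] at h10
            refine ⟨h7, h8, h9, ?_⟩
            rw [← hout _ _ _ (hlv' _) (h8.trans hj) le_rfl,
              ← hout _ _ _ (hlv' _) hj (by omega)] at h10
            exact h10
    · have hc' : sizeKey par v ≠ k := by
        rw [hv, Ne, ← subtreeSize_eq_div_iff, ← hv]
        intro h
        refine Expr.eval_eq_ne_zero.2 ?_ hc
        simp [hA 4 (by simp), h4, h2, hF.reg_zero, h]
      have hne := hK.key_ne_of_ofNat hc'
      refine ⟨by simpa using h2, (hF.setReg _ _ (by norm_num)).setReg _ _ (by norm_num), by simp,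
        fun u => ?_, hbd, hT.zero, fun w hw => hT.row w ?_⟩
      · rw [IsProcessingOrder.lastChild_succ_of_ne hne]
        exact hl u
      · have := hne w
        omega
  · rintro τ ⟨hF, -, -, -, hT⟩
    exact hQ τ hF hT

end RAM

/-! ### The program: reading off the frequencies and placing the calls -/

section Placement

variable {n : ℕ} {r : Fin n} {par : Fin n → Fin n} {key : Fin n → ℕ} {per : ℕ → ℕ}
  {ch : ℕ → ℕ → ℕ → ℕ} {k : ℕ} {f used a p : Fin n → ℕ}

/-- The frequencies of the vertices with keys from `k` on have been read off from the table, and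
`used u` is the total frequency of the children of `u` among them. -/
structure IsReadOff (r : Fin n) (par : Fin n → Fin n) (key : Fin n → ℕ) (ch : ℕ → ℕ → ℕ → ℕ)
    (k : ℕ) (f used : Fin n → ℕ) : Prop where
  root_freq : f r = 2 * n
  freq : ∀ v, v ≠ r → k ≤ key v → f v = ch (v + 1) (f (par v)) (2 * n - usedBy r par key f v)
  used : ∀ u, used u = ∑ w with w ≠ r ∧ par w = u ∧ k ≤ key w, f w

/-- The calls of the vertices with keys from `k` on have been placed. -/
structure IsPlacedFrom (r : Fin n) (par : Fin n → Fin n) (key : Fin n → ℕ) (per : ℕ → ℕ)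
    (k : ℕ) (f a p : Fin n → ℕ) : Prop where
  root_first : a r = 0
  period : ∀ v, v ≠ r → k ≤ key v → p v = per (f v)
  first : ∀ v, v ≠ r → k ≤ key v → ∀ d, per (f v) = per (f (par v)) * 2 ^ d →
    a v = (a (par v) + 1 + revRound (per (f (par v))) d
      (intervalIndex n (usedBy r par key f v) (per (f v)))) % per (f v)

theorem usedBy_congr {f g : Fin n → ℕ} {v : Fin n} (h : ∀ w, key v < key w → f w = g w) :
    usedBy r par key f v = usedBy r par key g v :=
  Finset.sum_congr rfl fun w hw => h w (Finset.mem_filter.1 hw).2.2.2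

theorem usedBy_update {f : Fin n → ℕ} {v x : Fin n} (h : key v ≤ key x) (y : ℕ) :
    usedBy r par key (Function.update f v y) x = usedBy r par key f x :=
  usedBy_congr fun w hw => Function.update_of_ne (by rintro rfl; omega) _ _

namespace IsReadOff

theorem used_eq {v : Fin n} (h : IsReadOff r par key ch (key v + 1) f used) :
    used (par v) = usedBy r par key f v := h.used (par v)

theorem of_forall_ne (h : IsReadOff r par key ch (k + 1) f used) (hk : ∀ v, key v ≠ k) :
    IsReadOff r par key ch k f used := by
  have h1 (v : Fin n) : k ≤ key v ↔ k + 1 ≤ key v := by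
    have := hk v
    omega
  refine ⟨h.root_freq, fun v hv hv' => h.freq v hv ((h1 v).1 hv'), fun u => ?_⟩
  simp only [h1]
  exact h.used u

variable [NeZero n] (hK : IsProcessingOrder r par key)
include hK

theorem step {v : Fin n} (hv : v ≠ r) (h : IsReadOff r par key ch (key v + 1) f used) {y : ℕ}
    (hy : y = ch (v + 1) (f (par v)) (2 * n - used (par v))) :
    IsReadOff r par key ch (key v) (Function.update f v y)
      (Function.update used (par v) (used (par v) + y)) := by
  have hpar : ∀ x, x ≠ r → key v ≤ key x → par x ≠ v := fun x hx hx' hxv => by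
    have := hK.lt_par x hx
    rw [hxv] at this
    omega
  refine ⟨?_, fun x hx hx' => ?_, fun u => ?_⟩
  · rw [Function.update_of_ne hv.symm]
    exact h.root_freq
  · rw [usedBy_update hx', Function.update_of_ne (hpar x hx hx')]
    rcases hx'.eq_or_lt with hxv | hxv
    · obtain rfl := hK.key_injective hxv
      rw [Function.update_self, hy, h.used_eq]
    · rw [Function.update_of_ne (by rintro rfl; omega)]
      exact h.freq x hx hxv
  · have hsum (u : Fin n) : ∑ w with w ≠ r ∧ par w = u ∧ key v + 1 ≤ key w,
        Function.update f v y w = used u := by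
      rw [h.used u]
      refine Finset.sum_congr rfl fun w hw => Function.update_of_ne ?_ _ _
      rintro rfl
      have := (Finset.mem_filter.1 hw).2.2.2
      omega
    have hle (w : Fin n) : key v ≤ key w ↔ w = v ∨ key v + 1 ≤ key w := by
      rw [Nat.succ_le_iff, le_iff_eq_or_lt, hK.key_injective.eq_iff, eq_comm]
    by_cases hu : u = par v
    · subst hu
      rw [Function.update_self, ← hsum, add_comm]
      have h1 : (Finset.univ.filter fun w => w ≠ r ∧ par w = par v ∧ key v ≤ key w) =
          insert v (Finset.univ.filter fun w => w ≠ r ∧ par w = par v ∧ key v + 1 ≤ key w) := by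
        ext w
        simp only [Finset.mem_filter, Finset.mem_univ, true_and, Finset.mem_insert, hle]
        constructor
        · tauto
        · rintro (rfl | h)
          · exact ⟨hv, rfl, .inl rfl⟩
          · tauto
      rw [h1, Finset.sum_insert (by simp), Function.update_self]
    · rw [Function.update_of_ne hu, ← hsum]
      refine Finset.sum_congr ?_ fun _ _ => rfl
      ext w
      simp only [Finset.mem_filter, Finset.mem_univ, true_and, hle]
      constructor
      · tauto
      · rintro ⟨h1, h2, rfl | h3⟩
        · exact absurd h2.symm hu
        · tauto

end IsReadOff

namespace IsPlacedFrom

theorem of_forall_ne (h : IsPlacedFrom r par key per (k + 1) f a p) (hk : ∀ v, key v ≠ k) :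
    IsPlacedFrom r par key per k f a p := by
  have h1 (v : Fin n) (hv : k ≤ key v) : k + 1 ≤ key v := by
    have := hk v
    omega
  exact ⟨h.root_first, fun v hv hv' => h.period v hv (h1 v hv'),
    fun v hv hv' => h.first v hv (h1 v hv')⟩

theorem step [NeZero n] (hK : IsProcessingOrder r par key) {v : Fin n} (hv : v ≠ r)
    (h : IsPlacedFrom r par key per (key v + 1) f a p) {y z : ℕ}
    (hz : ∀ d, per y = per (f (par v)) * 2 ^ d →
      z = (a (par v) + 1 + revRound (per (f (par v))) d
        (intervalIndex n (usedBy r par key f v) (per y))) % per y) :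
    IsPlacedFrom r par key per (key v) (Function.update f v y) (Function.update a v z)
      (Function.update p v (per y)) := by
  have hpar : ∀ x, x ≠ r → key v ≤ key x → par x ≠ v := fun x hx hx' hxv => by
    have := hK.lt_par x hx
    rw [hxv] at this
    omega
  refine ⟨?_, fun x hx hx' => ?_, fun x hx hx' => ?_⟩
  · rw [Function.update_of_ne hv.symm]
    exact h.root_first
  · rcases hx'.eq_or_lt with hxv | hxv
    · obtain rfl := hK.key_injective hxv
      rw [Function.update_self, Function.update_self]
    · rw [Function.update_of_ne (by rintro rfl; omega),
        Function.update_of_ne (by rintro rfl; omega)]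
      exact h.period x hx hxv
  · rw [usedBy_update hx', Function.update_of_ne (hpar x hx hx'),
      Function.update_of_ne (hpar x hx hx')]
    rcases hx'.eq_or_lt with hxv | hxv
    · obtain rfl := hK.key_injective hxv
      rw [Function.update_self, Function.update_self]
      exact hz
    · rw [Function.update_of_ne (by rintro rfl; omega),
        Function.update_of_ne (by rintro rfl; omega)]
      exact h.first x hx hxv

end IsPlacedFrom

end Placement

namespace RAM

/-- Reverses the last bits of the number in register `9`: the sum of the registers `9` and `11` is
the round `revRound P d J`, where `J` is the initial value of register `9`, the initial value of
register `10` is `P * 2 ^ d`, and `P` is the period of the parent. -/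
def reverseBits : Prog :=
  .forUp 4 (16 * .reg 0) <|
  .ite (.reg 10 - .cell 5 (.cell 9 (.reg 6)))
    (.seq (.assign 10 (.reg 10 / 2)) <|
      .seq (.assign 11 (.reg 11 + .reg 9 % 2 * .reg 10)) <|
      .assign 9 (.reg 9 / 2))
    .skip

/-- Reads off the frequency of the vertex in register `5` and places its calls. -/
def placeVertex : Prog :=
  .seq (.assign 6 (.cell 3 (.reg 5) - 1)) <|
  .seq (.assign 7 (.cell 7 ((.reg 5 + 1) * (dim * dim) +
    (.cell 9 (.reg 6) * dim + (2 * .reg 0 - .cell 10 (.reg 6)))))) <|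
  .seq (.assign 8 (.cell 5 (.reg 7))) <|
  .seq (.assign 9 ((.cell 10 (.reg 6) * .reg 8 + (4 * .reg 0 - 1)) / (4 * .reg 0))) <|
  .seq (.assign 10 (.reg 8)) <|
  .seq (.assign 11 0) <|
  .seq reverseBits <|
  .seq (.store 9 (.reg 5) (.reg 7)) <|
  .seq (.store 10 (.reg 6) (.cell 10 (.reg 6) + .reg 7)) <|
  .seq (.store 2 (.reg 5) (.reg 8)) <|
  .store 1 (.reg 5) ((.cell 1 (.reg 6) + 1 + (.reg 11 + .reg 9)) % .reg 8)

/-- Places all the calls. The vertices are processed in decreasing order of their keys. The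
frequencies go to array `9`, and array `10` holds the total frequencies of the children that are
processed already. -/
def placeAll : Prog :=
  .seq (.store 9 (.reg 1) (2 * .reg 0)) <|
  .seq (.forUp 2 (.reg 0 * .reg 0) <|
    .seq (.assign 3 (.reg 0 * .reg 0 - 1 - .reg 2)) <|
    .seq (.assign 5 (.reg 3 % .reg 0)) <|
    .ite (Expr.eq (.cell 4 (.reg 5)) (.reg 3 / .reg 0)) placeVertex .skip) <|
  .store 2 (.reg 1) 1

variable {n B : ℕ} {r : Fin n} {par : Fin n → Fin n}

theorem reverseBits_wp (hB : 100 * (n * n) ≤ B) {σ : State} (h0 : σ.reg 0 = n) {P d : ℕ}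
    (hP : σ.arr 5 (σ.arr 9 (σ.reg 6)) = P) (h10 : σ.reg 10 = P * 2 ^ d) (hd : 0 < σ.reg 10)
    (hn : σ.reg 10 ≤ 16 * n) (h9 : σ.reg 9 ≤ B) (h11 : σ.reg 11 = 0) {Q : State → Prop}
    (hQ : ∀ τ, τ.arr = σ.arr → (∀ x, x ≠ 4 → x ≠ 9 → x ≠ 10 → x ≠ 11 → τ.reg x = σ.reg x) →
      τ.reg 11 + τ.reg 9 = revRound P d (σ.reg 9) → Q τ) :
    reverseBits.wp B Q σ := by
  have hnn : n ≤ n * n := Nat.le_mul_self n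
  have hP0 : 0 < P := Nat.pos_of_ne_zero fun h => by simp [h] at h10; omega
  refine Prog.wp_forUp (16 * n) (fun i τ => τ.arr = σ.arr ∧
    (∀ x, x ≠ 4 → x ≠ 9 → x ≠ 10 → x ≠ 11 → τ.reg x = σ.reg x) ∧ τ.reg 4 = i ∧
    τ.reg 9 ≤ B ∧ τ.reg 11 + τ.reg 10 ≤ 16 * n ∧ ∃ e ≤ d - i, τ.reg 10 = P * 2 ^ e ∧
    τ.reg 11 + revRound P e (τ.reg 9) = revRound P d (σ.reg 9)) (by omega) ?_ ?_ ?_ ?_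
  · rintro i τ ⟨-, hr, hi, -⟩
    have h00 : τ.reg 0 = n := by rw [hr] <;> norm_num [h0]
    exact ⟨by simp [h00], hi⟩
  · exact ⟨rfl, fun x h1 _ _ _ => by simp [h1], by simp, by simpa using h9, by simpa [h11] using hn,
      d, le_rfl, by simpa using h10, by simp [h11]⟩
  · rintro i hi τ ⟨hA, hr, h4, h9', h1, e, he, h10', heq⟩
    have h06 : τ.reg 6 = σ.reg 6 := by rw [hr] <;> norm_num
    simp only [Prog.wp, Expr.eval_sub, Expr.eval_reg, Expr.eval_cell, h06, hA, hP, Expr.eval_div,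
      Expr.eval_ofNat, Expr.eval_add, Expr.eval_mul, Expr.eval_mod, State.setReg_reg,
      Nat.reduceEqDiff, if_true, if_false, State.setReg_arr, h4]
    refine ⟨fun hc => ?_, fun hc => ?_⟩
    · obtain _ | e := e
      · rw [pow_zero, mul_one] at h10'
        omega
      have h2 : τ.reg 10 / 2 = P * 2 ^ e := by
        rw [h10', pow_succ, ← mul_assoc]
        omega
      have h3 : τ.reg 9 % 2 * (τ.reg 10 / 2) ≤ τ.reg 10 / 2 := by
        rcases Nat.mod_two_eq_zero_or_one (τ.reg 9) with h | h <;> rw [h] <;> omega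
      rw [revRound, ← h2] at heq
      refine ⟨by omega, by omega, by omega, trivial, trivial, fun x h5 h6 h7 h8 => ?_, trivial,
        by omega, by omega, e, by omega, h2, by omega⟩
      simp only [if_neg h5, if_neg h6, if_neg h7, if_neg h8]
      exact hr x h5 h6 h7 h8
    · refine ⟨trivial, trivial, fun x h5 h6 h7 h8 => ?_, trivial, h9', h1, e, ?_, h10', heq⟩
      · simp only [if_neg h5]
        exact hr x h5 h6 h7 h8
      · obtain _ | e := e
        · exact Nat.zero_le _
        · have : P * 2 ^ 1 ≤ P * 2 ^ (e + 1) :=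
            Nat.mul_le_mul_left _ (Nat.pow_le_pow_right (by norm_num) (by omega))
          omega
  · rintro τ ⟨hA, hr, -, -, -, e, he, -, heq⟩
    have h1 : d < 2 ^ d := Nat.lt_two_pow_self
    have h2 : 2 ^ d ≤ P * 2 ^ d := Nat.le_mul_of_pos_left _ hP0
    obtain rfl : e = 0 := by omega
    exact hQ τ hA hr heq

theorem placeVertex_wp (hB : 100 * (n * n) ≤ B) {σ : State} (h0 : σ.reg 0 = n) {v u : Fin n}
    (h5 : σ.reg 5 = v) (h3 : σ.arr 3 v = u + 1) {f p d : ℕ}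
    (hf : tableOf n (σ.arr 7) (v + 1) (σ.arr 9 u) (2 * n - σ.arr 10 u) = f)
    (hfn : σ.arr 10 u + f ≤ 2 * n) (hp : σ.arr 5 f = p) (hp0 : 0 < p) (hpn : p ≤ 16 * n)
    (hd : p = σ.arr 5 (σ.arr 9 u) * 2 ^ d) {Q : State → Prop}
    (hQ : ∀ τ, (∀ x, x ≤ 3 → τ.reg x = σ.reg x) →
      (∀ x, x ∉ ({1, 2, 9, 10} : Set ℕ) → τ.arr x = σ.arr x) →
      τ.arr 9 = Function.update (σ.arr 9) v f →
      τ.arr 10 = Function.update (σ.arr 10) u (σ.arr 10 u + f) →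
      τ.arr 2 = Function.update (σ.arr 2) v p →
      τ.arr 1 = Function.update (σ.arr 1) v ((σ.arr 1 u + 1 +
        revRound (σ.arr 5 (σ.arr 9 u)) d (intervalIndex n (σ.arr 10 u) p)) % p) → Q τ) :
    placeVertex.wp B Q σ := by
  have hnn : n ≤ n * n := Nat.le_mul_self n
  have hn : 1 ≤ n := v.pos
  have hJ : intervalIndex n (σ.arr 10 u) p ≤ B := by
    have h1 : σ.arr 10 u * p ≤ 2 * n * (16 * n) := Nat.mul_le_mul (by omega) hpn
    have h2 : 2 * n * (16 * n) = 32 * (n * n) := by ring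
    have h3 := intervalIndex_mul_lt hn (σ.arr 10 u) p
    have h4 := Nat.le_mul_of_pos_right (intervalIndex n (σ.arr 10 u) p) (by omega : 0 < 4 * n)
    omega
  have hu := u.2
  rw [tableOf] at hf
  have hdim (τ : State) (h : τ.reg 0 = n) := eval_dim h
  rw [intervalIndex] at hJ hQ
  simp only [placeVertex, Prog.wp, Expr.eval_sub, Expr.eval_cell, Expr.eval_reg, Expr.eval_one,
    Expr.eval_add, Expr.eval_mul, Expr.eval_div, Expr.eval_mod, Expr.eval_ofNat, Expr.eval_zero,
    State.setReg_reg, State.setReg_arr, Nat.reduceEqDiff, if_true, if_false, h5, h3,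
    Nat.add_sub_cancel, eval_dim (n := n), h0, hf, hp, OfNat.zero_ne_ofNat]
  refine ⟨by omega, by omega, by omega, hJ, by omega, Nat.zero_le _, ?_⟩
  refine reverseBits_wp (P := σ.arr 5 (σ.arr 9 u)) (d := d) hB (by simpa using h0) (by simp)
    (by simpa using hd) (by simpa using hp0) (by simpa using hpn) (by simpa using hJ) (by simp)
    fun τ hA hr hJ' => ?_
  have hr5 : τ.reg 5 = v := by rw [hr] <;> norm_num [h5]
  have hr6 : τ.reg 6 = u := by rw [hr] <;> norm_num
  have hr7 : τ.reg 7 = f := by rw [hr] <;> norm_num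
  have hr8 : τ.reg 8 = p := by rw [hr] <;> norm_num
  simp only [State.setReg_reg, State.setReg_arr, Nat.reduceEqDiff, if_true, if_false] at hA hJ'
  simp only [hr5, hr6, hr7, hr8, hA, hJ', State.setArr_reg, State.setArr_arr, Nat.reduceEqDiff,
    if_false, OfNat.one_ne_ofNat]
  have hlt := Nat.mod_lt (σ.arr 1 u + 1 + revRound (σ.arr 5 (σ.arr 9 u)) d
    ((σ.arr 10 u * p + (4 * n - 1)) / (4 * n))) hp0
  refine ⟨by omega, by omega, by omega, by omega,
    hQ _ (fun x hx => ?_) (fun x hx => ?_) ?_ ?_ ?_ ?_⟩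
  · simp only [State.setArr_reg]
    rw [hr x (by omega) (by omega) (by omega) (by omega)]
    simp only [State.setReg_reg]
    rw [if_neg (by omega), if_neg (by omega), if_neg (by omega), if_neg (by omega),
      if_neg (by omega), if_neg (by omega)]
  · simp only [Set.mem_insert_iff, Set.mem_singleton_iff, not_or] at hx
    simp [hx, hA]
  all_goals simp [hA]

theorem placeAll_wp [NeZero n] {G : SimpleGraph (Fin n)} (hp : IsParentMap G r par)
    (hB : 100 * (n * n) ≤ B) {σ : State} (h0 : σ.reg 0 = n) (h1 : σ.reg 1 = r)
    (h3 : ∀ v : Fin n, σ.arr 3 v = par v + 1) (h4 : ∀ v : Fin n, σ.arr 4 v = subtreeSize par v)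
    (hper : IsPeriodTable n (σ.arr 5))
    (hT : IsTable (sizeKey par) par (σ.arr 5) (tableOf n (σ.arr 6)) (tableOf n (σ.arr 7))
      (16 * (n * n)) (n * n))
    (ha : σ.arr 1 r = 0) (h10 : σ.arr 10 = fun _ => 0) {Q : State → Prop}
    (hQ : ∀ τ f, IsPlacement r par n (σ.arr 5) (sizeKey par) f (fun v => τ.arr 1 v)
        (fun v => τ.arr 2 v) →
      (∀ g, IsFeasible r par (2 * n) g →
        ∑ v with v ≠ r, σ.arr 5 (f v) ≤ ∑ v with v ≠ r, σ.arr 5 (g v)) → Q τ) :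
    placeAll.wp B Q σ := by
  have hnn : n ≤ n * n := Nat.le_mul_self n
  have hn : 1 ≤ n := r.pos
  have hK := isProcessingOrder hp
  have hbig := hT.root_lt_big hK hper (by rw [mul_assoc])
  have hupd (A : ℕ → ℕ) (v : Fin n) (x : ℕ) : (fun w : Fin n => Function.update A v x w) =
      Function.update (fun w : Fin n => A w) v x := by
    funext w
    simp [Function.update_apply, Fin.ext_iff]
  refine ⟨by simp [h0]; omega, ?_⟩
  refine Prog.wp_forUp (n * n) (fun i τ => Frame n r {1, 2, 9, 10} σ τ ∧ τ.reg 2 = i ∧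
    IsReadOff r par (sizeKey par) (tableOf n (σ.arr 7)) (n * n - i) (fun v => τ.arr 9 v)
      (fun v => τ.arr 10 v) ∧
    IsPlacedFrom r par (sizeKey par) (σ.arr 5) (n * n - i) (fun v => τ.arr 9 v)
      (fun v => τ.arr 1 v) (fun v => τ.arr 2 v)) (by omega) ?_ ?_ ?_ ?_
  · rintro k τ ⟨hF, hk, -⟩
    exact ⟨by simp [hF.reg_zero], hk⟩
  · have hroot (v : Fin n) (hv : v ≠ r) (h : n * n - 0 ≤ sizeKey par v) : False := by
      have := (hK.lt_iff v).2 hv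
      omega
    refine ⟨((Frame.refl h0 h1).setArr _ _ (by simp)).setReg _ _ le_rfl, by simp,
      ⟨by simp [h0, h1], fun v hv h => (hroot v hv h).elim, fun u => ?_⟩,
      by simp [ha], fun v hv h => (hroot v hv h).elim, fun v hv h => (hroot v hv h).elim⟩
    rw [Finset.sum_eq_zero]
    · simp [h10]
    · intro w hw
      simp only [Finset.mem_filter, Finset.mem_univ, true_and] at hw
      exact (hroot w hw.1 hw.2.2).elim
  · rintro i hi τ ⟨hF, h2, hR, hP⟩
    set k := n * n - 1 - i with hk
    have hki : n * n - i = k + 1 := by omega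
    have hki' : n * n - (i + 1) = k := by omega
    rw [hki] at hR hP
    rw [hki']
    set v : Fin n := Fin.ofNat n k with hv
    have hkv : k % n = v := rfl
    have hA (x : ℕ) (hx : x ∉ ({1, 2, 9, 10} : Set ℕ)) := hF.arr x hx
    simp only [Prog.wp, Expr.eval_mod, Expr.eval_reg, Expr.eval_sub, Expr.eval_mul, Expr.eval_one,
      State.setReg_reg, Nat.reduceEqDiff, if_true, if_false, h2, hF.reg_zero, OfNat.zero_ne_ofNat,
      ← hk, hkv]
    have hvn := v.2
    refine ⟨by omega, by omega, fun hc => ?_, fun hc => ?_⟩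
    · rw [Expr.eval_eq_ne_zero] at hc
      simp only [Expr.eval_cell, Expr.eval_reg, Expr.eval_div, State.setReg_reg, State.setReg_arr,
        Nat.reduceEqDiff, if_true, if_false, hF.reg_zero, hA 4 (by simp), h4,
        OfNat.zero_ne_ofNat] at hc
      rw [hv, subtreeSize_eq_div_iff, ← hv] at hc
      have hvr : v ≠ r := (hK.lt_iff v).1 (by omega)
      rw [← hc] at hR hP ⊢
      have hR' := hR.step hK hvr rfl
      set f := tableOf n (σ.arr 7) (v + 1) (τ.arr 9 (par v)) (2 * n - τ.arr 10 (par v)) with hf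
      have hC := hT.choices_feasible hK hR'.root_freq hbig (sizeKey par v) (by omega) hR'.freq
      have hne : par v ≠ v := fun h => by
        have := hK.lt_par v hvr
        rw [h] at this
        omega
      obtain ⟨hf1, hf2, hf3⟩ := hC.1 v hvr le_rfl
      rw [usedBy_update le_rfl, ← hR.used_eq, Function.update_self] at hf3
      rw [Function.update_self, Function.update_of_ne hne] at hf2
      rw [Function.update_self] at hf1
      have hf4 := hC.2.1 (par v) (hK.lt_par v hvr).le
      rw [Function.update_of_ne hne] at hf4
      obtain ⟨d, hd⟩ := hper.exists_eq_mul_pow hf1 hf2 hf4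
      have hpos : 0 < σ.arr 5 f := by
        obtain ⟨l, hl⟩ := hper.pow_two f hf1 (hf2.trans hf4)
        rw [hl]
        positivity
      have hle : σ.arr 5 f ≤ 16 * n :=
        (Nat.le_mul_of_pos_right _ hf1).trans (hper.mul_lt f hf1 (hf2.trans hf4)).le
      have hP' := hP.step hK hvr (y := f) (z := (τ.arr 1 (par v) + 1 +
        revRound (σ.arr 5 (τ.arr 9 (par v))) d
          (intervalIndex n (τ.arr 10 (par v)) (σ.arr 5 f))) % σ.arr 5 f) fun d' hd' => by
            have hdd : d = d' := by
              rw [hd] at hd' hpos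
              exact Nat.pow_right_injective le_rfl
                (Nat.eq_of_mul_eq_mul_left (Nat.pos_of_mul_pos_right hpos) hd')
            rw [← hdd, ← hR.used_eq]
      refine placeVertex_wp (σ := (τ.setReg 3 (sizeKey par v)).setReg 5 v) (v := v) (u := par v)
        (f := f) (p := σ.arr 5 f) (d := d) hB ?_ ?_ ?_ ?_ hf3 ?_ hpos hle ?_
        fun ρ hρr hρA hρ9 hρ10 hρ2 hρ1 => ?_
      · simp [hF.reg_zero]
      · simp
      · simp [hA 3 (by simp), h3]
      · simp [hA 7 (by simp), hf]
      · simp [hA 5 (by simp)]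
      · simpa [hA 5 (by simp)] using hd
      · simp only [State.setReg_arr] at hρ9 hρ10 hρ2 hρ1 hρA
        rw [hA 5 (by simp)] at hρ1
        simp only [State.setReg_arr, hρ9, hρ10, hρ2, hρ1, hupd]
        refine ⟨?_, (Frame.setReg ⟨?_, ?_, fun x hx => ?_⟩ _ _ le_rfl), by simp, hR', hP'⟩
        · rw [hρr 2 (by norm_num)]
          simpa using h2
        · rw [hρr 0 (by norm_num)]
          simpa using hF.reg_zero
        · rw [hρr 1 (by norm_num)]
          simpa using hF.reg_one
        · rw [hρA x hx, hA x hx]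
    · have hc' : sizeKey par v ≠ k := by
        rw [hv, Ne, ← subtreeSize_eq_div_iff, ← hv]
        intro h
        refine Expr.eval_eq_ne_zero.2 ?_ hc
        simp [hA 4 (by simp), h4, hF.reg_zero, h]
      have hne := hK.key_ne_of_ofNat hc'
      exact ⟨by simp, ((hF.setReg _ _ (by norm_num)).setReg _ _ (by norm_num)).setReg _ _
        (by norm_num), by simp, hR.of_forall_ne hne, hP.of_forall_ne hne⟩
  · rintro τ ⟨hF, -, hR, hP⟩
    rw [Nat.sub_self] at hR hP
    have hC := hT.choices_feasible hK hR.root_freq hbig 0 (Nat.zero_le _) hR.freq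
    have h2 : Expr.eval τ (.reg 1) = r := hF.reg_one
    refine ⟨by simp; omega, hQ _ (fun v => τ.arr 9 v)
      ⟨hR.root_freq, hP.root_first, ?_, ?_, ?_, ?_, ?_, fun v hv => ?_⟩ fun g hg => ?_⟩
    · simp [h2]
    · exact fun v hv => (hC.1 v hv (Nat.zero_le _)).1
    · exact fun v hv => (hC.1 v hv (Nat.zero_le _)).2.1
    · exact fun v hv => (hC.1 v hv (Nat.zero_le _)).2.2
    · intro v hv
      have hvr : (v : ℕ) ≠ r := fun h => hv (Fin.ext h)
      simp only [State.setArr_arr, if_true, h2, Function.update_of_ne hvr]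
      exact hP.period v hv (Nat.zero_le _)
    · exact hP.first v hv (Nat.zero_le _)
    · refine (hT.sum_choices_le hK hR.root_freq (fun v hv => hR.freq v hv (Nat.zero_le _))
        hbig).trans (hT.root_le_sum hK hg)

end RAM

/-! ### The approximation ratio and the algorithm -/

/-- It suffices to compare the total latencies with integral bounds, since the total latency of a
schedule is unbounded or attains its maximum. -/
theorem Schedule.maxAvgLatency_le_mul {V : Type*} [Fintype V] {G : SimpleGraph V} {r : V}
    (S T : Schedule G) {c : ℕ} (hc : c ≠ 0)
    (h : ∀ b, (∀ t, ∑ v, T.latency r t v ≤ b) → ∀ t, ∑ v, S.latency r t v ≤ c * b) :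
    S.maxAvgLatency r ≤ c * T.maxAvgLatency r := by
  have hV : (Fintype.card V : ℝ≥0∞) ≠ 0 := by
    rw [Nat.cast_ne_zero]
    exact (Fintype.card_pos_iff.2 ⟨r⟩).ne'
  have hle (t : ℕ) : ((∑ v, T.latency r t v : ℕ) : ℝ≥0∞) / Fintype.card V ≤ T.maxAvgLatency r := by
    rw [Nat.cast_sum]
    exact le_iSup (fun t => (∑ v, (T.latency r t v : ℝ≥0∞)) / Fintype.card V) t
  by_cases htop : T.maxAvgLatency r = ⊤
  · rw [htop, ENNReal.mul_top (by simpa using hc)]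
    exact le_top
  have hbdd : BddAbove (Set.range fun t => ∑ v, T.latency r t v) := by
    obtain ⟨m, hm⟩ := ENNReal.exists_nat_gt
      (ENNReal.mul_ne_top htop (ENNReal.natCast_ne_top (Fintype.card V)))
    refine ⟨m, ?_⟩
    rintro _ ⟨t, rfl⟩
    have h1 := (ENNReal.div_le_iff hV (ENNReal.natCast_ne_top _)).1 (hle t)
    exact_mod_cast h1.trans hm.le
  obtain ⟨t₀, ht₀⟩ := Nat.sSup_mem (Set.range_nonempty _) hbdd
  refine iSup_le fun t => ?_
  have h1 := h _ (fun t => le_csSup hbdd ⟨t, rfl⟩) t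
  rw [← ht₀] at h1
  calc (∑ v, (S.latency r t v : ℝ≥0∞)) / Fintype.card V
      ≤ (c * (∑ v, T.latency r t₀ v : ℕ) : ℝ≥0∞) / Fintype.card V := by
        gcongr
        exact_mod_cast h1
    _ = c * ((∑ v, T.latency r t₀ v : ℕ) / Fintype.card V) := by rw [mul_div_assoc]
    _ ≤ c * T.maxAvgLatency r := by gcongr; exact hle t₀

theorem IsPlacement.pow_two {V : Type*} [Fintype V] [DecidableEq V] {r : V} {par : V → V} {n : ℕ}
    {per : ℕ → ℕ} {key f a p : V → ℕ} (h : IsPlacement r par n per key f a p)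
    (hper : IsPeriodTable n per) (v : V) :
    ∃ k, p v = 2 ^ k := by
  by_cases hv : v = r
  · exact ⟨0, by rw [hv, h.root_period, pow_zero]⟩
  · rw [h.period v hv]
    have := h.used_add_le v hv
    exact hper.pow_two _ (h.freq_pos v hv) (by omega)

/-- The approximation ratio: if the frequencies are optimal, the periods contribute at most `32` and
the offsets at most `4` times the optimal value. -/
theorem IsPlacement.exists_schedule {V : Type*} [Fintype V] [DecidableEq V] {G : SimpleGraph V}
    {r : V} {par : V → V} {n : ℕ} {per : ℕ → ℕ} {key f a p : V → ℕ}
    (h : IsPlacement r par n per key f a p) (hp : IsParentMap G r par) (hper : IsPeriodTable n per)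
    (hn : Fintype.card V = n) (hkey : Function.Injective key)
    (hsize : ∀ v w, key v < key w → subtreeSize par v ≤ subtreeSize par w)
    (hopt : ∀ g, IsFeasible r par (2 * n) g →
      ∑ v with v ≠ r, per (f v) ≤ ∑ v with v ≠ r, per (g v)) :
    ∃ S : Schedule G, S.IsDescribedBy r a p ∧ S.maxAvgLatency r ≤ 40 * optAvgRVC G r ∧
      ∃ o, S.IsRegular r p o := by
  have hn1 : 1 ≤ n := hn ▸ Fintype.card_pos_iff.2 ⟨r⟩
  obtain ⟨o, hplan, ho⟩ := h.exists_isCallPlan hp hper hn1 hkey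
  refine ⟨hplan.schedule hp, hplan.schedule_isDescribedBy hp, ?_, hplan.isRegular hp⟩
  rw [optAvgRVC, ENNReal.mul_iInf_of_ne (by norm_num) (by norm_num)]
  refine le_iInf fun T => ?_
  refine ((hplan.schedule hp).maxAvgLatency_le_mul T (c := 36) (by norm_num) fun b hb t => ?_).trans
    (by gcongr; norm_num)
  have h1 := T.le_of_forall_isFeasible hp hb hn hper.mul_lt hopt
  have h2 := T.sum_subtreeSize_mul_rank_le hb hp key hsize
  refine (hplan.sum_latency_le hp t).trans ?_
  have h3 : ∑ v with v ≠ r, p v = ∑ v with v ≠ r, per (f v) :=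
    Finset.sum_congr rfl fun v hv => h.period v (Finset.mem_filter.1 hv).2
  have h4 : ∑ v with v ≠ r, subtreeSize par v * o v ≤ 4 * b := by
    refine le_trans ?_ (Nat.mul_le_mul_left 4 h2)
    rw [Finset.mul_sum]
    refine Finset.sum_le_sum fun v hv => ?_
    rw [mul_left_comm]
    exact Nat.mul_le_mul_left _ (ho v (Finset.mem_filter.1 hv).2)
  omega

namespace RAM

/-- The whole algorithm: the first calls end up in array `1`, and the periods in array `2`. -/
def computeSchedule : Prog :=
  .seq findParents <| .seq findSizes <| .seq findPeriods <| .seq fillTable placeAll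

theorem graphInput_adj {n : ℕ} (G : SimpleGraph (Fin n)) (r u v : Fin n) :
    (graphInput G r).arr 0 (u * n + v) ≠ 0 ↔ G.Adj u v := by
  simp only [graphInput, true_and, ne_eq, ite_eq_right_iff, one_ne_zero, imp_false, not_not]
  constructor
  · rintro ⟨u', v', h, heq⟩
    have h1 : (u : ℕ) = u' := by
      have h2 := congrArg (· / n) heq
      simpa only [add_div_of_lt v.2, add_div_of_lt v'.2] using h2
    have h3 : (v : ℕ) = v' := by
      rw [h1] at heq
      omega
    rwa [Fin.ext h1, Fin.ext h3]
  · exact fun h => ⟨u, v, h, rfl⟩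

theorem graphInput_arr {n : ℕ} (G : SimpleGraph (Fin n)) (r : Fin n) {a : ℕ} (ha : a ≠ 0) :
    (graphInput G r).arr a = fun _ => 0 := by
  funext i
  simp [graphInput, ha]

theorem graphInput_bounded {n : ℕ} (G : SimpleGraph (Fin n)) (r : Fin n) :
    (graphInput G r).Bounded (100 * (n * n)) := by
  have hn := r.2
  have hnn : n ≤ n * n := Nat.le_mul_self n
  constructor
  · intro x
    simp only [graphInput]
    split_ifs <;> omega
  · intro a i
    simp only [graphInput]
    split_ifs <;> omega

theorem computeSchedule_wp {n : ℕ} [NeZero n] {G : SimpleGraph (Fin n)} {r : Fin n}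
    {par : Fin n → Fin n} (hp : IsParentMap G r par) :
    computeSchedule.wp (100 * (n * n)) (fun τ => ∃ per f, IsPeriodTable n per ∧
      IsPlacement r par n per (sizeKey par) f (fun v => τ.arr 1 v) (fun v => τ.arr 2 v) ∧
      ∀ g, IsFeasible r par (2 * n) g →
        ∑ v with v ≠ r, per (f v) ≤ ∑ v with v ≠ r, per (g v)) (graphInput G r) := by
  have harr (a : ℕ) (ha : a ≠ 0) := graphInput_arr G r ha
  refine findParents_wp hp le_rfl rfl rfl (graphInput_adj G r) (harr 3 (by norm_num))
    fun σ₁ h₁ h3 => ?_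
  have e₁ (a : ℕ) (ha : a ≠ 0) (ha3 : a ∉ ({3} : Set ℕ)) : σ₁.arr a = fun _ => 0 :=
    (h₁.arr a ha3).trans (harr a ha)
  refine findSizes_wp le_rfl h₁.reg_zero h₁.reg_one h3 (e₁ 4 (by norm_num) (by simp))
    fun σ₂ h₂ h4 => ?_
  refine findPeriods_wp le_rfl h₂.reg_zero h₂.reg_one fun σ₃ h₃ hper => ?_
  have e₃ (a : ℕ) (ha : a ≠ 0) (ha3 : a ∉ ({3} : Set ℕ)) (ha4 : a ∉ ({4} : Set ℕ))
      (ha5 : a ∉ ({5} : Set ℕ)) : σ₃.arr a = fun _ => 0 := by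
    rw [h₃.arr a ha5, h₂.arr a ha4, e₁ a ha ha3]
  have h3' (v : Fin n) : σ₃.arr 3 v = par v + 1 := by
    rw [h₃.arr 3 (by simp), h₂.arr 3 (by simp), h3]
  have h4' (v : Fin n) : σ₃.arr 4 v = subtreeSize par v := by
    rw [h₃.arr 4 (by simp), h4]
  refine fillTable_wp hp le_rfl h₃.reg_zero h₃.reg_one h3' h4' hper
    (e₃ 6 (by simp) (by simp) (by simp) (by simp)) (e₃ 8 (by simp) (by simp) (by simp) (by simp))
    fun σ₄ h₄ hT => ?_
  have h5 : σ₄.arr 5 = σ₃.arr 5 := h₄.arr 5 (by simp)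
  rw [← h5] at hper hT
  refine placeAll_wp hp le_rfl h₄.reg_zero h₄.reg_one (fun v => ?_) (fun v => ?_) hper hT ?_ ?_
    fun τ f h1 h2 => ⟨_, f, hper, h1, h2⟩
  · rw [h₄.arr 3 (by simp), h3']
  · rw [h₄.arr 4 (by simp), h4']
  · rw [h₄.arr 1 (by simp), e₃ 1 (by simp) (by simp) (by simp) (by simp)]
  · rw [h₄.arr 10 (by simp), e₃ 10 (by simp) (by simp) (by simp) (by simp)]

end RAM

theorem theorem4 :
    ∃ (prog : RAM.Prog) (P : Polynomial ℕ),
      ∀ (n : ℕ) (G : SimpleGraph (Fin n)) (r : Fin n), G.IsTree →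
        ∃ (τ : RAM.State) (time : ℕ),
          RAM.Exec prog (RAM.graphInput G r) τ time ∧
          time ≤ P.eval n ∧
          ∃ S : Schedule G,
            S.IsDescribedBy r (fun v => τ.arr 1 (v : ℕ)) (fun v => τ.arr 2 (v : ℕ)) ∧
            S.maxAvgLatency r ≤ 40 * optAvgRVC G r ∧
            (∃ o : Fin n → ℕ, S.IsRegular r (fun v => τ.arr 2 (v : ℕ)) o) ∧
            ∀ v : Fin n, ∃ k : ℕ, τ.arr 2 (v : ℕ) = 2 ^ k := by
  refine ⟨RAM.computeSchedule,
    RAM.computeSchedule.timeBound.comp (100 * (Polynomial.X * Polynomial.X)), fun n G r hG => ?_⟩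
  have : NeZero n := ⟨r.pos.ne'⟩
  obtain ⟨par, hp⟩ := hG.exists_isParentMap r
  obtain ⟨τ, time, hexec, htime, -, per, f, hper, hplace, hopt⟩ :=
    RAM.Prog.exec_of_wp _ (RAM.computeSchedule_wp hp) (RAM.graphInput_bounded G r)
  obtain ⟨S, hS, hratio, hreg⟩ := hplace.exists_schedule hp hper (Fintype.card_fin n)
    (RAM.isProcessingOrder hp).key_injective RAM.subtreeSize_le_of_sizeKey_lt hopt
  refine ⟨τ, time, hexec, ?_, S, hS, hratio, hreg, hplace.pow_two hper⟩
  simpa [Polynomial.eval_comp] using htime
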